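/- Let $(M,\pi)$ be a (finite-dimensional, Hausdorff, second countable) Poisson manifold, with bracket $\{f,g\}=\pi(df,dg)$, and let $H\in C^\infty(M)$, with Hamiltonian vector field $X_H=\{H,\cdot\}$ and flow $\phi^H_t$. All families below are smooth jointly in the parameters $\epsilon\in[0,\epsilon_0)$, $h\in[0,h_0)$ and the point. *Exact data.* Let $(S,\omega)$ be a symplectic manifold, with the conventions $\omega(X_G,\cdot)=dG$ and $\{G,f\}_\omega=X_G(f)$. For every $\epsilon\in[0,\epsilon_0)$ let $R_\epsilon=(S,\omega,\alpha_\epsilon,\beta_\epsilon,\sigma)$ be realization data for $(M,\epsilon\pi)$: $\alpha_\epsilon:S\to M$ is a Poisson map and $\beta_\epsilon:S\to M$ an anti-Poisson map for $\epsilon\pi$, $\ker D\alpha_\epsilon=(\ker D\beta_\epsilon)^{\omega}$ at every point, and $\sigma:M\to S$ is smooth, independent of $\epsilon$, a section of both $\alpha_\epsilon$ and $\beta_\epsilon$, and has Lagrangian image. Put $L_{\epsilon,h}=\phi^{\alpha_\epsilon^*H}_h(\sigma(M))$, where $\phi^{\alpha_\epsilon^*H}_h$ is the Hamiltonian flow of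 $H\circ\alpha_\epsilon$ in $(S,\omega)$. *Approximate data.* Let $n,m\ge 0$ be integers. - Let $\hat\alpha_\epsilon,\hat\beta_\epsilon:S\to M$ be families with $\hat\alpha_\epsilon=\alpha_\epsilon$ and $\hat\beta_\epsilon=\beta_\epsilon$ modulo $O(\epsilon^{n+1})$, uniformly on compact sets. Here, for maps into a manifold, an estimate $O(\cdot)$ on the difference of two maps means that this estimate holds for the difference of their compositions with every smooth real function on the target. - Identify a neighbourhood of the zero section of $T^*M$ with a neighbourhood of $\sigma(M)$ in $S$ by a diffeomorphism taking the zero section to $\sigma$ (for instance the symplectic one given by the Lagrangian tubular neighbourhood theorem). Let $\hat L_{\epsilon,h}\subset S$ be the submanifold corresponding to the graph of a 1-form $\hat\theta_{\epsilon,h}$ on $M$; assume that $\hat L_{\epsilon,h}$ is Lagrangian in $(S,\omega)$ and that $\hat L_{\epsilon,0}=\sigma(M)$. - Assume that $\hat L_{\epsilon,h}$ approximates $L_{\epsilon,h}$ to order $m$ in $h$: for every compact $K\subset M$, at the points $(x,p)$ of $T^*M$ that correspond to points of $\phi^{\alpha_\epsilon^*H}_h(\sigma(K))$ one has $\hat\theta_{\epsilon,h}(x)-p=O(h^{m+1})$,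 uniformly over these points and over small $\epsilon\geq 0$ (that is, after evaluation on any smooth vector field of $M$). *Conclusion.* Let $V\subset M$ be open with compact closure and $K\subset V$ compact (if $M$ is compact, one may take $K=V=M$), and let $\hat L^V_{\epsilon,h}$ be the part of $\hat L_{\epsilon,h}$ given by the graph over $V$. Then there are $\epsilon_1\in(0,\epsilon_0)$ and $h_1\in(0,h_0)$ such that, for all $\epsilon\in[0,\epsilon_1]$ and $h\in[0,h_1]$, the maps $\hat\alpha_\epsilon$ and $\hat\beta_\epsilon$ restrict to diffeomorphisms from $\hat L^V_{\epsilon,h}$ onto open subsets of $M$ that contain $K$, the flow $\phi^H_{\epsilon h}$ is defined on $K$, and the induced map $$\hat\phi_{\epsilon,h}=\hat\alpha_\epsilon\circ\big(\hat\beta_\epsilon|_{\hat L^V_{\epsilon,h}}\big)^{-1}$$ has the following properties, with all constants uniform over $\epsilon\in[0,\epsilon_1]$, $h\in[0,h_1]$ and over $K$: 1. $\hat\phi_{\epsilon,h}^*\pi-\pi=O(\epsilon^{n+1})$ on $K$, that is, after evaluation on $(df,dg)$ for any $f,g\in C^\infty(M)$; 2. $\hat\phi_{\epsilon,h}^*C-C=O(\epsilon^{n+1})$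 on $K$ for every Casimir $C\in C^\infty(M)$ of $\pi$; 3. $\hat\phi_{\epsilon,h}=\phi^H_{\epsilon h}$ up to $O(\epsilon^{n+1})+O(h^{m+1})$ on $K$; 4. in particular, $\hat\phi_{\epsilon,h}=\phi^H_{\epsilon h}$ up to $O\big(\max\{\epsilon,h\}^{\min\{n,m\}+1}\big)$ on $K$. -/

import Mathlib

open Set
open scoped Manifold ContDiff Topology

noncomputable section

namespace PoissonIntegrator

variable {E : Type*} [NormedAddCommGroup E] [NormedSpace ℝ E]
  {M : Type*} [TopologicalSpace M] [ChartedSpace E M]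
  {F : Type*} [NormedAddCommGroup F] [NormedSpace ℝ F]
  {S : Type*} [TopologicalSpace S] [ChartedSpace F S]

/-- Real-valued functions of class `C^∞` on a manifold. -/
def IsSmoothFun (E : Type*) [NormedAddCommGroup E] [NormedSpace ℝ E]
    {M : Type*} [TopologicalSpace M] [ChartedSpace E M] (f : M → ℝ) : Prop :=
  ContMDiff 𝓘(ℝ, E) 𝓘(ℝ, ℝ) ∞ f

/-- Smooth vector fields. -/
def IsSmoothVF [IsManifold 𝓘(ℝ, E) ∞ M] (X : ∀ x : M, TangentSpace 𝓘(ℝ, E) x) : Prop :=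
  ContMDiff 𝓘(ℝ, E) 𝓘(ℝ, E).tangent ∞ (fun x => (⟨x, X x⟩ : TangentBundle 𝓘(ℝ, E) M))

/-! ### Poisson structures -/

/-- The bracket `{f, g} = dg (P (df))` of a field `P` of linear maps `T*M → TM`. -/
def bracketOf (P : ∀ x : M, (TangentSpace 𝓘(ℝ, E) x →L[ℝ] ℝ) →ₗ[ℝ] TangentSpace 𝓘(ℝ, E) x)
    (f g : M → ℝ) : M → ℝ :=
  fun x => mvfderiv 𝓘(ℝ, E) g x (P x (mvfderiv 𝓘(ℝ, E) f x))

/-- A Poisson tensor `π` on `M`, given by its contraction `π^♯ : T*M → TM`,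
`π(ξ, η) = η (π^♯ ξ)`: it is skew-symmetric, smooth, and the bracket `{f, g} = π(df, dg)`
satisfies the Jacobi identity. (The Leibniz rule is automatic for a tensor.) -/
structure PoissonTensor (E : Type*) [NormedAddCommGroup E] [NormedSpace ℝ E]
    (M : Type*) [TopologicalSpace M] [ChartedSpace E M] where
  sharp : ∀ x : M, (TangentSpace 𝓘(ℝ, E) x →L[ℝ] ℝ) →ₗ[ℝ] TangentSpace 𝓘(ℝ, E) x
  skew : ∀ (x : M) (ξ η : TangentSpace 𝓘(ℝ, E) x →L[ℝ] ℝ), η (sharp x ξ) = -ξ (sharp x η)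
  smooth : ∀ f g : M → ℝ, IsSmoothFun E f → IsSmoothFun E g → IsSmoothFun E (bracketOf sharp f g)
  jacobi : ∀ f g h : M → ℝ, IsSmoothFun E f → IsSmoothFun E g → IsSmoothFun E h → ∀ x : M,
    bracketOf sharp (bracketOf sharp f g) h x + bracketOf sharp (bracketOf sharp h f) g x
      + bracketOf sharp (bracketOf sharp g h) f x = 0

namespace PoissonTensor

/-- The value `π_x(ξ, η)`. -/
def eval (π : PoissonTensor E M) (x : M) (ξ η : TangentSpace 𝓘(ℝ, E) x →L[ℝ] ℝ) : ℝ :=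
  η (π.sharp x ξ)

/-- The Poisson bracket `{f, g} = π(df, dg)`. -/
def bracket (π : PoissonTensor E M) (f g : M → ℝ) : M → ℝ := bracketOf π.sharp f g

/-- The Hamiltonian vector field `X_H`, characterized by `{H, f} = X_H(f)`. -/
def hamVF (π : PoissonTensor E M) (H : M → ℝ) (x : M) : TangentSpace 𝓘(ℝ, E) x :=
  π.sharp x (mvfderiv 𝓘(ℝ, E) H x)

/-- Casimir functions: smooth functions that commute with all smooth functions. -/
def IsCasimir (π : PoissonTensor E M) (C : M → ℝ) : Prop :=
  IsSmoothFun E C ∧ ∀ f : M → ℝ, IsSmoothFun E f → ∀ x, π.bracket C f x = 0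

theorem bracketOf_smul (c : ℝ)
    (P : ∀ x : M, (TangentSpace 𝓘(ℝ, E) x →L[ℝ] ℝ) →ₗ[ℝ] TangentSpace 𝓘(ℝ, E) x)
    (f g : M → ℝ) : bracketOf (fun x => c • P x) f g = fun x => c * bracketOf P f g x := by
  funext x
  simp [bracketOf]

theorem bracketOf_const_mul (c : ℝ)
    (P : ∀ x : M, (TangentSpace 𝓘(ℝ, E) x →L[ℝ] ℝ) →ₗ[ℝ] TangentSpace 𝓘(ℝ, E) x)
    (f g : M → ℝ) (hf : IsSmoothFun E f) (x : M) :
    bracketOf P (fun y => c * f y) g x = c * bracketOf P f g x := by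
  have h : mvfderiv 𝓘(ℝ, E) (fun y => c * f y) x = c • mvfderiv 𝓘(ℝ, E) f x := by
    have h1 := mvfderiv_mul (I := 𝓘(ℝ, E)) (f := fun _ : M => c) (g := f) (x := x)
      mdifferentiableAt_const ((hf x).mdifferentiableAt (by simp))
    rw [mvfderiv_const] at h1
    simpa [Pi.mul_def] using h1
  simp [bracketOf, h]

/-- The Poisson tensor `c π`. -/
def scale (c : ℝ) (π : PoissonTensor E M) : PoissonTensor E M where
  sharp := fun x => c • π.sharp x
  skew := by
    intro x ξ η
    simp [π.skew x ξ η]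
  smooth := by
    intro f g hf hg
    rw [bracketOf_smul]
    exact contMDiff_const.mul (π.smooth f g hf hg)
  jacobi := by
    intro f g h hf hg hh x
    simp only [bracketOf_smul]
    rw [bracketOf_const_mul c _ _ _ (π.smooth f g hf hg),
      bracketOf_const_mul c _ _ _ (π.smooth h f hh hf),
      bracketOf_const_mul c _ _ _ (π.smooth g h hg hh)]
    linear_combination c * c * π.jacobi f g h hf hg hh x

/-- The pullback `φ^*π`,
`(φ^*π)_x(ξ, η) = π_{φ(x)}(ξ ∘ (D_xφ)⁻¹, η ∘ (D_xφ)⁻¹)`, of a Poisson tensor by a map that is a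
local diffeomorphism at `x`. -/
def pullbackEval (π : PoissonTensor E M) (φ : M → M) (x : M)
    (ξ η : TangentSpace 𝓘(ℝ, E) x →L[ℝ] ℝ) : ℝ :=
  π.eval (φ x) (ξ ∘L (mfderiv 𝓘(ℝ, E) 𝓘(ℝ, E) φ x).inverse)
    (η ∘L (mfderiv 𝓘(ℝ, E) 𝓘(ℝ, E) φ x).inverse)

end PoissonTensor

/-! ### Symplectic structures -/

/-- A symplectic form on `S`: a smooth, closed, non-degenerate 2-form. Closedness is written
`dΩ(X, Y, Z) = 0` for all smooth vector fields `X, Y, Z`. -/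
structure SymplecticForm (F : Type*) [NormedAddCommGroup F] [NormedSpace ℝ F]
    (S : Type*) [TopologicalSpace S] [ChartedSpace F S] [IsManifold 𝓘(ℝ, F) ∞ S] where
  form : ∀ s : S, TangentSpace 𝓘(ℝ, F) s →ₗ[ℝ] TangentSpace 𝓘(ℝ, F) s →ₗ[ℝ] ℝ
  skew : ∀ (s : S) (v w : TangentSpace 𝓘(ℝ, F) s), form s v w = -form s w v
  nondegenerate : ∀ (s : S) (v : TangentSpace 𝓘(ℝ, F) s), (∀ w, form s v w = 0) → v = 0
  smooth : ∀ X Y : ∀ s : S, TangentSpace 𝓘(ℝ, F) s, IsSmoothVF X → IsSmoothVF Y →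
    IsSmoothFun F (fun s => form s (X s) (Y s))
  closed : ∀ X Y Z : ∀ s : S, TangentSpace 𝓘(ℝ, F) s,
    IsSmoothVF X → IsSmoothVF Y → IsSmoothVF Z → ∀ s : S,
    mvfderiv 𝓘(ℝ, F) (fun s => form s (Y s) (Z s)) s (X s)
      - mvfderiv 𝓘(ℝ, F) (fun s => form s (X s) (Z s)) s (Y s)
      + mvfderiv 𝓘(ℝ, F) (fun s => form s (X s) (Y s)) s (Z s)
      - form s (VectorField.mlieBracket 𝓘(ℝ, F) X Y s) (Z s)
      + form s (VectorField.mlieBracket 𝓘(ℝ, F) X Z s) (Y s)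
      - form s (VectorField.mlieBracket 𝓘(ℝ, F) Y Z s) (X s) = 0

section Symplectic

variable [FiniteDimensional ℝ F] [IsManifold 𝓘(ℝ, F) ∞ S]

theorem SymplecticForm.exists_dual (Ω : SymplecticForm F S) (s : S)
    (ξ : TangentSpace 𝓘(ℝ, F) s →L[ℝ] ℝ) : ∃ v, ∀ w, Ω.form s v w = ξ w := by
  have : FiniteDimensional ℝ (TangentSpace 𝓘(ℝ, F) s) := inferInstanceAs (FiniteDimensional ℝ F)
  have hinj : Function.Injective (Ω.form s) := by
    rw [← LinearMap.ker_eq_bot, LinearMap.ker_eq_bot']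
    intro v hv
    exact Ω.nondegenerate s v (fun w => by rw [hv]; rfl)
  have hsurj : Function.Surjective (Ω.form s) :=
    (LinearMap.injective_iff_surjective_of_finrank_eq_finrank
      (Subspace.dual_finrank_eq (K := ℝ) (V := TangentSpace 𝓘(ℝ, F) s)).symm).1 hinj
  obtain ⟨v, hv⟩ := hsurj (ξ : TangentSpace 𝓘(ℝ, F) s →ₗ[ℝ] ℝ)
  exact ⟨v, fun w => by rw [hv]; rfl⟩

/-- The Hamiltonian vector field `X_G` of `G : S → ℝ`, the unique solution of `Ω(X_G, ·) = dG`. -/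
def SymplecticForm.hamVF (Ω : SymplecticForm F S) (G : S → ℝ) (s : S) :
    TangentSpace 𝓘(ℝ, F) s :=
  (Ω.exists_dual s (mvfderiv 𝓘(ℝ, F) G s)).choose

/-- The bracket `{f, g}_Ω = X_f(g)`. -/
def SymplecticForm.bracket (Ω : SymplecticForm F S) (f g : S → ℝ) (s : S) : ℝ :=
  mvfderiv 𝓘(ℝ, F) g s (Ω.hamVF f s)

/-- Smooth Poisson maps from a symplectic manifold to a Poisson manifold. -/
def IsPoissonMap (Ω : SymplecticForm F S) (π : PoissonTensor E M) (a : S → M) : Prop :=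
  ContMDiff 𝓘(ℝ, F) 𝓘(ℝ, E) ∞ a ∧
    ∀ f g : M → ℝ, IsSmoothFun E f → IsSmoothFun E g → ∀ s : S,
      Ω.bracket (f ∘ a) (g ∘ a) s = π.bracket f g (a s)

/-- The image of the immersion `i : M → S` is Lagrangian: it is isotropic of half the dimension
of `S`. -/
def IsLagrangianEmb (E : Type*) [NormedAddCommGroup E] [NormedSpace ℝ E]
    {M : Type*} [TopologicalSpace M] [ChartedSpace E M] (Ω : SymplecticForm F S)
    (i : M → S) : Prop :=
  Module.finrank ℝ F = 2 * Module.finrank ℝ E ∧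
    ∀ (x : M) (v w : TangentSpace 𝓘(ℝ, E) x),
      Ω.form (i x) (mfderiv 𝓘(ℝ, E) 𝓘(ℝ, F) i x v) (mfderiv 𝓘(ℝ, E) 𝓘(ℝ, F) i x w) = 0

/-- `(S, Ω, α, β, σ)` is realization data for `(M, π)`: `α` is Poisson, `β` is anti-Poisson, their
fibers are `Ω`-orthogonal, and `σ` is a section of both with Lagrangian image. -/
structure IsRealizationData (Ω : SymplecticForm F S) (π : PoissonTensor E M)
    (α β : S → M) (σ : M → S) : Prop where
  poisson : IsPoissonMap Ω π α
  antiPoisson : IsPoissonMap Ω (π.scale (-1)) β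
  orthogonal : ∀ (s : S) (v : TangentSpace 𝓘(ℝ, F) s),
    mfderiv 𝓘(ℝ, F) 𝓘(ℝ, E) α s v = 0 ↔
      ∀ w : TangentSpace 𝓘(ℝ, F) s, mfderiv 𝓘(ℝ, F) 𝓘(ℝ, E) β s w = 0 → Ω.form s v w = 0
  smooth_section : ContMDiff 𝓘(ℝ, E) 𝓘(ℝ, F) ∞ σ
  section_left : ∀ x, α (σ x) = x
  section_right : ∀ x, β (σ x) = x
  lagrangian : IsLagrangianEmb E Ω σ

end Symplectic

/-! ### Flows, families and approximation -/

/-- `y = φ^X_t(x)`, for the flow of the vector field `X` and `t ≥ 0`: some integral curve of `X`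
defined on `[0, t]` goes from `x` to `y`. -/
def FlowsTo (X : ∀ x : M, TangentSpace 𝓘(ℝ, E) x) (t : ℝ) (x y : M) : Prop :=
  ∃ γ : ℝ → M, IsMIntegralCurveOn γ X (Icc 0 t) ∧ γ 0 = x ∧ γ t = y

/-- The set `φ^X_t(A)` of the endpoints at time `t` of the integral curves starting in `A`. -/
def flowImage (X : ∀ x : M, TangentSpace 𝓘(ℝ, E) x) (t : ℝ) (A : Set M) : Set M :=
  {y | ∃ x ∈ A, FlowsTo X t x y}

/-- A family of maps `a_ε : S → M`, smooth jointly in `ε ∈ [0, ε₀)` and the point. -/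
def IsSmoothFamily (E F : Type*) [NormedAddCommGroup E] [NormedSpace ℝ E]
    [NormedAddCommGroup F] [NormedSpace ℝ F] {M : Type*} [TopologicalSpace M] [ChartedSpace E M]
    {S : Type*} [TopologicalSpace S] [ChartedSpace F S] (ε₀ : ℝ) (a : ℝ → S → M) : Prop :=
  ContMDiffOn (𝓘(ℝ, ℝ).prod 𝓘(ℝ, F)) 𝓘(ℝ, E) ∞ (fun q : ℝ × S => a q.1 q.2)
    (Ico 0 ε₀ ×ˢ univ)

/-- `a_ε = b_ε mod O(ε^(n+1))`, uniformly on compact sets, for families of maps into a manifold: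
the difference of the two families is measured by every smooth function on the target (for
continuous families into a vector space, this amounts to measuring it with a norm). -/
def ApproxToOrder (E : Type*) [NormedAddCommGroup E] [NormedSpace ℝ E]
    {M : Type*} [TopologicalSpace M] [ChartedSpace E M] {S : Type*} [TopologicalSpace S]
    (n : ℕ) (a b : ℝ → S → M) : Prop :=
  ∀ g : M → ℝ, IsSmoothFun E g → ∀ K : Set S, IsCompact K →
    ∃ C : ℝ, ∃ ε₁ > 0, ∀ ε ∈ Icc 0 ε₁, ∀ s ∈ K, |g (a ε s) - g (b ε s)| ≤ C * ε ^ (n + 1)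

/-! ### Bisections -/

/-- The restriction of `a : S → M` to `L` is a diffeomorphism onto the open set `U`: it is a
bijection whose inverse is smooth as a map `U → S`. (Then `L` is an embedded submanifold,
parametrized by this inverse.) -/
def RestrictsToDiffeo (E F : Type*) [NormedAddCommGroup E] [NormedSpace ℝ E]
    [NormedAddCommGroup F] [NormedSpace ℝ F] {M : Type*} [TopologicalSpace M] [ChartedSpace E M]
    {S : Type*} [TopologicalSpace S] [ChartedSpace F S]
    (a : S → M) (L : Set S) (U : Set M) : Prop :=
  IsOpen U ∧ BijOn a L U ∧
    ∃ τ : M → S, ContMDiffOn 𝓘(ℝ, E) 𝓘(ℝ, F) ∞ τ U ∧ MapsTo τ U L ∧ ∀ x ∈ U, a (τ x) = x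

open Classical in
/-- The map `α ∘ (β|_L)⁻¹` induced by a bisection `L` (and the identity off `β(L)`). -/
def inducedMap (α β : S → M) (L : Set S) (x : M) : M :=
  if h : ∃ z ∈ L, β z = x then α h.choose else x

/-! ### Lagrangians as 1-forms -/

section Cotangent

variable [IsManifold 𝓘(ℝ, E) ∞ M]

/-- The cotangent bundle `T*M`. -/
abbrev CotangentBundle (E : Type*) [NormedAddCommGroup E] [NormedSpace ℝ E]
    (M : Type*) [TopologicalSpace M] [ChartedSpace E M] [IsManifold 𝓘(ℝ, E) ∞ M] : Type _ :=
  Bundle.TotalSpace (E →L[ℝ] ℝ) (fun x : M => TangentSpace 𝓘(ℝ, E) x →L[ℝ] ℝ)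

/-- A tubular neighbourhood of `σ(M)` in `S` modelled on `T*M`: a diffeomorphism from an open
neighbourhood of the zero section of `T*M` onto an open neighbourhood of `σ(M)` which sends the
zero covector at `x` to `σ(x)`. (The identification may be symplectic for the canonical form of
`T*M`, as it is when it comes from the Lagrangian tubular neighbourhood theorem, but it need
not be.) -/
structure IsTubularNeighbourhood (Ψ : OpenPartialHomeomorph (CotangentBundle E M) S)
    (σ : M → S) : Prop where
  smooth : ContMDiffOn (𝓘(ℝ, E).prod 𝓘(ℝ, E →L[ℝ] ℝ)) 𝓘(ℝ, F) ∞ Ψ Ψ.source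
  smooth_symm : ContMDiffOn 𝓘(ℝ, F) (𝓘(ℝ, E).prod 𝓘(ℝ, E →L[ℝ] ℝ)) ∞ Ψ.symm Ψ.target
  zero_mem : ∀ x : M, (⟨x, 0⟩ : CotangentBundle E M) ∈ Ψ.source
  zero_eq : ∀ x : M, Ψ ⟨x, 0⟩ = σ x

/-- The parametrization `x ↦ Ψ(θ(x))` of the horizontal submanifold of a 1-form `θ`. -/
def graphMap (Ψ : OpenPartialHomeomorph (CotangentBundle E M) S)
    (θ : ∀ x : M, TangentSpace 𝓘(ℝ, E) x →L[ℝ] ℝ) (x : M) : S :=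
  Ψ ⟨x, θ x⟩

/-- The family of submanifolds `L_{ε,h} = Ψ(θ_{ε,h}(M))`, for `ε ∈ [0, ε₀)` and `h ∈ [0, h₀)`,
is a smooth family of Lagrangian submanifolds of `(S, Ω)` with `L_{ε,0} = σ(M)`. -/
structure IsLagrangianFamily [IsManifold 𝓘(ℝ, F) ∞ S] (Ω : SymplecticForm F S)
    (Ψ : OpenPartialHomeomorph (CotangentBundle E M) S) (ε₀ h₀ : ℝ)
    (θ : ℝ → ℝ → ∀ x : M, TangentSpace 𝓘(ℝ, E) x →L[ℝ] ℝ) : Prop where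
  smooth : ContMDiffOn (𝓘(ℝ, ℝ × ℝ).prod 𝓘(ℝ, E)) (𝓘(ℝ, E).prod 𝓘(ℝ, E →L[ℝ] ℝ)) ∞
    (fun q : (ℝ × ℝ) × M => (⟨q.2, θ q.1.1 q.1.2 q.2⟩ : CotangentBundle E M))
    ((Ico 0 ε₀ ×ˢ Ico 0 h₀) ×ˢ univ)
  mem_source : ∀ ε ∈ Ico 0 ε₀, ∀ h ∈ Ico 0 h₀, ∀ x : M,
    (⟨x, θ ε h x⟩ : CotangentBundle E M) ∈ Ψ.source
  lagrangian : ∀ ε ∈ Ico 0 ε₀, ∀ h ∈ Ico 0 h₀, IsLagrangianEmb E Ω (graphMap Ψ (θ ε h))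
  at_zero : ∀ ε ∈ Ico 0 ε₀, ∀ x : M, θ ε 0 x = 0

/-- The family `θ_{ε,h}` approximates to order `m` in `h` the exact Lagrangians
`L_{ε,h} = φ_h^{α_ε^*H}(σ(M))`, uniformly on compact sets and uniformly for small `ε`: at each point
`x` lying under a point `Ψ(x, p)` of `φ_h^{α_ε^*H}(σ(K))`, with `K` compact, `p` is the value at `x`
of the 1-form of `L_{ε,h}`, and it differs from `θ_{ε,h}(x)` by `O(h^(m+1))`, the difference being
measured by any smooth vector field. -/
def ApproxLagrangian [FiniteDimensional ℝ F] [IsManifold 𝓘(ℝ, F) ∞ S] (Ω : SymplecticForm F S)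
    (Ψ : OpenPartialHomeomorph (CotangentBundle E M) S) (σ : M → S) (α : ℝ → S → M) (H : M → ℝ)
    (m : ℕ) (θ : ℝ → ℝ → ∀ x : M, TangentSpace 𝓘(ℝ, E) x →L[ℝ] ℝ) : Prop :=
  ∀ X : ∀ x : M, TangentSpace 𝓘(ℝ, E) x, IsSmoothVF X → ∀ K : Set M, IsCompact K →
    ∃ C : ℝ, ∃ ε₁ > 0, ∃ h₁ > 0, ∀ ε ∈ Icc 0 ε₁, ∀ h ∈ Icc 0 h₁,
      ∀ (x : M) (p : TangentSpace 𝓘(ℝ, E) x →L[ℝ] ℝ),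
        (⟨x, p⟩ : CotangentBundle E M) ∈ Ψ.source →
        Ψ ⟨x, p⟩ ∈ flowImage (Ω.hamVF (H ∘ α ε)) h (σ '' K) →
        |θ ε h x (X x) - p (X x)| ≤ C * h ^ (m + 1)

end Cotangent

end PoissonIntegrator

end

open PoissonIntegrator

/-! In exact realization data every Lagrangian bisection `L` induces a Poisson map. At a point of
`L`, let `ξ` be the covector at the `α`-end that corresponds to `df` at the `β`-end, and let `u`,
`w` be the symplectic duals of `α^*ξ` and `β^*df`. These two covectors agree on `TL`, so `u - w` is
orthogonal to `TL`, hence tangent to it, and `Dα`, `Dβ` send it to `π^♯ξ` and `π^♯df`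
(`IsRealizationData.eval_eq_bracket`). Replacing the exact Lagrangian by an approximate one
therefore costs nothing for the Poisson property; only the replacement of `α`, `β` by `α'`, `β'`
does.

The data at `ε` realize `επ`. For `ε > 0` the factor `ε` cancels. At `ε = 0` the structure vanishes
and every smooth function is a Casimir. Casimirs have equal pullbacks by `α` and `β` near the
section: `d(c ∘ α)` vanishes along the fibers of `β`, and a nearby point of a fiber is joined to the
section inside that fiber (`eventually_casimir_eq`). Hence `α_0 = β_0` there and the induced map is
the identity. The same lemma gives the estimate for Casimirs.

Passing to `α'`, `β'` changes values by `O(ε^(n+1))`. The pullback of `π` also involves first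
derivatives along `M`. These directions are tangent to the hyperplane `ε = 0`, so no order is lost
(`fderiv_tangent_isBigO`), and the pullback is a C¹ function of the first jets
(`PoissonTensor.isBigO_transportEval_sub`).

For the flow, `X_{H ∘ α}` is tangent to the fibers of `β` and projects by `α` to `εX_H`, so the
exact Lagrangian induces the flow of `X_H` at time `εh`. Over the same base point the approximate
Lagrangian is `O(h^(m+1))` away in cotangent coordinates, and all maps involved, including the local
inverse of `β'` on the bisection, are Lipschitz (`isBigO_flow_sub`).

The families are smooth only for `ε, h ≥ 0`. The substitution `ε = a ^ 2`, `h = b ^ 2` makes them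
smooth around `(a, b) = 0`, where the bisection maps are the identity. The inverse function theorem
and Taylor expansions then apply, with orders doubled, and compactness makes the local estimates
uniform (`exists_bound_of_isBigO`). -/

noncomputable section

namespace PoissonIntegrator

open Filter Asymptotics

/-! ### Orders of vanishing and Taylor expansion -/

section Calculus

variable {E' : Type*} [NormedAddCommGroup E'] [NormedSpace ℝ E']

/-- Mean value inequality on the closed ball of radius `|t|`, where `|x| ^ k` is largest at the
boundary. -/
theorem isBigO_pow_succ_of_deriv {G : ℝ → E'} {k : ℕ}
    (hG : ∀ᶠ t in 𝓝 (0 : ℝ), DifferentiableAt ℝ G t)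
    (h0 : G 0 = 0) (h : deriv G =O[𝓝 0] fun t : ℝ => t ^ k) :
    G =O[𝓝 0] fun t : ℝ => t ^ (k + 1) := by
  obtain ⟨C, hC⟩ := h.bound
  obtain ⟨r, hr, hball⟩ := Metric.eventually_nhds_iff_ball.1 (hG.and hC)
  refine IsBigO.of_bound C ?_
  filter_upwards [Metric.ball_mem_nhds (0 : ℝ) hr] with t ht
  have key := Convex.norm_image_sub_le_of_norm_deriv_le (f := G) (C := C * ‖t ^ k‖)
    (s := Metric.closedBall 0 |t|) (x := 0) (y := t) ?_ ?_ (convex_closedBall _ _) (by simp)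
    (by simp)
  · rw [h0, sub_zero, sub_zero] at key
    rw [pow_succ, norm_mul, ← mul_assoc]
    exact key
  · intro x hx
    refine (hball x ?_).1
    simp only [Metric.mem_closedBall, Metric.mem_ball, dist_zero_right, Real.norm_eq_abs] at *
    linarith
  · intro x hx
    have hx' : x ∈ Metric.ball (0 : ℝ) r := by
      simp only [Metric.mem_closedBall, Metric.mem_ball, dist_zero_right, Real.norm_eq_abs] at *
      linarith
    have h1 := (hball x hx').2
    have hxt : ‖x ^ k‖ ≤ ‖t ^ k‖ := by
      rw [norm_pow, norm_pow]
      gcongr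
      simpa using hx
    rcases le_or_gt 0 C with hC0 | hC0
    · exact h1.trans (by gcongr)
    -- The constant of a big O carries no sign; a negative one is compatible with the bound only
    -- where `x ^ k = 0`.
    · have h2 : ‖x ^ k‖ = 0 ∨ 0 < ‖x ^ k‖ := by
        rcases (norm_nonneg (x ^ k)).eq_or_lt with h | h
        · exact Or.inl h.symm
        · exact Or.inr h
      have h3 : (0 : ℝ) ≤ C * ‖t ^ k‖ := by
        have h4 := (norm_nonneg _).trans (hball t ht).2
        exact h4
      rcases h2 with h2 | h2
      · rw [h2, mul_zero] at h1
        exact h1.trans h3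
      · nlinarith [norm_nonneg (deriv G x)]

theorem contDiffAt_deriv {g : ℝ → E'} {t : ℝ} (hg : ContDiffAt ℝ ∞ g t) :
    ContDiffAt ℝ ∞ (deriv g) t := by
  have h := hg.fderiv_right (m := ∞) (by simp)
  have : deriv g = fun s => fderiv ℝ g s 1 := by
    funext s; simp
  rw [this]
  exact h.clm_apply contDiffAt_const

theorem isBigO_pow_zero_of_contDiffAt {g : ℝ → E'} (hg : ContDiffAt ℝ ∞ g 0) :
    g =O[𝓝 0] fun t : ℝ => t ^ 0 := by
  simpa using hg.continuousAt.isBigO_one ℝ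

theorem eventually_differentiableAt_of_contDiffAt {Z : Type*} [NormedAddCommGroup Z]
    [NormedSpace ℝ Z] {g : Z → E'} {z : Z} (hg : ContDiffAt ℝ ∞ g z) :
    ∀ᶠ t in 𝓝 z, DifferentiableAt ℝ g t := by
  have h1 : ContDiffAt ℝ 1 g z := hg.of_le (by simp)
  filter_upwards [h1.eventually (by simp)] with t ht
  exact ht.differentiableAt (by simp)

/-- One more term of the Taylor expansion of a smooth function of one variable, and the order of
vanishing of its derivative. -/
theorem taylor_step (k : ℕ) : ∀ g : ℝ → E', ContDiffAt ℝ ∞ g 0 →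
    ((g =O[𝓝 0] fun t : ℝ => t ^ k) →
      ∃ A : E', (fun t => g t - t ^ k • A) =O[𝓝 0] fun t : ℝ => t ^ (k + 1)) ∧
    ((g =O[𝓝 0] fun t : ℝ => t ^ (k + 1)) → deriv g =O[𝓝 0] fun t : ℝ => t ^ k) := by
  induction k with
  | zero =>
    intro g hg
    refine ⟨fun _ => ⟨g 0, ?_⟩, fun _ => isBigO_pow_zero_of_contDiffAt (contDiffAt_deriv hg)⟩
    have hd : DifferentiableAt ℝ g 0 := hg.differentiableAt (by simp)
    simpa using hd.hasFDerivAt.isBigO_sub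
  | succ k ih =>
    intro g hg
    -- Pass to `deriv g`, expand it by one term with the induction hypothesis, and integrate: the
    -- coefficient `A` becomes `A / (k + 1)`.
    have key : (g =O[𝓝 0] fun t : ℝ => t ^ (k + 1)) → ∃ A : E',
        ((fun t => deriv g t - t ^ k • A) =O[𝓝 0] fun t : ℝ => t ^ (k + 1)) ∧
        (fun t => g t - t ^ (k + 1) • ((k + 1 : ℝ)⁻¹ • A)) =O[𝓝 0]
          fun t : ℝ => t ^ (k + 1 + 1) := by
      intro h
      obtain ⟨A, hA⟩ := (ih (deriv g) (contDiffAt_deriv hg)).1 ((ih g hg).2 h)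
      refine ⟨A, hA, ?_⟩
      have hg0 : g 0 = 0 := by
        have := h.eq_zero_imp.self_of_nhds
        exact this (by simp)
      have hder : ∀ t, DifferentiableAt ℝ g t →
          HasDerivAt (fun t => g t - t ^ (k + 1) • ((k + 1 : ℝ)⁻¹ • A))
            (deriv g t - t ^ k • A) t := by
        intro t ht
        have h1 := (hasDerivAt_pow (k + 1) t).smul_const ((k + 1 : ℝ)⁻¹ • A)
        have h2 := ht.hasDerivAt.sub h1
        have h3 : (k + 1 : ℝ) ≠ 0 := by positivity
        have h4 : ((k + 1 : ℕ) * t ^ (k + 1 - 1) : ℝ) • ((k + 1 : ℝ)⁻¹ • A) = t ^ k • A := by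
          rw [smul_smul]
          congr 1
          rw [Nat.add_sub_cancel]
          push_cast
          field_simp
        rw [h4] at h2
        exact h2
      have hev := eventually_differentiableAt_of_contDiffAt hg
      refine isBigO_pow_succ_of_deriv (hev.mono fun t ht => (hder t ht).differentiableAt)
        (by simp [hg0]) ?_
      refine hA.congr' ?_ EventuallyEq.rfl
      filter_upwards [hev] with t ht
      exact (hder t ht).deriv.symm
    refine ⟨fun h => ?_, fun h => ?_⟩
    · obtain ⟨A, -, hA⟩ := key h
      exact ⟨_, hA⟩
    · have hle : (fun t : ℝ => t ^ (k + 1 + 1)) =O[𝓝 0] fun t : ℝ => t ^ (k + 1) :=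
        (isLittleO_pow_pow (Nat.lt_succ_self _)).isBigO
      obtain ⟨A, hA, hA'⟩ := key (h.trans hle)
      -- Otherwise `t ^ (k + 1)` times a nonzero vector would be `O(t ^ (k + 2))`.
      have hA0 : A = 0 := by
        have h1 : (fun t : ℝ => t ^ (k + 1) • ((k + 1 : ℝ)⁻¹ • A)) =O[𝓝 0]
            fun t : ℝ => t ^ (k + 1 + 1) := by
          simpa using h.sub hA'
        have h2 := h1.trans_isLittleO (isLittleO_pow_pow (𝕜 := ℝ) (Nat.lt_succ_self (k + 1)))
        by_contra hne
        have hpos : 0 < ‖(k + 1 : ℝ)⁻¹ • A‖ := by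
          rw [norm_pos_iff]
          exact smul_ne_zero (by positivity) hne
        have h3 := (h2.def (half_pos hpos)).filter_mono (nhdsWithin_le_nhds (s := {0}ᶜ))
        obtain ⟨t, ht, ht0⟩ := (h3.and self_mem_nhdsWithin).exists
        have ht1 : 0 < ‖t ^ (k + 1)‖ := by
          rw [norm_pos_iff]
          exact pow_ne_zero _ ht0
        rw [norm_smul] at ht
        nlinarith
      simpa [hA0] using hA

/-- If a smooth function vanishes to order `k` along the hyperplane `ℓ = 0`, then so do its
derivatives in the directions tangent to the hyperplane. -/
theorem fderiv_tangent_isBigO {Z : Type*} [NormedAddCommGroup Z] [NormedSpace ℝ Z]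
    (ℓ : Z →L[ℝ] ℝ) (e : Z) (he : ℓ e = 1) (k : ℕ) : ∀ (f : Z → E') (z₀ : Z), ℓ z₀ = 0 →
    (∀ᶠ z in 𝓝 z₀, ContDiffAt ℝ ∞ f z) →
    (∀ᶠ z in 𝓝 z₀, ℓ z = 0 → (fun t : ℝ => f (z + t • e)) =O[𝓝 0] fun t : ℝ => t ^ k) →
    ∀ v, ℓ v = 0 → (fun z => fderiv ℝ f z v) =O[𝓝 z₀] fun z => ℓ z ^ k := by
  induction k with
  | zero =>
    intro f z₀ _ hf _ v _
    have h1 : ContDiffAt ℝ ∞ (fun z => fderiv ℝ f z v) z₀ :=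
      (hf.self_of_nhds.fderiv_right (m := ∞) (by simp)).clm_apply contDiffAt_const
    simpa using h1.continuousAt.isBigO_one ℝ
  | succ k ih =>
    intro f z₀ hz₀ hf hO v hv
    have hsm : ∀ w : Z, ∀ᶠ z in 𝓝 z₀, ContDiffAt ℝ ∞ (fun z => fderiv ℝ f z w) z := by
      intro w
      filter_upwards [hf] with z hz
      exact (hz.fderiv_right (m := ∞) (by simp)).clm_apply contDiffAt_const
    have hline : ∀ z : Z, Tendsto (fun t : ℝ => z + t • e) (𝓝 0) (𝓝 z) := by
      intro z
      have : Continuous fun t : ℝ => z + t • e := by fun_prop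
      simpa using this.tendsto 0
    -- On each line in the direction `e`, the derivative `∂ₑf` vanishes to one order less, so the
    -- induction hypothesis applies to `∂ₑf`.
    have hstep : ∀ᶠ z in 𝓝 z₀, ℓ z = 0 →
        (fun t : ℝ => fderiv ℝ f (z + t • e) e) =O[𝓝 0] fun t : ℝ => t ^ k := by
      filter_upwards [hO, hf.eventually_nhds] with z hz hfz hz0
      have hsmooth : ContDiffAt ℝ ∞ (fun t : ℝ => f (z + t • e)) 0 := by
        refine ContDiffAt.comp (0 : ℝ) (g := f) (f := fun t : ℝ => z + t • e) ?_
          (by fun_prop)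
        simpa using hfz.self_of_nhds
      refine ((taylor_step k _ hsmooth).2 (hz hz0)).congr' ?_ EventuallyEq.rfl
      filter_upwards [(hline z).eventually hfz] with t ht
      have h1 : HasDerivAt (fun t : ℝ => z + t • e) e t := by
        simpa using ((hasDerivAt_id t).smul_const e).const_add z
      exact ((ht.differentiableAt (by simp)).hasFDerivAt.comp_hasDerivAt t h1).deriv
    have hcross := ih (fun z => fderiv ℝ f z e) z₀ hz₀ (hsm e) hstep v hv
    -- The induction hypothesis controls `∂ᵥ∂ₑf`; by symmetry of the second derivative it controls
    -- `∂ₑ∂ᵥf`, which will be integrated along `e`.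
    have hcross' : (fun z => fderiv ℝ (fun z => fderiv ℝ f z v) z e) =O[𝓝 z₀]
        fun z => ℓ z ^ k := by
      refine hcross.congr' ?_ EventuallyEq.rfl
      filter_upwards [hf] with z hz
      have hs : IsSymmSndFDerivAt ℝ f z := hz.isSymmSndFDerivAt (by
        rw [minSmoothness_of_isRCLikeNormedField]
        exact WithTop.coe_le_coe.2 (le_top : (2 : ℕ∞) ≤ ⊤))
      have hd : DifferentiableAt ℝ (fderiv ℝ f) z :=
        (hz.fderiv_right (m := ∞) (by simp)).differentiableAt (by simp)
      have hc : ∀ w w' : Z, fderiv ℝ (fun z => fderiv ℝ f z w) z w' =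
          fderiv ℝ (fderiv ℝ f) z w' w := by
        intro w w'
        rw [fderiv_clm_apply hd (differentiableAt_const w)]
        simp
      rw [hc, hc]
      exact hs.eq v e
    -- Initial value for that integration: `f` vanishes on the hyperplane, hence so do its
    -- derivatives along it.
    have hzero : ∀ᶠ z in 𝓝 z₀, ℓ z = 0 → fderiv ℝ f z v = 0 := by
      filter_upwards [hO.eventually_nhds, hf] with z hz hfz hz0
      have h1 : HasDerivAt (fun t : ℝ => z + t • v) v 0 := by
        simpa using ((hasDerivAt_id (0 : ℝ)).smul_const v).const_add z
      have h2 : HasFDerivAt f (fderiv ℝ f z) (z + (0 : ℝ) • v) := by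
        simpa using (hfz.differentiableAt (by simp)).hasFDerivAt
      have h3 := h2.comp_hasDerivAt (0 : ℝ) h1
      have hcont : Tendsto (fun t : ℝ => z + t • v) (𝓝 0) (𝓝 z) := by
        have : Continuous fun t : ℝ => z + t • v := by fun_prop
        simpa using this.tendsto 0
      have h4 : (f ∘ fun t : ℝ => z + t • v) =ᶠ[𝓝 0] fun _ => 0 := by
        filter_upwards [hcont.eventually hz] with t ht
        have h5 := ht (by simp [hz0, hv])
        have h6 := h5.eq_zero_imp.self_of_nhds
        simpa using h6 (by simp)
      have h7 : HasDerivAt (f ∘ fun t : ℝ => z + t • v) (0 : E') 0 :=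
        (hasDerivAt_const (0 : ℝ) (0 : E')).congr_of_eventuallyEq h4
      exact h3.unique h7
    obtain ⟨C, hC0, hC⟩ := hcross'.exists_nonneg
    rw [IsBigOWith] at hC
    obtain ⟨r, hr, hball⟩ :=
      Metric.eventually_nhds_iff_ball.1 (hC.and (hzero.and (hsm v)))
    have hproj : Tendsto (fun z => z - ℓ z • e) (𝓝 z₀) (𝓝 z₀) := by
      have : Continuous fun z => z - ℓ z • e := by fun_prop
      simpa [hz₀] using this.tendsto z₀
    refine IsBigO.of_bound C ?_
    filter_upwards [Metric.ball_mem_nhds z₀ hr, hproj.eventually (Metric.ball_mem_nhds z₀ hr)]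
      with z hz hz'
    -- The foot of `z` on the hyperplane; `ℓ z` is the length of the path from it to `z` in the
    -- direction `e`.
    set z' := z - ℓ z • e with hz'def
    have hℓz' : ℓ z' = 0 := by simp [hz'def, he]
    have hseg : ∀ t ∈ uIcc (0 : ℝ) (ℓ z), z' + t • e ∈ Metric.ball z₀ r := by
      intro t ht
      have hconv := (convex_ball z₀ r)
      have hpre : Convex ℝ ((fun t : ℝ => z' + t • e) ⁻¹' Metric.ball z₀ r) := by
        have : (fun t : ℝ => z' + t • e) = AffineMap.lineMap z' (z' + e) := by
          funext t
          simp [AffineMap.lineMap_apply, add_comm]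
        rw [this]
        exact hconv.affine_preimage _
      have h0 : (0 : ℝ) ∈ (fun t : ℝ => z' + t • e) ⁻¹' Metric.ball z₀ r := by simpa using hz'
      have h1 : ℓ z ∈ (fun t : ℝ => z' + t • e) ⁻¹' Metric.ball z₀ r := by
        simpa [hz'def] using hz
      have := hpre.segment_subset h0 h1
      rw [segment_eq_uIcc] at this
      exact this ht
    have hder : ∀ t ∈ uIcc (0 : ℝ) (ℓ z),
        HasDerivAt (fun t : ℝ => fderiv ℝ f (z' + t • e) v)
          (fderiv ℝ (fun z => fderiv ℝ f z v) (z' + t • e) e) t := by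
      intro t ht
      have h1 : HasDerivAt (fun t : ℝ => z' + t • e) e t := by
        simpa using ((hasDerivAt_id t).smul_const e).const_add z'
      exact ((hball _ (hseg t ht)).2.2.differentiableAt (by simp)).hasFDerivAt.comp_hasDerivAt t h1
    have key := Convex.norm_image_sub_le_of_norm_hasDerivWithin_le
      (f := fun t : ℝ => fderiv ℝ f (z' + t • e) v)
      (f' := fun t => fderiv ℝ (fun z => fderiv ℝ f z v) (z' + t • e) e)
      (s := uIcc (0 : ℝ) (ℓ z)) (C := C * |ℓ z| ^ k) (x := 0) (y := ℓ z)
      (fun t ht => (hder t ht).hasDerivWithinAt) ?_ (convex_uIcc _ _) left_mem_uIcc right_mem_uIcc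
    · have h0 : fderiv ℝ f (z' + (0 : ℝ) • e) v = 0 := by
        simpa using (hball z' hz').2.1 hℓz'
      have h1 : z' + ℓ z • e = z := by simp [hz'def]
      simp only [h0, h1, sub_zero] at key
      rw [pow_succ, norm_mul, norm_pow, ← mul_assoc]
      exact key
    · intro t ht
      refine (hball _ (hseg t ht)).1.trans ?_
      have : ℓ (z' + t • e) = t := by simp [hℓz', he]
      rw [this, norm_pow, Real.norm_eq_abs]
      have ht' : |t| ≤ |ℓ z| := by
        have := abs_sub_left_of_mem_uIcc ht
        simpa using this
      gcongr

/-- A family of linear maps on a finite-dimensional space is `O(δ)` as soon as its values are. -/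
theorem isBigO_clm_of_apply {ι Z : Type*} {E : Type*} [NormedAddCommGroup E] [NormedSpace ℝ E]
    [FiniteDimensional ℝ E] {l : Filter ι} {L : ι → E →L[ℝ] E'} {δ : ι → Z} [NormedAddCommGroup Z]
    (h : ∀ v, (fun i => L i v) =O[l] δ) : L =O[l] δ := by
  let b := Module.finBasis ℝ E
  obtain ⟨C, hC, hb⟩ := b.exists_opNorm_le (F := E')
  have hsum : (fun i => ∑ j, ‖L i (b j)‖) =O[l] δ :=
    IsBigO.fun_sum fun j _ => (h (b j)).norm_left
  refine IsBigO.trans (IsBigO.of_bound C (Eventually.of_forall fun i => ?_)) hsum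
  have hn : 0 ≤ ∑ j, ‖L i (b j)‖ := Finset.sum_nonneg fun j _ => norm_nonneg _
  rw [Real.norm_of_nonneg hn]
  exact hb hn fun j => Finset.single_le_sum (f := fun j => ‖L i (b j)‖)
    (fun j _ => norm_nonneg _) (Finset.mem_univ j)

/-- A map into a finite-dimensional space is `O(δ)` as soon as its coordinates are. -/
theorem isBigO_of_dual {ι Z : Type*} {E : Type*} [NormedAddCommGroup E] [NormedSpace ℝ E]
    [FiniteDimensional ℝ E] {l : Filter ι} {q : ι → E} {δ : ι → Z} [NormedAddCommGroup Z]
    (h : ∀ ξ : E →L[ℝ] ℝ, (fun i => ξ (q i)) =O[l] δ) : q =O[l] δ := by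
  let b := Module.finBasis ℝ E
  have h1 : (fun i => b.equivFunL (q i)) =O[l] δ := by
    rw [isBigO_pi]
    intro j
    exact h ((ContinuousLinearMap.proj (R := ℝ) (φ := fun _ => ℝ) j).comp
      (b.equivFunL : E →L[ℝ] _))
  exact ((b.equivFunL.symm : _ →L[ℝ] E).isBigO_comp (fun i => b.equivFunL (q i)) l |>.congr_left
    (by simp)).trans h1

/-- Local bounds on a compact set give a global bound. -/
theorem exists_bound_of_isBigO {E' : Type*} [NormedAddCommGroup E']
    {Z : Type*} [TopologicalSpace Z] {T : Set Z} (hT : IsCompact T)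
    {q : Z → E'} {δ : Z → ℝ} (hδ : ∀ z ∈ T, 0 ≤ δ z) (h : ∀ z ∈ T, q =O[𝓝[T] z] δ) :
    ∃ C : ℝ, 0 ≤ C ∧ ∀ z ∈ T, ‖q z‖ ≤ C * δ z := by
  have key : ∃ C : ℝ, 0 ≤ C ∧ ∀ z ∈ T ∩ T, ‖q z‖ ≤ C * δ z := by
    refine hT.induction_on (p := fun A => ∃ C : ℝ, 0 ≤ C ∧ ∀ z ∈ A ∩ T, ‖q z‖ ≤ C * δ z) ?_ ?_ ?_ ?_
    · exact ⟨0, le_rfl, by simp⟩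
    · rintro A B hAB ⟨C, hC, h⟩
      exact ⟨C, hC, fun z hz => h z ⟨hAB hz.1, hz.2⟩⟩
    · rintro A B ⟨C, hC, h⟩ ⟨C', hC', h'⟩
      refine ⟨max C C', le_max_of_le_left hC, fun z hz => ?_⟩
      have hz0 := hδ z hz.2
      rcases hz.1 with hA | hB
      · exact (h z ⟨hA, hz.2⟩).trans (by gcongr; exact le_max_left _ _)
      · exact (h' z ⟨hB, hz.2⟩).trans (by gcongr; exact le_max_right _ _)
    · intro z hz
      obtain ⟨C, hC, hb⟩ := (h z hz).exists_nonneg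
      rw [IsBigOWith] at hb
      refine ⟨_, hb, C, hC, fun w hw => ?_⟩
      have := hw.1
      simp only [mem_ofPred_eq] at this
      rwa [Real.norm_of_nonneg (hδ w hw.2)] at this
  simpa using key

end Calculus

/-! ### Globally defined coordinates and test functions on manifolds -/

section Coordinates

variable {E : Type*} [NormedAddCommGroup E] [NormedSpace ℝ E]
  {M : Type*} [TopologicalSpace M] [ChartedSpace E M]

/-- Smooth coordinates around `x₀`: a globally defined smooth map `χ : M → E` and a local
inverse `κ` of it. -/
structure LocalCoord (x₀ : M) (χ : M → E) (κ : E → M) : Prop where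
  smooth : ContMDiff 𝓘(ℝ, E) 𝓘(ℝ, E) ∞ χ
  smooth_symm : ∀ᶠ v in 𝓝 (χ x₀), ContMDiffAt 𝓘(ℝ, E) 𝓘(ℝ, E) ∞ κ v
  left_inv : ∀ᶠ x in 𝓝 x₀, κ (χ x) = x
  right_inv : ∀ᶠ v in 𝓝 (χ x₀), χ (κ v) = v

/-- The chart is cut off by a bump function so that `χ` is smooth on all of `M`. Then `ξ ∘ χ` is an
admissible test function in the hypotheses, which speak only of smooth functions on the whole
manifold. -/
theorem exists_localCoord [FiniteDimensional ℝ E] [IsManifold 𝓘(ℝ, E) ∞ M] [T2Space M] (x₀ : M) :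
    ∃ (χ : M → E) (κ : E → M), LocalCoord x₀ χ κ := by
  let f : SmoothBumpFunction 𝓘(ℝ, E) x₀ := Classical.arbitrary _
  let e := extChartAt 𝓘(ℝ, E) x₀
  have h1 : (fun x => f x • e x) =ᶠ[𝓝 x₀] e := by
    filter_upwards [f.eventuallyEq_one] with x hx
    simp [hx]
  have h0 : f x₀ • e x₀ = e x₀ := h1.self_of_nhds
  refine ⟨fun x => f x • e x, e.symm, ⟨f.contMDiff_smul ?_, ?_, ?_, ?_⟩⟩
  · exact contMDiffOn_extChartAt
  · rw [h0]
    filter_upwards [extChartAt_target_mem_nhds (I := 𝓘(ℝ, E)) x₀] with v hv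
    exact (contMDiffOn_extChartAt_symm x₀ v hv).contMDiffAt
      ((isOpen_extChartAt_target x₀).mem_nhds hv)
  · filter_upwards [h1, extChartAt_source_mem_nhds (I := 𝓘(ℝ, E)) x₀] with x hx hx'
    rw [hx]
    exact e.left_inv hx'
  · rw [h0]
    have hc : ContinuousAt e.symm (e x₀) := continuousAt_extChartAt_symm x₀
    have hc' : Tendsto e.symm (𝓝 (e x₀)) (𝓝 x₀) := by
      have := hc.tendsto
      rwa [e.left_inv (mem_extChartAt_source x₀)] at this
    filter_upwards [hc'.eventually h1, extChartAt_target_mem_nhds (I := 𝓘(ℝ, E)) x₀] with v hv hv'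
    rw [hv]
    exact e.right_inv hv'

namespace LocalCoord

variable {x₀ : M} {χ : M → E} {κ : E → M}

theorem left_inv_self (h : LocalCoord x₀ χ κ) : κ (χ x₀) = x₀ := h.left_inv.self_of_nhds

theorem tendsto (h : LocalCoord x₀ χ κ) : Tendsto χ (𝓝 x₀) (𝓝 (χ x₀)) :=
  h.smooth.continuous.tendsto x₀

theorem tendsto_symm (h : LocalCoord x₀ χ κ) : Tendsto κ (𝓝 (χ x₀)) (𝓝 x₀) := by
  have := h.smooth_symm.self_of_nhds.continuousAt.tendsto
  rwa [h.left_inv_self] at this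

theorem mdifferentiableAt (h : LocalCoord x₀ χ κ) (x : M) :
    MDifferentiableAt 𝓘(ℝ, E) 𝓘(ℝ, E) χ x :=
  h.smooth.contMDiffAt.mdifferentiableAt (by simp)

theorem mdifferentiableAt_symm (h : LocalCoord x₀ χ κ) :
    ∀ᶠ v in 𝓝 (χ x₀), MDifferentiableAt 𝓘(ℝ, E) 𝓘(ℝ, E) κ v :=
  h.smooth_symm.mono fun _ hv => hv.mdifferentiableAt (by simp)

/-- The coordinates are also coordinates around nearby points. -/
theorem eventually (h : LocalCoord x₀ χ κ) : ∀ᶠ x in 𝓝 x₀, LocalCoord x χ κ := by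
  filter_upwards [h.tendsto.eventually h.smooth_symm.eventually_nhds, h.left_inv.eventually_nhds,
    h.tendsto.eventually h.right_inv.eventually_nhds] with x h1 h2 h3
  exact ⟨h.smooth, h1, h2, h3⟩

theorem mfderiv_left (h : LocalCoord x₀ χ κ) (w : TangentSpace 𝓘(ℝ, E) x₀) :
    mfderiv 𝓘(ℝ, E) 𝓘(ℝ, E) κ (χ x₀) (mvfderiv 𝓘(ℝ, E) χ x₀ w) = w := by
  have h1 : mfderiv 𝓘(ℝ, E) 𝓘(ℝ, E) (κ ∘ χ) x₀ =
      (mfderiv 𝓘(ℝ, E) 𝓘(ℝ, E) κ (χ x₀)).comp (mfderiv 𝓘(ℝ, E) 𝓘(ℝ, E) χ x₀) :=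
    mfderiv_comp x₀ h.mdifferentiableAt_symm.self_of_nhds (h.mdifferentiableAt x₀)
  have h2 : mfderiv 𝓘(ℝ, E) 𝓘(ℝ, E) (κ ∘ χ) x₀ = mfderiv 𝓘(ℝ, E) 𝓘(ℝ, E) id x₀ :=
    Filter.EventuallyEq.mfderiv_eq h.left_inv
  rw [mfderiv_id] at h2
  have h3 := h1.symm.trans h2
  exact DFunLike.congr_fun h3 w

theorem mfderiv_right (h : LocalCoord x₀ χ κ) : ∀ᶠ v in 𝓝 (χ x₀), ∀ w : E,
    mvfderiv 𝓘(ℝ, E) χ (κ v) (mfderiv 𝓘(ℝ, E) 𝓘(ℝ, E) κ v w) = w := by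
  filter_upwards [h.mdifferentiableAt_symm, h.right_inv.eventually_nhds] with v hv hv' w
  have h1 : mfderiv 𝓘(ℝ, E) 𝓘(ℝ, E) (χ ∘ κ) v =
      (mfderiv 𝓘(ℝ, E) 𝓘(ℝ, E) χ (κ v)).comp (mfderiv 𝓘(ℝ, E) 𝓘(ℝ, E) κ v) :=
    mfderiv_comp v (h.mdifferentiableAt _) hv
  have h2 : mfderiv 𝓘(ℝ, E) 𝓘(ℝ, E) (χ ∘ κ) v = mfderiv 𝓘(ℝ, E) 𝓘(ℝ, E) id v :=
    Filter.EventuallyEq.mfderiv_eq hv'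
  rw [mfderiv_id] at h2
  exact DFunLike.congr_fun (h1.symm.trans h2) w

theorem injective_mvfderiv (h : LocalCoord x₀ χ κ) :
    Function.Injective (mvfderiv 𝓘(ℝ, E) χ x₀) :=
  Function.LeftInverse.injective h.mfderiv_left

theorem eventually_eq_of_eq (h : LocalCoord x₀ χ κ) :
    ∀ᶠ q in 𝓝 (x₀, x₀), χ q.1 = χ q.2 → q.1 = q.2 := by
  rw [nhds_prod_eq]
  filter_upwards [h.left_inv.prod_mk h.left_inv] with q hq hqq
  rw [← hq.1, ← hq.2, hqq]

end LocalCoord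

theorem ContMDiff.isSmoothFun_clm_comp {V : Type*} [NormedAddCommGroup V] [NormedSpace ℝ V]
    {k : M → V} (hk : ContMDiff 𝓘(ℝ, E) 𝓘(ℝ, V) ∞ k) (ξ : V →L[ℝ] ℝ) :
    IsSmoothFun E (fun x => ξ (k x)) :=
  ξ.contMDiff.comp hk

theorem mvfderiv_comp_mfderiv {F : Type*} [NormedAddCommGroup F] [NormedSpace ℝ F]
    {S : Type*} [TopologicalSpace S] [ChartedSpace F S]
    {V : Type*} [NormedAddCommGroup V] [NormedSpace ℝ V] {g : M → V} {f : S → M} {s : S}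
    (hg : MDifferentiableAt 𝓘(ℝ, E) 𝓘(ℝ, V) g (f s))
    (hf : MDifferentiableAt 𝓘(ℝ, F) 𝓘(ℝ, E) f s) (w : TangentSpace 𝓘(ℝ, F) s) :
    mvfderiv 𝓘(ℝ, F) (fun y => g (f y)) s w =
      mvfderiv 𝓘(ℝ, E) g (f s) (mfderiv 𝓘(ℝ, F) 𝓘(ℝ, E) f s w) :=
  mfderiv_comp_apply s hg hf w

theorem mvfderiv_eq_fderiv {V W : Type*} [NormedAddCommGroup V] [NormedSpace ℝ V]
    [NormedAddCommGroup W] [NormedSpace ℝ W] (g : V → W) (v w : V) :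
    mvfderiv 𝓘(ℝ, V) g v w = fderiv ℝ g v w :=
  DFunLike.congr_fun (mfderiv_eq_fderiv (f := g) (x := v)) w

theorem mvfderiv_clm_comp {V W : Type*} [NormedAddCommGroup V] [NormedSpace ℝ V]
    [NormedAddCommGroup W] [NormedSpace ℝ W] (L : V →L[ℝ] W) {k : M → V} {x : M}
    (hk : MDifferentiableAt 𝓘(ℝ, E) 𝓘(ℝ, V) k x) (w : TangentSpace 𝓘(ℝ, E) x) :
    mvfderiv 𝓘(ℝ, E) (fun y => L (k y)) x w = L (mvfderiv 𝓘(ℝ, E) k x w) := by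
  have h1 := mvfderiv_comp_mfderiv (g := L) L.mdifferentiableAt hk w
  have h2 : mfderiv 𝓘(ℝ, V) 𝓘(ℝ, W) L (k x) = L := L.mfderiv_eq
  exact h1.trans (DFunLike.congr_fun h2 _)

section Covectors

variable [FiniteDimensional ℝ E] [IsManifold 𝓘(ℝ, E) ∞ M] [T2Space M]

/-- Every covector is the differential of a smooth function. -/
theorem exists_smoothFun_mvfderiv_eq (x : M) (ξ : TangentSpace 𝓘(ℝ, E) x →L[ℝ] ℝ) :
    ∃ f : M → ℝ, IsSmoothFun E f ∧ mvfderiv 𝓘(ℝ, E) f x = ξ := by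
  obtain ⟨χ, κ, h⟩ := exists_localCoord (E := E) x
  let η : E →L[ℝ] ℝ := ContinuousLinearMap.comp (M₂ := E) ξ (mfderiv 𝓘(ℝ, E) 𝓘(ℝ, E) κ (χ x))
  refine ⟨fun y => η (χ y), h.smooth.isSmoothFun_clm_comp η, ?_⟩
  ext w
  rw [mvfderiv_clm_comp η (h.mdifferentiableAt x)]
  exact congrArg ξ (h.mfderiv_left w)

/-- Smooth functions separate the points of a manifold. -/
theorem eq_of_forall_smoothFun_eq {x y : M} (h : ∀ g : M → ℝ, IsSmoothFun E g → g x = g y) :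
    x = y := by
  by_contra hxy
  obtain ⟨f, -, hf⟩ := (SmoothBumpFunction.nhds_basis_tsupport (I := 𝓘(ℝ, E)) x).mem_iff.1
    (isOpen_compl_singleton.mem_nhds hxy : ({y}ᶜ : Set M) ∈ 𝓝 x)
  have h1 : f y = 0 := image_eq_zero_of_notMem_tsupport fun hy => hf hy rfl
  have h2 := h f f.contMDiff
  rw [f.eq_one, h1] at h2
  exact one_ne_zero h2

end Covectors

/-- The expression in coordinates of a smooth family of maps. -/
theorem contDiffAt_coord {P V : Type*} [NormedAddCommGroup P] [NormedSpace ℝ P]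
    [NormedAddCommGroup V] [NormedSpace ℝ V] {G : P × M → V} {κ : E → M} {p : P} {v : E}
    (hG : ContMDiffAt (𝓘(ℝ, P).prod 𝓘(ℝ, E)) 𝓘(ℝ, V) ∞ G (p, κ v))
    (hκ : ContMDiffAt 𝓘(ℝ, E) 𝓘(ℝ, E) ∞ κ v) :
    ContDiffAt ℝ ∞ (fun q : P × E => G (q.1, κ q.2)) (p, v) := by
  rw [← contMDiffAt_iff_contDiffAt]
  have h1 : ContMDiffAt 𝓘(ℝ, P × E) (𝓘(ℝ, P).prod 𝓘(ℝ, E)) ∞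
      (fun q : P × E => (q.1, κ q.2)) (p, v) := by
    refine ContMDiffAt.prodMk ?_ ?_
    · exact contMDiffAt_iff_contDiffAt.2 contDiffAt_fst
    · exact ContMDiffAt.comp (p, v) (g := κ) (f := fun q : P × E => q.2) hκ
        (contMDiffAt_iff_contDiffAt.2 contDiffAt_snd)
  exact ContMDiffAt.comp (p, v) (g := G) (f := fun q : P × E => (q.1, κ q.2)) hG h1

theorem contMDiffAt_slice {P : Type*} [NormedAddCommGroup P] [NormedSpace ℝ P]
    {E' : Type*} [NormedAddCommGroup E'] [NormedSpace ℝ E']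
    {N : Type*} [TopologicalSpace N] [ChartedSpace E' N] {n : WithTop ℕ∞}
    {G : P → M → N} {p : P} {y : M}
    (hG : ContMDiffAt (𝓘(ℝ, P).prod 𝓘(ℝ, E)) 𝓘(ℝ, E') n (fun q : P × M => G q.1 q.2) (p, y)) :
    ContMDiffAt 𝓘(ℝ, E) 𝓘(ℝ, E') n (G p) y :=
  ContMDiffAt.comp y (g := fun q : P × M => G q.1 q.2) (f := fun y => (p, y)) hG
    (contMDiffAt_const.prodMk contMDiffAt_id)

/-! ### The inverse function theorem with parameters -/

section Inverse

variable {E' : Type*} [NormedAddCommGroup E'] [NormedSpace ℝ E'] [FiniteDimensional ℝ E']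
  [FiniteDimensional ℝ E]
  {N : Type*} [TopologicalSpace N] [ChartedSpace E' N] [IsManifold 𝓘(ℝ, E) ∞ M]
  [IsManifold 𝓘(ℝ, E') ∞ N] [T2Space M] [T2Space N]
  {P : Type*} [NormedAddCommGroup P] [NormedSpace ℝ P] [CompleteSpace P]

/-- The linear automorphism `(p, v) ↦ (p, A p + B v)`. -/
def shearEquiv (A : P →L[ℝ] E') (B : E ≃L[ℝ] E') : (P × E) ≃L[ℝ] (P × E') :=
  ContinuousLinearEquiv.equivOfInverse
    ((ContinuousLinearMap.fst ℝ P E).prod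
      (A.comp (ContinuousLinearMap.fst ℝ P E) +
        (B : E →L[ℝ] E').comp (ContinuousLinearMap.snd ℝ P E)))
    ((ContinuousLinearMap.fst ℝ P E').prod
      ((B.symm : E' →L[ℝ] E).comp (ContinuousLinearMap.snd ℝ P E' -
        A.comp (ContinuousLinearMap.fst ℝ P E'))))
    (fun q => by ext <;> simp) (fun q => by ext <;> simp)

/-- The inverse function theorem for a smooth family of maps between manifolds. -/
theorem exists_local_inverse (hd : Module.finrank ℝ E = Module.finrank ℝ E')
    {G : P → M → N} {p₀ : P} {y₀ : M}
    (hG : ContMDiffAt (𝓘(ℝ, P).prod 𝓘(ℝ, E)) 𝓘(ℝ, E') ∞ (fun q : P × M => G q.1 q.2) (p₀, y₀))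
    (hinj : Function.Injective (mfderiv 𝓘(ℝ, E) 𝓘(ℝ, E') (G p₀) y₀)) :
    ∃ J : P → N → M,
      ContMDiffAt (𝓘(ℝ, P).prod 𝓘(ℝ, E')) 𝓘(ℝ, E) ∞ (fun q : P × N => J q.1 q.2)
        (p₀, G p₀ y₀) ∧
      (∀ᶠ q in 𝓝 (p₀, y₀), J q.1 (G q.1 q.2) = q.2) ∧
      ∀ᶠ q in 𝓝 (p₀, G p₀ y₀), G q.1 (J q.1 q.2) = q.2 := by
  obtain ⟨χ, κ, hχ⟩ := exists_localCoord (E := E) y₀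
  obtain ⟨χ', κ', hχ'⟩ := exists_localCoord (E := E') (G p₀ y₀)
  set v₀ := χ y₀ with hv₀
  have hκv : κ v₀ = y₀ := hχ.left_inv_self
  let g : P × E → E' := fun q => χ' (G q.1 (κ q.2))
  have hg : ContDiffAt ℝ ∞ g (p₀, v₀) := by
    refine contDiffAt_coord (G := fun q : P × M => χ' (G q.1 q.2)) ?_
      hχ.smooth_symm.self_of_nhds
    rw [hκv]
    exact ContMDiffAt.comp (p₀, y₀) (g := χ') hχ'.smooth.contMDiffAt hG
  -- Adjoining the parameter to the values reduces the theorem to the case without parameters: the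
  -- derivative of `T` is a shear, invertible because the partial derivative in `v` is injective
  -- between spaces of equal dimension.
  let T : P × E → P × E' := fun q => (q.1, g q)
  have hT : ContDiffAt ℝ ∞ T (p₀, v₀) := contDiffAt_fst.prodMk hg
  have hgd : HasFDerivAt g (fderiv ℝ g (p₀, v₀)) (p₀, v₀) :=
    (hg.differentiableAt (by simp)).hasFDerivAt
  set D := fderiv ℝ g (p₀, v₀)
  have hsl : ∀ v : E, D (0, v) = mvfderiv 𝓘(ℝ, E') χ' (G p₀ y₀)
      (mfderiv 𝓘(ℝ, E) 𝓘(ℝ, E') (G p₀) y₀ (mfderiv 𝓘(ℝ, E) 𝓘(ℝ, E) κ v₀ v)) := by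
    intro v
    have h1 : HasFDerivAt (fun v => g (p₀, v)) (D.comp (ContinuousLinearMap.inr ℝ P E)) v₀ :=
      hgd.comp v₀ (hasFDerivAt_prodMk_right p₀ v₀)
    have hGs : MDifferentiableAt 𝓘(ℝ, E) 𝓘(ℝ, E') (G p₀) (κ v₀) := by
      rw [hκv]
      exact (contMDiffAt_slice hG).mdifferentiableAt (by simp)
    have hκd : MDifferentiableAt 𝓘(ℝ, E) 𝓘(ℝ, E) κ v₀ := hχ.mdifferentiableAt_symm.self_of_nhds
    have h2 := mvfderiv_comp_mfderiv (g := χ') (f := fun v => G p₀ (κ v)) (s := v₀)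
      (hχ'.mdifferentiableAt _) (hGs.comp v₀ hκd) v
    have h3 : mfderiv 𝓘(ℝ, E) 𝓘(ℝ, E') (fun v => G p₀ (κ v)) v₀ v =
        mfderiv 𝓘(ℝ, E) 𝓘(ℝ, E') (G p₀) (κ v₀) (mfderiv 𝓘(ℝ, E) 𝓘(ℝ, E) κ v₀ v) :=
      mfderiv_comp_apply v₀ hGs hκd v
    rw [mvfderiv_eq_fderiv, h1.fderiv, h3, hκv] at h2
    exact h2
  have hκinj : Function.Injective (mfderiv 𝓘(ℝ, E) 𝓘(ℝ, E) κ v₀) :=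
    Function.LeftInverse.injective (g := mvfderiv 𝓘(ℝ, E) χ (κ v₀)) hχ.mfderiv_right.self_of_nhds
  have hBinj : Function.Injective (D.comp (ContinuousLinearMap.inr ℝ P E)) := by
    intro v w hvw
    have h1 : D (0, v) = D (0, w) := hvw
    rw [hsl, hsl] at h1
    exact hκinj (hinj (hχ'.injective_mvfderiv h1))
  let B : E ≃L[ℝ] E' := (LinearEquiv.ofInjectiveOfFinrankEq
    (D.comp (ContinuousLinearMap.inr ℝ P E)).toLinearMap hBinj hd).toContinuousLinearEquiv
  have hT' : HasFDerivAt T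
      (shearEquiv (D.comp (ContinuousLinearMap.inl ℝ P E)) B : P × E →L[ℝ] P × E')
      (p₀, v₀) := by
    have h1 := (hasFDerivAt_fst (𝕜 := ℝ) (p := (p₀, v₀))).prodMk hgd
    have heq : (shearEquiv (D.comp (ContinuousLinearMap.inl ℝ P E)) B : P × E →L[ℝ] P × E') =
        (ContinuousLinearMap.fst ℝ P E).prod D := by
      refine ContinuousLinearMap.ext fun q => Prod.ext rfl ?_
      have hB : B q.2 = D (0, q.2) := rfl
      change D (q.1, 0) + B q.2 = D q
      rw [hB, ← map_add]
      simp
    rw [heq]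
    exact h1
  have hstrict := hT.hasStrictFDerivAt' hT' (by simp)
  let Tinv := hstrict.localInverse T _ (p₀, v₀)
  have hTinv : ContDiffAt ℝ ∞ Tinv (T (p₀, v₀)) := hT.to_localInverse hT' (by simp)
  have hTv : T (p₀, v₀) = (p₀, χ' (G p₀ y₀)) := by simp [T, g, hκv]
  have hTinv0 : Tinv (p₀, χ' (G p₀ y₀)) = (p₀, v₀) := by
    rw [← hTv]
    exact hstrict.localInverse_apply_image
  rw [hTv] at hTinv
  have hr : ∀ᶠ q in 𝓝 (p₀, χ' (G p₀ y₀)), T (Tinv q) = q := by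
    rw [← hTv]
    exact hstrict.eventually_right_inverse
  have hpχ : Tendsto (fun q : P × M => (q.1, χ q.2)) (𝓝 (p₀, y₀)) (𝓝 (p₀, v₀)) := by
    have : Continuous fun q : P × M => (q.1, χ q.2) :=
      continuous_fst.prodMk (hχ.smooth.continuous.comp continuous_snd)
    exact this.tendsto _
  have hpχ' : Tendsto (fun q : P × N => (q.1, χ' q.2)) (𝓝 (p₀, G p₀ y₀))
      (𝓝 (p₀, χ' (G p₀ y₀))) := by
    have : Continuous fun q : P × N => (q.1, χ' q.2) :=
      continuous_fst.prodMk (hχ'.smooth.continuous.comp continuous_snd)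
    exact this.tendsto _
  have hJ : ContMDiffAt (𝓘(ℝ, P).prod 𝓘(ℝ, E')) 𝓘(ℝ, E) ∞
      (fun q : P × N => κ (Tinv (q.1, χ' q.2)).2) (p₀, G p₀ y₀) := by
    have h1 : ContMDiffAt (𝓘(ℝ, P).prod 𝓘(ℝ, E')) 𝓘(ℝ, P × E') ∞
        (fun q : P × N => (q.1, χ' q.2)) (p₀, G p₀ y₀) :=
      contMDiffAt_fst.prodMk_space (hχ'.smooth.contMDiffAt.comp _ contMDiffAt_snd)
    have h2 : ContMDiffAt 𝓘(ℝ, P × E') 𝓘(ℝ, E) ∞ (fun q => (Tinv q).2) (p₀, χ' (G p₀ y₀)) :=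
      contMDiffAt_iff_contDiffAt.2 (contDiffAt_snd.comp _ hTinv)
    have h3 : ContMDiffAt 𝓘(ℝ, E) 𝓘(ℝ, E) ∞ κ (Tinv (p₀, χ' (G p₀ y₀))).2 := by
      rw [hTinv0]
      exact hχ.smooth_symm.self_of_nhds
    have h4 : ContMDiffAt (𝓘(ℝ, P).prod 𝓘(ℝ, E')) 𝓘(ℝ, E) ∞
        (fun q : P × N => (Tinv (q.1, χ' q.2)).2) (p₀, G p₀ y₀) :=
      ContMDiffAt.comp (p₀, G p₀ y₀) (g := fun q => (Tinv q).2) h2 h1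
    exact ContMDiffAt.comp (p₀, G p₀ y₀) (g := κ) h3 h4
  refine ⟨fun p x => κ (Tinv (p, χ' x)).2, hJ, ?_, ?_⟩
  · have h2 : ∀ᶠ q : P × M in 𝓝 (p₀, y₀), κ (χ q.2) = q.2 :=
      (continuous_snd.tendsto (p₀, y₀)).eventually hχ.left_inv
    filter_upwards [hpχ.eventually hstrict.eventually_left_inverse, h2] with q h1 h2
    have h3 : T (q.1, χ q.2) = (q.1, χ' (G q.1 q.2)) := by simp [T, g, h2]
    have h4 : Tinv (q.1, χ' (G q.1 q.2)) = (q.1, χ q.2) := by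
      rw [← h3]
      exact h1
    rw [h4]
    exact h2
  -- The inverse of `T` yields only an equality after applying `χ'`, which is injective near `G p₀
  -- y₀`. So both sides must be shown to tend to that point.
  · have hGJ : Tendsto (fun q : P × N => (G q.1 (κ (Tinv (q.1, χ' q.2)).2), q.2))
        (𝓝 (p₀, G p₀ y₀)) (𝓝 (G p₀ y₀, G p₀ y₀)) := by
      have h1 : κ (Tinv (p₀, χ' (G p₀ y₀))).2 = y₀ := by rw [hTinv0]; exact hκv
      have h2 : Tendsto (fun q : P × N => (q.1, κ (Tinv (q.1, χ' q.2)).2)) (𝓝 (p₀, G p₀ y₀))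
          (𝓝 (p₀, y₀)) := by
        have h3 := hJ.continuousAt.tendsto
        simp only [h1] at h3
        exact (continuous_fst.tendsto (p₀, G p₀ y₀)).prodMk_nhds h3
      have h4 := hG.continuousAt.tendsto.comp h2
      exact h4.prodMk_nhds (continuous_snd.tendsto (p₀, G p₀ y₀))
    filter_upwards [hpχ'.eventually hr, hGJ.eventually hχ'.eventually_eq_of_eq] with q h1 h2
    refine h2 ?_
    have h3 : (Tinv (q.1, χ' q.2)).1 = q.1 := congrArg Prod.fst h1
    have h4 : χ' (G (Tinv (q.1, χ' q.2)).1 (κ (Tinv (q.1, χ' q.2)).2)) = χ' q.2 :=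
      congrArg Prod.snd h1
    rwa [h3] at h4

end Inverse

end Coordinates

/-! ### Perturbations of the identity on compact sets -/

section Families

variable {E : Type*} [NormedAddCommGroup E] [NormedSpace ℝ E] [FiniteDimensional ℝ E]
  {M : Type*} [TopologicalSpace M] [ChartedSpace E M] [IsManifold 𝓘(ℝ, E) ∞ M] [T2Space M]
  {P : Type*} [NormedAddCommGroup P] [NormedSpace ℝ P] [CompleteSpace P]

theorem exists_tangentEquiv_of_injective {x y : M}
    {A : TangentSpace 𝓘(ℝ, E) x →L[ℝ] TangentSpace 𝓘(ℝ, E) y} (h : Function.Injective A) :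
    ∃ e : TangentSpace 𝓘(ℝ, E) x ≃L[ℝ] TangentSpace 𝓘(ℝ, E) y,
      (e : TangentSpace 𝓘(ℝ, E) x →L[ℝ] TangentSpace 𝓘(ℝ, E) y) = A := by
  have key : ∀ A : E →L[ℝ] E, Function.Injective A → ∃ e : E ≃L[ℝ] E, (e : E →L[ℝ] E) = A := by
    intro A h
    refine ⟨(LinearEquiv.ofInjectiveOfFinrankEq A.toLinearMap h rfl).toContinuousLinearEquiv, ?_⟩
    ext v
    rfl
  exact key A h

/-- The inverse function theorem for smooth maps between manifolds of the same dimension. -/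
theorem exists_local_inverse_map {f : M → M} {y : M}
    (hf : ContMDiffAt 𝓘(ℝ, E) 𝓘(ℝ, E) ∞ f y)
    (hinj : Function.Injective (mfderiv 𝓘(ℝ, E) 𝓘(ℝ, E) f y)) :
    ∃ j : M → M, ContMDiffAt 𝓘(ℝ, E) 𝓘(ℝ, E) ∞ j (f y) ∧ (∀ᶠ x in 𝓝 y, j (f x) = x) ∧
      ∀ᶠ x in 𝓝 (f y), f (j x) = x := by
  obtain ⟨J, h1, h2, h3⟩ := exists_local_inverse (P := ℝ) (p₀ := 0) (G := fun _ => f) rfl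
    (ContMDiffAt.comp ((0 : ℝ), y) (g := f) hf contMDiffAt_snd) hinj
  refine ⟨J 0, contMDiffAt_slice h1, ?_, ?_⟩
  · exact (Continuous.prodMk_right (0 : ℝ)).tendsto y |>.eventually h2
  · exact (Continuous.prodMk_right (0 : ℝ)).tendsto (f y) |>.eventually h3

/-- The part of a smooth family of maps near a point where the derivative is injective. -/
theorem eventually_injective_mfderiv {G : P → M → M} {p₀ : P} {y₀ : M}
    (hG : ContMDiffAt (𝓘(ℝ, P).prod 𝓘(ℝ, E)) 𝓘(ℝ, E) ∞ (fun q : P × M => G q.1 q.2) (p₀, y₀))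
    (hinj : Function.Injective (mfderiv 𝓘(ℝ, E) 𝓘(ℝ, E) (G p₀) y₀)) :
    ∀ᶠ q in 𝓝 (p₀, y₀), Function.Injective (mfderiv 𝓘(ℝ, E) 𝓘(ℝ, E) (G q.1) q.2) := by
  obtain ⟨J, h1, h2, -⟩ := exists_local_inverse rfl hG hinj
  -- Class `C^∞` at a point need not hold on a neighbourhood, which may shrink with the order; class
  -- `C^1` does, and it is enough for the chain rule applied to `J ∘ G = id`.
  have hG1 := (contMDiffAt_iff_contMDiffAt_nhds (n := 1) (by simp)).1 (hG.of_le (by simp))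
  have hJ1 := (contMDiffAt_iff_contMDiffAt_nhds (n := 1) (by simp)).1 (h1.of_le (by simp))
  have hc : Tendsto (fun q : P × M => (q.1, G q.1 q.2)) (𝓝 (p₀, y₀)) (𝓝 (p₀, G p₀ y₀)) :=
    (continuous_fst.tendsto (p₀, y₀)).prodMk_nhds hG.continuousAt.tendsto
  filter_upwards [hG1, hc.eventually hJ1, h2.eventually_nhds] with q hq hJq hq2
  have e1 : MDifferentiableAt 𝓘(ℝ, E) 𝓘(ℝ, E) (G q.1) q.2 :=
    (contMDiffAt_slice (p := q.1) (y := q.2) hq).mdifferentiableAt (by simp)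
  have e2 : MDifferentiableAt 𝓘(ℝ, E) 𝓘(ℝ, E) (J q.1) (G q.1 q.2) :=
    (contMDiffAt_slice (p := q.1) (y := G q.1 q.2) hJq).mdifferentiableAt (by simp)
  have e3 : (J q.1 ∘ G q.1) =ᶠ[𝓝 q.2] id :=
    ((Continuous.prodMk_right q.1).tendsto q.2).eventually hq2
  have e4 := e3.mfderiv_eq (I := 𝓘(ℝ, E)) (I' := 𝓘(ℝ, E))
  rw [mfderiv_id, mfderiv_comp q.2 e2 e1] at e4
  exact Function.LeftInverse.injective (g := mfderiv 𝓘(ℝ, E) 𝓘(ℝ, E) (J q.1) (G q.1 q.2))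
    fun w => DFunLike.congr_fun e4 w

theorem injective_mfderiv_of_eq_id {g : M → M} (hg : ∀ y, g y = y) (x : M) :
    Function.Injective (mfderiv 𝓘(ℝ, E) 𝓘(ℝ, E) g x) := by
  have : g = id := funext hg
  subst this
  rw [mfderiv_id]
  exact fun _ _ h => h

/-- A small perturbation of the identity has injective derivatives on a compact set. -/
theorem eventually_forall_injective_mfderiv {G : P → M → M}
    (hG : ∀ y, ContMDiffAt (𝓘(ℝ, P).prod 𝓘(ℝ, E)) 𝓘(ℝ, E) ∞ (fun q : P × M => G q.1 q.2) (0, y))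
    (h0 : ∀ y, G 0 y = y) {Q : Set M} (hQ : IsCompact Q) :
    ∀ᶠ p in 𝓝 (0 : P), ∀ y ∈ Q, Function.Injective (mfderiv 𝓘(ℝ, E) 𝓘(ℝ, E) (G p) y) :=
  hQ.eventually_forall_of_forall_eventually fun y _ =>
    eventually_injective_mfderiv (hG y) (injective_mfderiv_of_eq_id h0 y)

/-- A small perturbation of the identity is injective on a compact set. -/
theorem eventually_injOn {G : P → M → M}
    (hG : ∀ y, ContMDiffAt (𝓘(ℝ, P).prod 𝓘(ℝ, E)) 𝓘(ℝ, E) ∞ (fun q : P × M => G q.1 q.2) (0, y))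
    (h0 : ∀ y, G 0 y = y) {Q : Set M} (hQ : IsCompact Q) :
    ∀ᶠ p in 𝓝 (0 : P), InjOn (G p) Q := by
  have key : ∀ᶠ p in 𝓝 (0 : P), ∀ w ∈ Q ×ˢ Q, G p w.1 = G p w.2 → w.1 = w.2 := by
    refine (hQ.prod hQ).eventually_forall_of_forall_eventually fun w _ => ?_
    obtain ⟨y, y'⟩ := w
    have t1 : Tendsto (fun z : P × M × M => (z.1, z.2.1)) (𝓝 (0, y, y')) (𝓝 (0, y)) := by
      have : Continuous fun z : P × M × M => (z.1, z.2.1) := by fun_prop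
      exact this.tendsto _
    have t2 : Tendsto (fun z : P × M × M => (z.1, z.2.2)) (𝓝 (0, y, y')) (𝓝 (0, y')) := by
      have : Continuous fun z : P × M × M => (z.1, z.2.2) := by fun_prop
      exact this.tendsto _
    -- At a diagonal point the local left inverse separates nearby points; off the diagonal the two
    -- values stay apart by continuity.
    by_cases hyy : y = y'
    · subst hyy
      obtain ⟨J, -, h2, -⟩ := exists_local_inverse rfl (hG y) (injective_mfderiv_of_eq_id h0 y)
      filter_upwards [t1.eventually h2, t2.eventually h2] with z hz1 hz2 hz
      rw [← hz1, ← hz2]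
      exact congrArg _ hz
    · have hne : G 0 y ≠ G 0 y' := by rwa [h0, h0]
      have c1 := (hG y).continuousAt.tendsto.comp t1
      have c2 := (hG y').continuousAt.tendsto.comp t2
      filter_upwards [(c1.prodMk_nhds c2).eventually
        ((isClosed_diagonal.isOpen_compl).mem_nhds (show (G 0 y, G 0 y') ∈ (diagonal M)ᶜ from hne))]
        with z hz hzz
      exact absurd hzz hz
  filter_upwards [key] with p hp y hy y' hy' h
  exact hp (y, y') ⟨hy, hy'⟩ h

/-- The equation `G p y = x` is solvable near a point `x₀ = G 0 x₀`. -/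
theorem eventually_exists_preimage {G : P → M → M}
    (hG : ∀ y, ContMDiffAt (𝓘(ℝ, P).prod 𝓘(ℝ, E)) 𝓘(ℝ, E) ∞ (fun q : P × M => G q.1 q.2) (0, y))
    (h0 : ∀ y, G 0 y = y) {x₀ : M} {U : Set M} (hU : U ∈ 𝓝 x₀) :
    ∀ᶠ q in 𝓝 ((0 : P), x₀), ∃ y ∈ U, G q.1 y = q.2 := by
  -- The solution is `J p x`; it lies in `U` because `J` is continuous and sends `(0, x₀)` to `x₀`.
  obtain ⟨J, h1, h2, h3⟩ := exists_local_inverse rfl (hG x₀) (injective_mfderiv_of_eq_id h0 x₀)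
  have hJ0 : J 0 (G 0 x₀) = x₀ := h2.self_of_nhds
  have hc := h1.continuousAt.tendsto
  simp only [hJ0] at hc
  rw [h0 x₀] at hc h3
  filter_upwards [hc.eventually hU, h3] with q hq hq3
  exact ⟨_, hq, hq3⟩

/-- The image of an open set by a small perturbation of the identity covers compact subsets. -/
theorem eventually_subset_image {G : P → M → M}
    (hG : ∀ y, ContMDiffAt (𝓘(ℝ, P).prod 𝓘(ℝ, E)) 𝓘(ℝ, E) ∞ (fun q : P × M => G q.1 q.2) (0, y))
    (h0 : ∀ y, G 0 y = y) {K V : Set M} (hK : IsCompact K) (hV : IsOpen V) (hKV : K ⊆ V) :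
    ∀ᶠ p in 𝓝 (0 : P), K ⊆ G p '' V :=
  hK.eventually_forall_of_forall_eventually fun _ hx =>
    eventually_exists_preimage hG h0 (hV.mem_nhds (hKV hx))

end Families

/-! ### Bisections and the maps they induce -/

section Bisections

variable {E : Type*} [NormedAddCommGroup E] [NormedSpace ℝ E] [FiniteDimensional ℝ E]
  {M : Type*} [TopologicalSpace M] [ChartedSpace E M] [IsManifold 𝓘(ℝ, E) ∞ M] [T2Space M]
  {F : Type*} [NormedAddCommGroup F] [NormedSpace ℝ F]
  {S : Type*} [TopologicalSpace S] [ChartedSpace F S]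

/-- Injectivity on `V` forces the set-theoretic inverse to coincide, near each point of the image,
with the local inverse of the inverse function theorem; so it is smooth. -/
theorem restrictsToDiffeo_of_injOn {a : S → M} {Γ : M → S} {V : Set M} (hV : IsOpen V)
    (hΓ : ∀ y ∈ V, ContMDiffAt 𝓘(ℝ, E) 𝓘(ℝ, F) ∞ Γ y)
    (hG : ∀ y ∈ V, ContMDiffAt 𝓘(ℝ, E) 𝓘(ℝ, E) ∞ (fun y => a (Γ y)) y)
    (hinj : InjOn (fun y => a (Γ y)) V)
    (hder : ∀ y ∈ V, Function.Injective (mfderiv 𝓘(ℝ, E) 𝓘(ℝ, E) (fun y => a (Γ y)) y)) :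
    RestrictsToDiffeo E F a (Γ '' V) ((fun y => a (Γ y)) '' V) := by
  set G := fun y => a (Γ y) with hGdef
  have key : ∀ y ∈ V, ∃ j : M → M, ContMDiffAt 𝓘(ℝ, E) 𝓘(ℝ, E) ∞ j (G y) ∧ j (G y) = y ∧
      ∀ᶠ x in 𝓝 (G y), j x ∈ V ∧ G (j x) = x := by
    intro y hy
    obtain ⟨j, h1, h2, h3⟩ := exists_local_inverse_map (hG y hy) (hder y hy)
    have hj : j (G y) = y := h2.self_of_nhds
    have hc := h1.continuousAt.tendsto
    rw [hj] at hc
    exact ⟨j, h1, hj, (hc.eventually (hV.mem_nhds hy)).and h3⟩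
  refine ⟨?_, ⟨?_, ?_, ?_⟩, ?_⟩
  · rw [isOpen_iff_mem_nhds]
    rintro _ ⟨y, hy, rfl⟩
    obtain ⟨j, -, -, h⟩ := key y hy
    filter_upwards [h] with x hx
    exact ⟨j x, hx.1, hx.2⟩
  · rintro _ ⟨y, hy, rfl⟩
    exact ⟨y, hy, rfl⟩
  · rintro _ ⟨y, hy, rfl⟩ _ ⟨y', hy', rfl⟩ h
    rw [hinj hy hy' h]
  · rintro _ ⟨y, hy, rfl⟩
    exact ⟨Γ y, ⟨y, hy, rfl⟩, rfl⟩
  · classical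
    rcases V.eq_empty_or_nonempty with rfl | ⟨y₁, -⟩
    · have hM : (fun y => a (Γ y)) '' (∅ : Set M) = ∅ := image_empty _
      by_cases hS : Nonempty S
      · exact ⟨fun _ => hS.some, by simp [ContMDiffOn], by simp, by simp⟩
      · exact ⟨Γ, by simp [ContMDiffOn], by simp, by simp⟩
    have : Nonempty M := ⟨y₁⟩
    refine ⟨fun x => Γ (Function.invFunOn G V x), ?_, ?_, ?_⟩
    · rintro _ ⟨y, hy, rfl⟩
      obtain ⟨j, h1, h2, h3⟩ := key y hy
      have hΓj : ContMDiffAt 𝓘(ℝ, E) 𝓘(ℝ, F) ∞ (fun x => Γ (j x)) (G y) := by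
        refine ContMDiffAt.comp (G y) (g := Γ) ?_ h1
        rw [h2]
        exact hΓ y hy
      refine (hΓj.congr_of_eventuallyEq ?_).contMDiffWithinAt
      filter_upwards [h3] with x hx
      have hx' : ∃ y ∈ V, G y = x := ⟨j x, hx.1, hx.2⟩
      have : Function.invFunOn G V x = j x :=
        hinj (Function.invFunOn_mem hx') hx.1
          ((Function.invFunOn_eq hx').trans hx.2.symm)
      rw [this]
    · rintro x hx
      exact ⟨_, Function.invFunOn_mem hx, rfl⟩
    · rintro x hx
      exact Function.invFunOn_eq hx

theorem inducedMap_eq {α β : S → M} {Γ : M → S} {V : Set M}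
    (hinj : InjOn (fun y => β (Γ y)) V) {y : M} (hy : y ∈ V) :
    inducedMap α β (Γ '' V) (β (Γ y)) = α (Γ y) := by
  have h : ∃ z ∈ Γ '' V, β z = β (Γ y) := ⟨Γ y, ⟨y, hy, rfl⟩, rfl⟩
  rw [inducedMap, dif_pos h]
  obtain ⟨⟨y', hy', h1⟩, h2⟩ := h.choose_spec
  rw [← h1] at h2 ⊢
  rw [hinj hy' hy h2]

/-- The covectors sit over points whose equality is not definitional; comparing them on vectors of
the model space `E` avoids a transport. -/
theorem eval_congr_of_eq (π : PoissonTensor E M) {a a' : M} (h : a = a')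
    {ξ η : TangentSpace 𝓘(ℝ, E) a →L[ℝ] ℝ} {ξ' η' : TangentSpace 𝓘(ℝ, E) a' →L[ℝ] ℝ}
    (hξ : ∀ w : E, ξ w = ξ' w)
    (hη : ∀ w : E, η w = η' w) :
    π.eval a ξ η = π.eval a' ξ' η' := by
  subst h
  have h1 : ξ = ξ' := ContinuousLinearMap.ext hξ
  have h2 : η = η' := ContinuousLinearMap.ext hη
  rw [h1, h2]

/-- The derivative of the induced map. -/
theorem mfderiv_inducedMap {α β : S → M} {Γ : M → S} {V : Set M} (hV : IsOpen V)
    (hinj : InjOn (fun y => β (Γ y)) V) {y : M} (hy : y ∈ V)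
    (hA : ContMDiffAt 𝓘(ℝ, E) 𝓘(ℝ, E) ∞ (fun y => α (Γ y)) y)
    (hB : ContMDiffAt 𝓘(ℝ, E) 𝓘(ℝ, E) ∞ (fun y => β (Γ y)) y)
    (hder : Function.Injective (mfderiv 𝓘(ℝ, E) 𝓘(ℝ, E) (fun y => β (Γ y)) y))
    (w : TangentSpace 𝓘(ℝ, E) y) :
    mfderiv 𝓘(ℝ, E) 𝓘(ℝ, E) (inducedMap α β (Γ '' V)) (β (Γ y))
      (mfderiv 𝓘(ℝ, E) 𝓘(ℝ, E) (fun y => β (Γ y)) y w) =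
    mfderiv 𝓘(ℝ, E) 𝓘(ℝ, E) (fun y => α (Γ y)) y w := by
  obtain ⟨j, h1, h2, h3⟩ := exists_local_inverse_map hB hder
  have hj : j (β (Γ y)) = y := h2.self_of_nhds
  have hc := h1.continuousAt.tendsto
  rw [hj] at hc
  have hφ : inducedMap α β (Γ '' V) =ᶠ[𝓝 (β (Γ y))] fun x => α (Γ (j x)) := by
    filter_upwards [hc.eventually (hV.mem_nhds hy), h3] with x hx hx3
    have := inducedMap_eq (α := α) hinj hx
    rwa [hx3] at this
  have hφd : MDifferentiableAt 𝓘(ℝ, E) 𝓘(ℝ, E) (inducedMap α β (Γ '' V)) (β (Γ y)) := by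
    refine MDifferentiableAt.congr_of_eventuallyEq ?_ hφ
    refine MDifferentiableAt.comp (β (Γ y)) (g := fun y => α (Γ y)) (f := j) ?_
      (h1.mdifferentiableAt (by simp))
    rw [hj]
    exact hA.mdifferentiableAt (by simp)
  have h4 := mfderiv_comp_apply y hφd (hB.mdifferentiableAt (by simp)) w
  rw [← h4]
  have h5 : (inducedMap α β (Γ '' V) ∘ fun y => β (Γ y)) =ᶠ[𝓝 y] fun y => α (Γ y) := by
    filter_upwards [hV.mem_nhds hy] with y' hy'
    exact inducedMap_eq hinj hy'
  have h6 := h5.mfderiv_eq (I := 𝓘(ℝ, E)) (I' := 𝓘(ℝ, E))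
  exact DFunLike.congr_fun h6 w

/-- Since `Dφ ∘ D(β ∘ Γ) = D(α ∘ Γ)`, the covector `df ∘ (Dφ)⁻¹` is the one whose pullback by `D(α ∘
Γ)` is `d(f ∘ β ∘ Γ)`. The pullback of `π` is thus expressed on the bisection, without the induced
map, and can be compared for exact and approximate data. -/
theorem pullbackEval_inducedMap (π : PoissonTensor E M) {α β : S → M} {Γ : M → S} {V : Set M}
    (hV : IsOpen V) (hinj : InjOn (fun y => β (Γ y)) V) {y : M} (hy : y ∈ V)
    (hA : ContMDiffAt 𝓘(ℝ, E) 𝓘(ℝ, E) ∞ (fun y => α (Γ y)) y)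
    (hB : ContMDiffAt 𝓘(ℝ, E) 𝓘(ℝ, E) ∞ (fun y => β (Γ y)) y)
    (hdA : Function.Injective (mfderiv 𝓘(ℝ, E) 𝓘(ℝ, E) (fun y => α (Γ y)) y))
    (hdB : Function.Injective (mfderiv 𝓘(ℝ, E) 𝓘(ℝ, E) (fun y => β (Γ y)) y))
    {f g : M → ℝ} (hf : IsSmoothFun E f) (hg : IsSmoothFun E g) 
    (ξ η : TangentSpace 𝓘(ℝ, E) (α (Γ y)) →L[ℝ] ℝ)
    (hξ : ∀ w, ξ (mfderiv 𝓘(ℝ, E) 𝓘(ℝ, E) (fun y => α (Γ y)) y w) =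
      mvfderiv 𝓘(ℝ, E) (fun y => f (β (Γ y))) y w)
    (hη : ∀ w, η (mfderiv 𝓘(ℝ, E) 𝓘(ℝ, E) (fun y => α (Γ y)) y w) =
      mvfderiv 𝓘(ℝ, E) (fun y => g (β (Γ y))) y w) :
    π.pullbackEval (inducedMap α β (Γ '' V)) (β (Γ y)) (mvfderiv 𝓘(ℝ, E) f (β (Γ y)))
      (mvfderiv 𝓘(ℝ, E) g (β (Γ y))) = π.eval (α (Γ y)) ξ η := by
  have hD := mfderiv_inducedMap (α := α) hV hinj hy hA hB hdB
  have hval := inducedMap_eq (α := α) hinj hy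
  set φ := inducedMap α β (Γ '' V)
  obtain ⟨eA, heA⟩ := exists_tangentEquiv_of_injective hdA
  obtain ⟨eB, heB⟩ := exists_tangentEquiv_of_injective hdB
  have hφinj : Function.Injective (mfderiv 𝓘(ℝ, E) 𝓘(ℝ, E) φ (β (Γ y))) := by
    intro w w' hww
    obtain ⟨u, rfl⟩ := eB.surjective w
    obtain ⟨u', rfl⟩ := eB.surjective w'
    have h1 : ∀ u, eB u = mfderiv 𝓘(ℝ, E) 𝓘(ℝ, E) (fun y => β (Γ y)) y u :=
      fun u => DFunLike.congr_fun heB u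
    rw [h1, h1] at hww
    have h2 := hdA ((hD u).symm.trans (hww.trans (hD u')))
    rw [h2]
  obtain ⟨eφ, heφ⟩ := exists_tangentEquiv_of_injective hφinj
  have hinv : ∀ u, (mfderiv 𝓘(ℝ, E) 𝓘(ℝ, E) φ (β (Γ y))).inverse
      (mfderiv 𝓘(ℝ, E) 𝓘(ℝ, E) (fun y => α (Γ y)) y u) =
      mfderiv 𝓘(ℝ, E) 𝓘(ℝ, E) (fun y => β (Γ y)) y u := by
    intro u
    have h1 := hD u
    rw [← heφ] at h1 ⊢
    rw [ContinuousLinearMap.inverse_equiv, ← h1]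
    exact eφ.symm_apply_apply _
  have hBd := hB.mdifferentiableAt (by simp)
  refine eval_congr_of_eq π hval ?_ ?_
  · intro w
    obtain ⟨u, hu⟩ := eA.surjective w
    have hu' : mfderiv 𝓘(ℝ, E) 𝓘(ℝ, E) (fun y => α (Γ y)) y u = w := by
      rw [← heA]
      exact hu
    subst hu'
    have h1 := mvfderiv_comp_mfderiv (g := f) (f := fun y => β (Γ y))
      ((hf (β (Γ y))).mdifferentiableAt (by simp)) hBd u
    exact (congrArg (mvfderiv 𝓘(ℝ, E) f (β (Γ y))) (hinv u)).trans (h1.symm.trans (hξ u).symm)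
  · intro w
    obtain ⟨u, hu⟩ := eA.surjective w
    have hu' : mfderiv 𝓘(ℝ, E) 𝓘(ℝ, E) (fun y => α (Γ y)) y u = w := by
      rw [← heA]
      exact hu
    subst hu'
    have h1 := mvfderiv_comp_mfderiv (g := g) (f := fun y => β (Γ y))
      ((hg (β (Γ y))).mdifferentiableAt (by simp)) hBd u
    exact (congrArg (mvfderiv 𝓘(ℝ, E) g (β (Γ y))) (hinv u)).trans (h1.symm.trans (hη u).symm)

end Bisections

/-! ### Linear symplectic algebra of realization data -/

section Realization

variable {E : Type*} [NormedAddCommGroup E] [NormedSpace ℝ E] [FiniteDimensional ℝ E]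
  {M : Type*} [TopologicalSpace M] [ChartedSpace E M] [IsManifold 𝓘(ℝ, E) ∞ M] [T2Space M]
  {F : Type*} [NormedAddCommGroup F] [NormedSpace ℝ F] [FiniteDimensional ℝ F]
  {S : Type*} [TopologicalSpace S] [ChartedSpace F S] [IsManifold 𝓘(ℝ, F) ∞ S]

theorem SymplecticForm.form_hamVF (Ω : SymplecticForm F S) (G : S → ℝ) (s : S)
    (w : TangentSpace 𝓘(ℝ, F) s) : Ω.form s (Ω.hamVF G s) w = mvfderiv 𝓘(ℝ, F) G s w :=
  (Ω.exists_dual s (mvfderiv 𝓘(ℝ, F) G s)).choose_spec w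

theorem SymplecticForm.ext_of_form (Ω : SymplecticForm F S) {s : S}
    {v v' : TangentSpace 𝓘(ℝ, F) s} (h : ∀ w, Ω.form s v w = Ω.form s v' w) : v = v' := by
  rw [← sub_eq_zero]
  refine Ω.nondegenerate s _ fun w => ?_
  rw [map_sub, LinearMap.sub_apply, h w, sub_self]

theorem SymplecticForm.isRefl (Ω : SymplecticForm F S) (s : S) :
    LinearMap.BilinForm.IsRefl (Ω.form s : LinearMap.BilinForm ℝ (TangentSpace 𝓘(ℝ, F) s)) :=
  fun x y hxy => by rw [Ω.skew s y x, hxy, neg_zero]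

theorem SymplecticForm.nondegenerate_bilinForm (Ω : SymplecticForm F S) (s : S) :
    LinearMap.BilinForm.Nondegenerate
      (Ω.form s : LinearMap.BilinForm ℝ (TangentSpace 𝓘(ℝ, F) s)) :=
  (LinearMap.IsRefl.nondegenerate_iff_separatingLeft (Ω.isRefl s)).2 (Ω.nondegenerate s)

theorem SymplecticForm.orthogonal_orthogonal (Ω : SymplecticForm F S) {s : S}
    (W : Submodule ℝ (TangentSpace 𝓘(ℝ, F) s)) {v : TangentSpace 𝓘(ℝ, F) s}
    (h : ∀ u, (∀ w ∈ W, Ω.form s u w = 0) → Ω.form s v u = 0) : v ∈ W := by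
  have : FiniteDimensional ℝ (TangentSpace 𝓘(ℝ, F) s) := inferInstanceAs (FiniteDimensional ℝ F)
  let B : LinearMap.BilinForm ℝ (TangentSpace 𝓘(ℝ, F) s) := Ω.form s
  have hrefl : B.IsRefl := Ω.isRefl s
  have hnd : B.Nondegenerate := Ω.nondegenerate_bilinForm s
  have h1 := LinearMap.BilinForm.orthogonal_orthogonal hnd hrefl W
  rw [← h1]
  intro u hu
  have h2 : ∀ w ∈ W, Ω.form s u w = 0 := fun w hw => hrefl _ _ (hu w hw)
  exact hrefl _ _ (h u h2)

/-- An isotropic subspace of half the dimension equals its orthogonal, by a dimension count. -/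
theorem SymplecticForm.mem_of_isotropic (Ω : SymplecticForm F S) {s : S}
    (W : Submodule ℝ (TangentSpace 𝓘(ℝ, F) s)) (hd : Module.finrank ℝ F = 2 * Module.finrank ℝ W)
    (hW : ∀ v ∈ W, ∀ w ∈ W, Ω.form s v w = 0) {v : TangentSpace 𝓘(ℝ, F) s}
    (hv : ∀ w ∈ W, Ω.form s v w = 0) : v ∈ W := by
  have : FiniteDimensional ℝ (TangentSpace 𝓘(ℝ, F) s) := inferInstanceAs (FiniteDimensional ℝ F)
  let B : LinearMap.BilinForm ℝ (TangentSpace 𝓘(ℝ, F) s) := Ω.form s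
  have hrefl : B.IsRefl := Ω.isRefl s
  have hnd : B.Nondegenerate := Ω.nondegenerate_bilinForm s
  have h1 := LinearMap.BilinForm.finrank_orthogonal hnd W
  have hdS : Module.finrank ℝ (TangentSpace 𝓘(ℝ, F) s) = Module.finrank ℝ F := rfl
  have h2 : W = B.orthogonal W := by
    refine Submodule.eq_of_le_of_finrank_eq (fun v hv w hw => hW w hw v hv) ?_
    rw [h1]
    omega
  rw [h2]
  intro w hw
  exact hrefl _ _ (hv w hw)

theorem eq_of_forall_covector {x : M} {v w : TangentSpace 𝓘(ℝ, E) x}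
    (h : ∀ η : TangentSpace 𝓘(ℝ, E) x →L[ℝ] ℝ, η v = η w) : v = w := by
  have key : ∀ v w : E, (∀ η : E →L[ℝ] ℝ, η v = η w) → v = w := fun v w h => 
    SeparatingDual.eq_iff_forall_dual_eq.2 h
  exact key v w h

theorem IsPoissonMap.mdifferentiableAt {Ω : SymplecticForm F S} {π : PoissonTensor E M}
    {a : S → M} (ha : IsPoissonMap Ω π a) (s : S) : MDifferentiableAt 𝓘(ℝ, F) 𝓘(ℝ, E) a s :=
  (ha.1 s).mdifferentiableAt (by simp)

/-- A Poisson map sends the symplectic dual of the pullback of a covector `ξ` to `π^♯ ξ`. -/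
theorem IsPoissonMap.mfderiv_dual {Ω : SymplecticForm F S} {π : PoissonTensor E M} {a : S → M}
    (ha : IsPoissonMap Ω π a) {s : S} {ξ : TangentSpace 𝓘(ℝ, E) (a s) →L[ℝ] ℝ}
    {u : TangentSpace 𝓘(ℝ, F) s}
    (hu : ∀ w, Ω.form s u w = ξ (mfderiv 𝓘(ℝ, F) 𝓘(ℝ, E) a s w)) :
    mfderiv 𝓘(ℝ, F) 𝓘(ℝ, E) a s u = π.sharp (a s) ξ := by
  obtain ⟨f, hf, rfl⟩ := exists_smoothFun_mvfderiv_eq (a s) ξ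
  have hd : ∀ {g : M → ℝ}, IsSmoothFun E g → ∀ w, mvfderiv 𝓘(ℝ, F) (g ∘ a) s w =
      mvfderiv 𝓘(ℝ, E) g (a s) (mfderiv 𝓘(ℝ, F) 𝓘(ℝ, E) a s w) := fun hg w =>
    mvfderiv_comp_mfderiv ((hg _).mdifferentiableAt (by simp)) (ha.mdifferentiableAt s) w
  -- With `ξ = df`, the vector `u` is the Hamiltonian vector of `f ∘ a`, and pairing its image with
  -- `dg` gives the bracket that `a` preserves.
  have hu' : u = Ω.hamVF (f ∘ a) s :=
    Ω.ext_of_form fun w => by rw [hu, Ω.form_hamVF, hd hf]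
  refine eq_of_forall_covector fun η => ?_
  obtain ⟨g, hg, rfl⟩ := exists_smoothFun_mvfderiv_eq (a s) η
  have h1 := ha.2 f g hf hg s
  rw [SymplecticForm.bracket, ← hu', hd hg] at h1
  exact h1

theorem PoissonTensor.scale_sharp (c : ℝ) (π : PoissonTensor E M) (x : M)
    (ξ : TangentSpace 𝓘(ℝ, E) x →L[ℝ] ℝ) : (π.scale c).sharp x ξ = c • π.sharp x ξ := rfl

namespace IsRealizationData

variable {Ω : SymplecticForm F S} {π : PoissonTensor E M} {α β : S → M} {σ : M → S}

/-- The dual of a covector pulled back by `β` is orthogonal to `ker Dβ`, and this orthogonal is `ker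
Dα`. -/
theorem mfderiv_left_eq_zero (R : IsRealizationData Ω π α β σ) {s : S}
    {ξ : TangentSpace 𝓘(ℝ, E) (β s) →L[ℝ] ℝ} {u : TangentSpace 𝓘(ℝ, F) s}
    (hu : ∀ w, Ω.form s u w = ξ (mfderiv 𝓘(ℝ, F) 𝓘(ℝ, E) β s w)) :
    mfderiv 𝓘(ℝ, F) 𝓘(ℝ, E) α s u = 0 :=
  (R.orthogonal s u).2 fun w hw => by rw [hu, hw, map_zero]

/-- The hypothesis describes `ker Dα` as the orthogonal of `ker Dβ`; the roles are exchanged by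
taking the orthogonal twice. -/
theorem mfderiv_right_eq_zero (R : IsRealizationData Ω π α β σ) {s : S}
    {ξ : TangentSpace 𝓘(ℝ, E) (α s) →L[ℝ] ℝ} {u : TangentSpace 𝓘(ℝ, F) s}
    (hu : ∀ w, Ω.form s u w = ξ (mfderiv 𝓘(ℝ, F) 𝓘(ℝ, E) α s w)) :
    mfderiv 𝓘(ℝ, F) 𝓘(ℝ, E) β s u = 0 := by
  have h1 : u ∈ LinearMap.ker (mfderiv 𝓘(ℝ, F) 𝓘(ℝ, E) β s).toLinearMap := by
    refine Ω.orthogonal_orthogonal _ fun v hv => ?_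
    have h2 := (R.orthogonal s v).2 fun w hw => hv w hw
    rw [hu, h2, map_zero]
  exact h1

/-- The differentials of the pullbacks of a Casimir by `α` vanish along the fibers of `β`. -/
theorem casimir_mfderiv (R : IsRealizationData Ω π α β σ) {c : M → ℝ} (hc : π.IsCasimir c) {s : S}
    {v : TangentSpace 𝓘(ℝ, F) s} (hv : mfderiv 𝓘(ℝ, F) 𝓘(ℝ, E) β s v = 0) :
    mvfderiv 𝓘(ℝ, E) c (α s) (mfderiv 𝓘(ℝ, F) 𝓘(ℝ, E) α s v) = 0 := by
  have hd : ∀ w, mvfderiv 𝓘(ℝ, F) (c ∘ α) s w =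
      mvfderiv 𝓘(ℝ, E) c (α s) (mfderiv 𝓘(ℝ, F) 𝓘(ℝ, E) α s w) := fun w =>
    mvfderiv_comp_mfderiv ((hc.1 _).mdifferentiableAt (by simp)) (R.poisson.mdifferentiableAt s) w
  have hu : ∀ w, Ω.form s (Ω.hamVF (c ∘ α) s) w =
      mvfderiv 𝓘(ℝ, E) c (α s) (mfderiv 𝓘(ℝ, F) 𝓘(ℝ, E) α s w) := fun w => by
    rw [Ω.form_hamVF, hd]
  -- The Hamiltonian vector of `c ∘ α` projects by `α` to `π^♯ dc = 0`. Hence it lies in `ker Dα`,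
  -- the orthogonal of `ker Dβ`, and pairs to zero with `v`.
  have h1 := R.poisson.mfderiv_dual hu
  have h2 : π.sharp (α s) (mvfderiv 𝓘(ℝ, E) c (α s)) = 0 := by
    refine eq_of_forall_covector fun η => ?_
    obtain ⟨g, hg, rfl⟩ := exists_smoothFun_mvfderiv_eq (α s) η
    rw [map_zero]
    exact hc.2 g hg (α s)
  rw [h2] at h1
  rw [← hu]
  exact (R.orthogonal s _).1 h1 v hv

/-- The Hamiltonian vector field of `H ∘ α` is tangent to the fibers of `β`. -/
theorem mfderiv_right_hamVF (R : IsRealizationData Ω π α β σ) {H : M → ℝ} (hH : IsSmoothFun E H)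
    (s : S) : mfderiv 𝓘(ℝ, F) 𝓘(ℝ, E) β s (Ω.hamVF (H ∘ α) s) = 0 :=
  R.mfderiv_right_eq_zero (ξ := mvfderiv 𝓘(ℝ, E) H (α s)) fun w => by
    rw [Ω.form_hamVF]
    exact mvfderiv_comp_mfderiv ((hH _).mdifferentiableAt (by simp))
      (R.poisson.mdifferentiableAt s) w

/-- The Hamiltonian vector field of `H ∘ α` is `α`-related to that of `H`. -/
theorem mfderiv_left_hamVF (R : IsRealizationData Ω π α β σ) {H : M → ℝ} (hH : IsSmoothFun E H)
    (s : S) : mfderiv 𝓘(ℝ, F) 𝓘(ℝ, E) α s (Ω.hamVF (H ∘ α) s) = π.hamVF H (α s) :=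
  R.poisson.mfderiv_dual (ξ := mvfderiv 𝓘(ℝ, E) H (α s)) fun w => by
    rw [Ω.form_hamVF]
    exact mvfderiv_comp_mfderiv ((hH _).mdifferentiableAt (by simp))
      (R.poisson.mdifferentiableAt s) w

/-- The map induced by a Lagrangian bisection is Poisson. -/
theorem eval_eq_bracket (R : IsRealizationData Ω π α β σ) {Γ : M → S} {y : M}
    (hL : IsLagrangianEmb E Ω Γ) (hΓ : MDifferentiableAt 𝓘(ℝ, E) 𝓘(ℝ, F) Γ y)
    (hdA : Function.Injective (mfderiv 𝓘(ℝ, E) 𝓘(ℝ, E) (fun y => α (Γ y)) y))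
    {f g : M → ℝ} (hf : IsSmoothFun E f) (hg : IsSmoothFun E g)
    {ξ η : TangentSpace 𝓘(ℝ, E) (α (Γ y)) →L[ℝ] ℝ}
    (hξ : ∀ w, ξ (mfderiv 𝓘(ℝ, E) 𝓘(ℝ, E) (fun y => α (Γ y)) y w) =
      mvfderiv 𝓘(ℝ, E) (fun y => f (β (Γ y))) y w)
    (hη : ∀ w, η (mfderiv 𝓘(ℝ, E) 𝓘(ℝ, E) (fun y => α (Γ y)) y w) =
      mvfderiv 𝓘(ℝ, E) (fun y => g (β (Γ y))) y w) :
    π.eval (α (Γ y)) ξ η = π.bracket f g (β (Γ y)) := by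
  have hAc : ∀ w, mfderiv 𝓘(ℝ, E) 𝓘(ℝ, E) (fun y => α (Γ y)) y w =
      mfderiv 𝓘(ℝ, F) 𝓘(ℝ, E) α (Γ y) (mfderiv 𝓘(ℝ, E) 𝓘(ℝ, F) Γ y w) := fun w =>
    mfderiv_comp_apply y (R.poisson.mdifferentiableAt _) hΓ w
  have hBc : ∀ {f : M → ℝ}, IsSmoothFun E f → ∀ w,
      mvfderiv 𝓘(ℝ, E) (fun y => f (β (Γ y))) y w = mvfderiv 𝓘(ℝ, E) f (β (Γ y))
      (mfderiv 𝓘(ℝ, F) 𝓘(ℝ, E) β (Γ y) (mfderiv 𝓘(ℝ, E) 𝓘(ℝ, F) Γ y w)) := by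
    intro f hf w
    have h1 := mvfderiv_comp_mfderiv (g := fun s => f (β s)) (f := Γ) (s := y)
      (((hf _).mdifferentiableAt (by simp)).comp (Γ y) (R.antiPoisson.mdifferentiableAt _)) hΓ w
    rw [h1]
    exact mvfderiv_comp_mfderiv ((hf _).mdifferentiableAt (by simp))
      (R.antiPoisson.mdifferentiableAt _) _
  obtain ⟨u, hu⟩ := Ω.exists_dual (Γ y)
    (ξ ∘L (mfderiv 𝓘(ℝ, F) 𝓘(ℝ, E) α (Γ y)))
  obtain ⟨w, hw⟩ := Ω.exists_dual (Γ y)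
    (mvfderiv 𝓘(ℝ, E) f (β (Γ y)) ∘L (mfderiv 𝓘(ℝ, F) 𝓘(ℝ, E) β (Γ y)))
  have hΓinj : Function.Injective (mfderiv 𝓘(ℝ, E) 𝓘(ℝ, F) Γ y) := by
    intro v v' h
    apply hdA
    rw [hAc, hAc, h]
  -- By `hξ`, the duals `u` and `w` define the same functional on the tangent space of the
  -- bisection; so `u - w` is orthogonal to this Lagrangian space and therefore belongs to it.
  obtain ⟨τ, hτ⟩ : ∃ τ, mfderiv 𝓘(ℝ, E) 𝓘(ℝ, F) Γ y τ = u - w := by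
    have h1 : u - w ∈ LinearMap.range (mfderiv 𝓘(ℝ, E) 𝓘(ℝ, F) Γ y).toLinearMap := by
      refine Ω.mem_of_isotropic _ ?_ ?_ ?_
      · rw [LinearMap.finrank_range_of_inj hΓinj]
        exact hL.1
      · rintro _ ⟨v, rfl⟩ _ ⟨v', rfl⟩
        exact hL.2 y v v'
      · rintro _ ⟨v, rfl⟩
        have e1 := hu (mfderiv 𝓘(ℝ, E) 𝓘(ℝ, F) Γ y v)
        have e2 := hw (mfderiv 𝓘(ℝ, E) 𝓘(ℝ, F) Γ y v)
        rw [ContinuousLinearMap.comp_apply] at e1 e2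
        rw [← hAc, hξ] at e1
        rw [← hBc hf] at e2
        rw [map_sub, LinearMap.sub_apply, sub_eq_zero]
        exact e1.trans e2.symm
    exact h1
  -- Each dual is killed by the differential of the other map. The minus sign in `u - w` compensates
  -- for `β` being anti-Poisson, so both images carry the same sign and `hη τ` is the claim.
  have hAτ : mfderiv 𝓘(ℝ, E) 𝓘(ℝ, E) (fun y => α (Γ y)) y τ = π.sharp (α (Γ y)) ξ := by
    rw [hAc, hτ, map_sub, R.poisson.mfderiv_dual hu, R.mfderiv_left_eq_zero hw, sub_zero]
  have hBτ : mfderiv 𝓘(ℝ, F) 𝓘(ℝ, E) β (Γ y) (mfderiv 𝓘(ℝ, E) 𝓘(ℝ, F) Γ y τ) =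
      π.sharp (β (Γ y)) (mvfderiv 𝓘(ℝ, E) f (β (Γ y))) := by
    rw [hτ, map_sub, R.antiPoisson.mfderiv_dual (ξ := mvfderiv 𝓘(ℝ, E) f (β (Γ y))) hw,
      R.mfderiv_right_eq_zero hu, zero_sub,
      PoissonTensor.scale_sharp, neg_smul, one_smul, neg_neg]
  have h1 := hη τ
  rw [hAτ, hBc hg, hBτ] at h1
  exact h1

end IsRealizationData

end Realization

/-! ### Trivializations of the cotangent bundle -/

section CotangentCoordinates

variable {E : Type*} [NormedAddCommGroup E] [NormedSpace ℝ E]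
  {M : Type*} [TopologicalSpace M] [ChartedSpace E M] [IsManifold 𝓘(ℝ, E) ∞ M]

/-- A local trivialization of `T*M` around `x₀`, together with smooth vector fields whose values
form the dual frame. -/
structure CotangentCoord (x₀ : M) (Φ : M × (E →L[ℝ] ℝ) → CotangentBundle E M)
    (co : CotangentBundle E M → (E →L[ℝ] ℝ)) (X : E → ∀ x : M, TangentSpace 𝓘(ℝ, E) x) : Prop where
  smooth : ∀ᶠ y in 𝓝 x₀, ∀ ξ : E →L[ℝ] ℝ,
    ContMDiffAt (𝓘(ℝ, E).prod 𝓘(ℝ, E →L[ℝ] ℝ)) (𝓘(ℝ, E).prod 𝓘(ℝ, E →L[ℝ] ℝ)) ∞ Φ (y, ξ)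
  continuousAt : ContinuousAt co ⟨x₀, 0⟩
  left_inv : ∀ᶠ y in 𝓝 x₀, ∀ p, Φ (y, co ⟨y, p⟩) = ⟨y, p⟩
  smoothVF : ∀ w, IsSmoothVF (X w)
  frame : ∀ᶠ y in 𝓝 x₀, ∀ p w, co ⟨y, p⟩ w = p (X w y)

/-- The trivialization of `T*M` is dual to that of `TM`, so the coordinates of `p` are its values on
the frame. The frame is cut off by a bump function to give global smooth fields, as
`ApproxLagrangian` tests 1-forms only on these. -/
theorem exists_cotangentCoord [FiniteDimensional ℝ E] [T2Space M] (x₀ : M) :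
    ∃ Φ co X, CotangentCoord (E := E) x₀ Φ co X := by
  let e := trivializationAt (E →L[ℝ] ℝ) (fun x : M => TangentSpace 𝓘(ℝ, E) x →L[ℝ] ℝ) x₀
  let eT := trivializationAt E (TangentSpace 𝓘(ℝ, E) : M → Type _) x₀
  let ρ : SmoothBumpFunction 𝓘(ℝ, E) x₀ := Classical.arbitrary _
  have hbase : ∀ᶠ y in 𝓝 x₀, y ∈ e.baseSet :=
    e.open_baseSet.mem_nhds (mem_baseSet_trivializationAt _ _ x₀)
  refine ⟨e.toOpenPartialHomeomorph.symm, fun z => (e z).2, fun w y => ρ y • eT.symmL ℝ y w,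
    ⟨?_, ?_, ?_, ?_, ?_⟩⟩
  · filter_upwards [hbase] with y hy ξ
    exact (e.contMDiffOn_symm (IB := 𝓘(ℝ, E)) (n := ∞) (y, ξ) (e.mem_target.2 hy)).contMDiffAt
      (e.open_target.mem_nhds (e.mem_target.2 hy))
  · have h1 : (⟨x₀, 0⟩ : CotangentBundle E M) ∈ e.source :=
      e.mem_source.2 (mem_baseSet_trivializationAt _ _ x₀)
    exact continuous_snd.continuousAt.comp (e.continuousAt h1)
  · filter_upwards [hbase] with y hy p
    have h1 : (⟨y, p⟩ : CotangentBundle E M) ∈ e.source := e.mem_source.2 hy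
    have h2 := e.mk_proj_snd h1
    have h3 : (y, (e ⟨y, p⟩).2) = e ⟨y, p⟩ := h2
    rw [h3]
    exact e.toOpenPartialHomeomorph.left_inv h1
  · intro w y
    by_cases hy : y ∈ tsupport ρ
    · have hy' : y ∈ eT.baseSet := by
        have := ρ.tsupport_subset_chartAt_source hy
        simpa [eT] using this
      have h1 : ContMDiffAt 𝓘(ℝ, E) 𝓘(ℝ, E).tangent ∞
          (fun y => (⟨y, eT.symmL ℝ y w⟩ : TangentBundle 𝓘(ℝ, E) M)) y := by
        have h2 := (eT.contMDiffOn_symm (IB := 𝓘(ℝ, E)) (n := ∞) (y, w)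
          (eT.mem_target.2 hy')).contMDiffAt (eT.open_target.mem_nhds (eT.mem_target.2 hy'))
        have h3 : ContMDiffAt 𝓘(ℝ, E) (𝓘(ℝ, E).prod 𝓘(ℝ, E)) ∞ (fun y : M => (y, w)) y :=
          contMDiffAt_id.prodMk contMDiffAt_const
        refine (h2.comp y h3).congr_of_eventuallyEq ?_
        filter_upwards [eT.open_baseSet.mem_nhds hy'] with y' hy'
        rw [eT.symmL_apply hy']
        exact eT.mk_symm hy' w
      exact ContMDiffAt.smul_section ρ.contMDiffAt h1
    · refine ContMDiffAt.congr_of_eventuallyEq (f := Bundle.zeroSection E (TangentSpace 𝓘(ℝ, E)))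
        (Bundle.contMDiff_zeroSection ℝ _ _) ?_
      filter_upwards [(isClosed_tsupport ρ).isOpen_compl.mem_nhds hy] with y' hy'
      have : ρ y' = 0 := image_eq_zero_of_notMem_tsupport hy'
      simp [this, Bundle.zeroSection]
  · filter_upwards [hbase, ρ.eventuallyEq_one] with y hy hρ p w
    have h1 : (e ⟨y, p⟩).2 w = p (eT.symmL ℝ y w) := by
      -- The fiber coordinate of a bundle of linear maps is composition with the trivializations at
      -- both ends; at the end of the trivial line bundle it is the identity.
      change ((trivializationAt ℝ (Bundle.Trivial M ℝ) x₀).continuousLinearMapAt ℝ y)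
        (p (eT.symmL ℝ y w)) = _
      have h2 : trivializationAt ℝ (Bundle.Trivial M ℝ) x₀ =
          Bundle.Trivial.trivialization M ℝ := rfl
      simp only [h2, Bundle.Trivial.continuousLinearMapAt_trivialization]
      rfl
    rw [h1]
    simp [hρ]

end CotangentCoordinates

/-! ### Coordinates near the section -/

section Tubular

variable {E : Type*} [NormedAddCommGroup E] [NormedSpace ℝ E]
  {M : Type*} [TopologicalSpace M] [ChartedSpace E M] [IsManifold 𝓘(ℝ, E) ∞ M]
  {F : Type*} [NormedAddCommGroup F] [NormedSpace ℝ F]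
  {S : Type*} [TopologicalSpace S] [ChartedSpace F S]

/-- Coordinates `(ξ, y) ↦ Λ ξ y` on a neighbourhood of `σ x₀` given by a tubular neighbourhood and a
local trivialization of `T*M`. -/
structure TubularCoord (Ψ : OpenPartialHomeomorph (CotangentBundle E M) S) (σ : M → S) (x₀ : M)
    (Λ : (E →L[ℝ] ℝ) → M → S) (co : CotangentBundle E M → (E →L[ℝ] ℝ))
    (X : E → ∀ x : M, TangentSpace 𝓘(ℝ, E) x) : Prop where
  smooth : ∀ᶠ q in 𝓝 ((0 : E →L[ℝ] ℝ), x₀),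
    ContMDiffAt (𝓘(ℝ, E →L[ℝ] ℝ).prod 𝓘(ℝ, E)) 𝓘(ℝ, F) ∞
      (fun q : (E →L[ℝ] ℝ) × M => Λ q.1 q.2) q
  zero : ∀ᶠ y in 𝓝 x₀, Λ 0 y = σ y
  eq_graph : ∀ᶠ y in 𝓝 x₀, ∀ p, Λ (co ⟨y, p⟩) y = Ψ ⟨y, p⟩
  tendsto : Tendsto (fun s => (co (Ψ.symm s), (Ψ.symm s).proj)) (𝓝 (σ x₀)) (𝓝 (0, x₀))
  eq_self : ∀ᶠ s in 𝓝 (σ x₀), Λ (co (Ψ.symm s)) (Ψ.symm s).proj = s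
  mem_target : ∀ᶠ s in 𝓝 (σ x₀), s ∈ Ψ.target
  smoothVF : ∀ w, IsSmoothVF (X w)
  frame : ∀ᶠ y in 𝓝 x₀, ∀ p w, co ⟨y, p⟩ w = p (X w y)

/-- The covector coordinate comes first in `Λ` because it will serve as a parameter: for fixed `ξ`,
`y ↦ Λ ξ y` is a section-like map into which `α` or `β` is composed to get a family of self-maps of
`M`. -/
theorem IsTubularNeighbourhood.exists_coord [FiniteDimensional ℝ E] [T2Space M]
    {Ψ : OpenPartialHomeomorph (CotangentBundle E M) S} {σ : M → S}
    (hΨ : IsTubularNeighbourhood (F := F) Ψ σ) (x₀ : M) :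
    ∃ Λ co X, TubularCoord (F := F) Ψ σ x₀ Λ co X := by
  obtain ⟨Φ, co, X, h⟩ := exists_cotangentCoord (E := E) x₀
  have hco0 : ∀ᶠ y in 𝓝 x₀, co ⟨y, 0⟩ = 0 := by
    filter_upwards [h.frame] with y hy
    ext w
    simp [hy 0 w]
  have hΦ0 : Φ (x₀, 0) = ⟨x₀, 0⟩ := by
    have := h.left_inv.self_of_nhds 0
    rwa [hco0.self_of_nhds] at this
  have hmem : Ψ ⟨x₀, 0⟩ ∈ Ψ.target := Ψ.map_source (hΨ.zero_mem x₀)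
  have hmem' : σ x₀ ∈ Ψ.target := by rwa [← hΨ.zero_eq x₀]
  have hsymm : Ψ.symm (σ x₀) = ⟨x₀, 0⟩ := by
    rw [← hΨ.zero_eq x₀]
    exact Ψ.left_inv (hΨ.zero_mem x₀)
  have hc : Tendsto Ψ.symm (𝓝 (σ x₀)) (𝓝 ⟨x₀, 0⟩) := by
    have := (Ψ.continuousAt_symm hmem').tendsto
    rwa [hsymm] at this
  have hproj : Tendsto (fun s => (Ψ.symm s).proj) (𝓝 (σ x₀)) (𝓝 x₀) := by
    have h1 : Continuous (Bundle.TotalSpace.proj : CotangentBundle E M → M) :=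
      FiberBundle.continuous_proj _ _
    exact (h1.tendsto (⟨x₀, 0⟩ : CotangentBundle E M)).comp hc
  have hgraph : ∀ᶠ y in 𝓝 x₀, ∀ p, Ψ (Φ (y, co ⟨y, p⟩)) = Ψ ⟨y, p⟩ := by
    filter_upwards [h.left_inv] with y hy p
    rw [hy p]
  refine ⟨fun ξ y => Ψ (Φ (y, ξ)), co, X, ⟨?_, ?_, hgraph, ?_, ?_, ?_, h.smoothVF,
    h.frame⟩⟩
  · have hΦc : ContinuousAt Φ (x₀, 0) := (h.smooth.self_of_nhds 0).continuousAt
    have hsw : Tendsto (fun q : (E →L[ℝ] ℝ) × M => (q.2, q.1)) (𝓝 (0, x₀)) (𝓝 (x₀, 0)) :=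
      continuous_swap.tendsto _
    have h1 : ∀ᶠ q in 𝓝 ((0 : E →L[ℝ] ℝ), x₀), Φ (q.2, q.1) ∈ Ψ.source := by
      refine (hΦc.tendsto.comp hsw).eventually (Ψ.open_source.mem_nhds ?_)
      rw [hΦ0]
      exact hΨ.zero_mem x₀
    filter_upwards [h1, (continuous_snd.tendsto ((0 : E →L[ℝ] ℝ), x₀)).eventually h.smooth]
      with q hq hq2
    have e1 : ContMDiffAt (𝓘(ℝ, E →L[ℝ] ℝ).prod 𝓘(ℝ, E)) (𝓘(ℝ, E).prod 𝓘(ℝ, E →L[ℝ] ℝ)) ∞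
        (fun q : (E →L[ℝ] ℝ) × M => Φ (q.2, q.1)) q :=
      ContMDiffAt.comp q (g := Φ) (f := fun q : (E →L[ℝ] ℝ) × M => (q.2, q.1)) (hq2 q.1)
        (contMDiffAt_snd.prodMk contMDiffAt_fst)
    exact ContMDiffAt.comp q (g := Ψ) ((hΨ.smooth _ hq).contMDiffAt (Ψ.open_source.mem_nhds hq)) e1
  · filter_upwards [hgraph, hco0] with y hy hy0
    have := hy 0
    rw [hy0] at this
    rw [this]
    exact hΨ.zero_eq y
  · refine Tendsto.prodMk_nhds ?_ hproj
    have := h.continuousAt.tendsto.comp hc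
    rwa [hco0.self_of_nhds] at this
  · filter_upwards [hproj.eventually hgraph, Ψ.open_target.mem_nhds hmem'] with s hs hs'
    have h1 := hs (Ψ.symm s).2
    have h2 : (⟨(Ψ.symm s).proj, (Ψ.symm s).2⟩ : CotangentBundle E M) = Ψ.symm s := rfl
    rw [h2, Ψ.right_inv hs'] at h1
    exact h1
  · exact Ψ.open_target.mem_nhds hmem'

end Tubular

/-! ### Smoothness after `ε = t ^ 2`, and Casimirs near the section -/

section Casimir

variable {E : Type*} [NormedAddCommGroup E] [NormedSpace ℝ E] [FiniteDimensional ℝ E]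
  {M : Type*} [TopologicalSpace M] [ChartedSpace E M] [IsManifold 𝓘(ℝ, E) ∞ M] [T2Space M]
  {F : Type*} [NormedAddCommGroup F] [NormedSpace ℝ F] [FiniteDimensional ℝ F]
  {S : Type*} [TopologicalSpace S] [ChartedSpace F S] [IsManifold 𝓘(ℝ, F) ∞ S]

/-- A smooth family becomes smooth on an open set after the substitution `ε = t ^ 2`. -/
theorem IsSmoothFamily.contMDiffAt_sq {ε₀ : ℝ} {a : ℝ → S → M} (ha : IsSmoothFamily E F ε₀ a)
    {t : ℝ} (ht : t ^ 2 < ε₀) (s : S) :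
    ContMDiffAt (𝓘(ℝ, ℝ).prod 𝓘(ℝ, F)) 𝓘(ℝ, E) ∞ (fun q : ℝ × S => a (q.1 ^ 2) q.2) (t, s) := by
  have h1 : ContMDiffAt (𝓘(ℝ, ℝ).prod 𝓘(ℝ, F)) (𝓘(ℝ, ℝ).prod 𝓘(ℝ, F)) ∞
      (fun q : ℝ × S => (q.1 ^ 2, q.2)) (t, s) := by
    refine ContMDiffAt.prodMk ?_ contMDiffAt_snd
    exact ContMDiffAt.comp (t, s) (g := fun t : ℝ => t ^ 2) (f := fun q : ℝ × S => q.1)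
      (contMDiffAt_iff_contDiffAt.2 (contDiffAt_id.pow 2)) contMDiffAt_fst
  have h2 := ha (t ^ 2, s) ⟨⟨sq_nonneg t, ht⟩, mem_univ s⟩
  have h3 : (fun q : ℝ × S => (q.1 ^ 2, q.2)) ⁻¹' (Ico 0 ε₀ ×ˢ univ) ∈ 𝓝 (t, s) := by
    have hc : Continuous fun q : ℝ × S => q.1 ^ 2 := by fun_prop
    filter_upwards [hc.continuousAt.eventually (isOpen_Iio.mem_nhds (show t ^ 2 ∈ Iio ε₀ from ht))]
      with q hq
    exact ⟨⟨sq_nonneg _, hq⟩, mem_univ _⟩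
  have h4 := ContMDiffWithinAt.comp (t, s) h2 (h1.contMDiffWithinAt
    (s := (fun q : ℝ × S => (q.1 ^ 2, q.2)) ⁻¹' (Ico 0 ε₀ ×ˢ univ))) (fun q hq => hq)
  exact h4.contMDiffAt h3

theorem contMDiffAt_comp_family {P : Type*} [NormedAddCommGroup P] [NormedSpace ℝ P]
    {n : WithTop ℕ∞} {b : ℝ → S → M} {τ : P → ℝ} {g : P × M → S} {q₀ : P × M}
    (hb : ContMDiffAt (𝓘(ℝ, ℝ).prod 𝓘(ℝ, F)) 𝓘(ℝ, E) n (fun q : ℝ × S => b q.1 q.2)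
      (τ q₀.1, g q₀))
    (hτ : ContDiffAt ℝ n τ q₀.1)
    (hg : ContMDiffAt (𝓘(ℝ, P).prod 𝓘(ℝ, E)) 𝓘(ℝ, F) n g q₀) :
    ContMDiffAt (𝓘(ℝ, P).prod 𝓘(ℝ, E)) 𝓘(ℝ, E) n (fun q : P × M => b (τ q.1) (g q)) q₀ := by
  have h1 : ContMDiffAt (𝓘(ℝ, P).prod 𝓘(ℝ, E)) 𝓘(ℝ, ℝ) n (fun q : P × M => τ q.1) q₀ :=
    ContMDiffAt.comp q₀ (g := τ) (f := fun q : P × M => q.1)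
      (contMDiffAt_iff_contDiffAt.2 hτ) contMDiffAt_fst
  exact ContMDiffAt.comp q₀ (g := fun q : ℝ × S => b q.1 q.2) (f := fun q : P × M => (τ q.1, g q))
    hb (h1.prodMk hg)

/-- A Casimir has the same pullbacks by the two maps of realization data, near the section. -/
theorem eventually_casimir_eq {Ω : SymplecticForm F S} {π : PoissonTensor E M} {σ : M → S}
    {ε₀ : ℝ} (hε₀ : 0 < ε₀) {α β : ℝ → S → M} (hβ : IsSmoothFamily E F ε₀ β)
    (hR : ∀ ε ∈ Ico 0 ε₀, IsRealizationData Ω (π.scale ε) (α ε) (β ε) σ)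
    {Ψ : OpenPartialHomeomorph (CotangentBundle E M) S} (hΨ : IsTubularNeighbourhood (F := F) Ψ σ)
    (x₀ : M) :
    ∀ᶠ q in 𝓝 ((0 : ℝ), σ x₀), ∀ c, (π.scale (q.1 ^ 2)).IsCasimir c →
      c (α (q.1 ^ 2) q.2) = c (β (q.1 ^ 2) q.2) := by
  obtain ⟨Λ, co, X, hΛ⟩ := hΨ.exists_coord x₀
  have hε : ∀ᶠ t in 𝓝 (0 : ℝ), t ^ 2 < ε₀ := by
    have : Continuous fun t : ℝ => t ^ 2 := by fun_prop
    exact this.continuousAt.eventually (Iio_mem_nhds (by simpa using hε₀))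
  let P := ℝ × (E →L[ℝ] ℝ)
  -- The parameter is `p = (t, ξ)`. Near `x₀` the map `G 0` is the identity, so the family has a
  -- local inverse `J`, and `J (t, ξ) x` is the base point at which the fiber of `β` over `x` meets
  -- the covector coordinate `ξ`.
  let G : P → M → M := fun p y => β (p.1 ^ 2) (Λ p.2 y)
  have hR0 := hR 0 ⟨le_rfl, hε₀⟩
  have hΛ0 : Λ 0 x₀ = σ x₀ := hΛ.zero.self_of_nhds
  have hΛP : ∀ᶠ q : P × M in 𝓝 ((0 : P), x₀), ContMDiffAt (𝓘(ℝ, P).prod 𝓘(ℝ, E)) 𝓘(ℝ, F) ∞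
      (fun q : P × M => Λ q.1.2 q.2) q := by
    have hc : Tendsto (fun q : P × M => (q.1.2, q.2)) (𝓝 ((0 : P), x₀)) (𝓝 (0, x₀)) := by
      have : Continuous fun q : P × M => (q.1.2, q.2) :=
        (continuous_snd.comp continuous_fst).prodMk continuous_snd
      exact this.tendsto _
    filter_upwards [hc.eventually hΛ.smooth] with q hq
    refine ContMDiffAt.comp q (g := fun q : (E →L[ℝ] ℝ) × M => Λ q.1 q.2)
      (f := fun q : P × M => (q.1.2, q.2)) hq ?_
    exact (ContMDiffAt.comp q (g := fun p : P => p.2) (f := fun q : P × M => q.1)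
      (contMDiffAt_iff_contDiffAt.2 contDiffAt_snd) contMDiffAt_fst).prodMk contMDiffAt_snd
  have hGsm : ContMDiffAt (𝓘(ℝ, P).prod 𝓘(ℝ, E)) 𝓘(ℝ, E) ∞ (fun q : P × M => G q.1 q.2)
      ((0 : P), x₀) :=
    contMDiffAt_comp_family (b := fun t s => β (t ^ 2) s) (τ := fun p : P => p.1)
      (hβ.contMDiffAt_sq (by simpa using hε₀) _) contDiffAt_fst hΛP.self_of_nhds
  have hGid : G 0 =ᶠ[𝓝 x₀] id := by
    filter_upwards [hΛ.zero] with y hy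
    simp only [G, Prod.snd_zero, hy, Prod.fst_zero, ne_eq, OfNat.ofNat_ne_zero, not_false_eq_true,
      zero_pow, id]
    exact hR0.section_right y
  have hG0 : G 0 x₀ = x₀ := hGid.self_of_nhds
  have hinj : Function.Injective (mfderiv 𝓘(ℝ, E) 𝓘(ℝ, E) (G 0) x₀) := by
    have h1 := hGid.mfderiv_eq (I := 𝓘(ℝ, E)) (I' := 𝓘(ℝ, E))
    rw [mfderiv_id] at h1
    intro v w hvw
    have h2 := DFunLike.congr_fun h1 v
    have h3 := DFunLike.congr_fun h1 w
    exact h2.symm.trans (hvw.trans h3)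
  obtain ⟨J, hJ, hJl, hJr⟩ := exists_local_inverse rfl hGsm hinj
  have hJ0 : J 0 (G 0 x₀) = x₀ := hJl.self_of_nhds
  rw [hG0] at hJ hJr hJ0
  have hJc : Tendsto (fun q : P × M => (q.1, J q.1 q.2)) (𝓝 ((0 : P), x₀)) (𝓝 ((0 : P), x₀)) := by
    have := hJ.continuousAt.tendsto
    simp only [hJ0] at this
    exact (continuous_fst.tendsto ((0 : P), x₀)).prodMk_nhds this
  -- For fixed `t` and `x`, the map `ξ ↦ W ((t, ξ), x)` parametrizes the fiber of `β` over `x` near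
  -- the section.
  let W : P × M → S := fun q => Λ q.1.2 (J q.1 q.2)
  have hW : ∀ᶠ q : P × M in 𝓝 ((0 : P), x₀),
      MDifferentiableAt (𝓘(ℝ, P).prod 𝓘(ℝ, E)) 𝓘(ℝ, F) W q := by
    have hJ1 := (contMDiffAt_iff_contMDiffAt_nhds (n := 1) (by simp)).1 (hJ.of_le (by simp))
    filter_upwards [hJ1, hJc.eventually hΛP] with q hq1 hq2
    exact MDifferentiableAt.comp q (g := fun q : P × M => Λ q.1.2 q.2)
      (f := fun q : P × M => (q.1, J q.1 q.2)) (hq2.mdifferentiableAt (by simp))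
      (mdifferentiableAt_fst.prodMk (hq1.mdifferentiableAt (by simp)))
  -- the radial paths in the fibers of `β`
  let Z := P × M
  -- The compact interval contains `[0, 1]` in its interior, so that derivatives along the path are
  -- two-sided on `[0, 1]`.
  have hrad : ∀ᶠ z : Z in 𝓝 ((0 : P), x₀), ∀ t ∈ Icc (-1 : ℝ) 2,
      MDifferentiableAt (𝓘(ℝ, P).prod 𝓘(ℝ, E)) 𝓘(ℝ, F) W ((z.1.1, t • z.1.2), z.2) ∧
      G (z.1.1, t • z.1.2) (J (z.1.1, t • z.1.2) z.2) = z.2 := by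
    refine isCompact_Icc.eventually_forall_of_forall_eventually fun t _ => ?_
    have hc : Tendsto (fun w : Z × ℝ => (((w.1.1.1, w.2 • w.1.1.2) : P), w.1.2))
        (𝓝 (((0 : P), x₀), t)) (𝓝 ((0 : P), x₀)) := by
      have hP : Continuous fun w : Z × ℝ => w.1.1 := continuous_fst.comp continuous_fst
      have h1 : Continuous fun w : Z × ℝ => (((w.1.1.1, w.2 • w.1.1.2) : P), w.1.2) :=
        ((continuous_fst.comp hP).prodMk (continuous_snd.smul (continuous_snd.comp hP))).prodMk
          (continuous_snd.comp continuous_fst)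
      have h2 := h1.tendsto (((0 : P), x₀), t)
      have h3 : ((((0 : P).1, t • (0 : P).2) : P), x₀) = ((0 : P), x₀) :=
        Prod.ext (Prod.ext rfl (smul_zero t)) rfl
      simp only [h3] at h2
      exact h2
    exact hc.eventually (hW.and hJr)
  have hcoord : Tendsto (fun q : ℝ × S => (((q.1, co (Ψ.symm q.2)) : P), β (q.1 ^ 2) q.2))
      (𝓝 ((0 : ℝ), σ x₀)) (𝓝 ((0 : P), x₀)) := by
    have h1 := (hβ.contMDiffAt_sq (t := 0) (by simpa using hε₀) (σ x₀)).continuousAt.tendsto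
    have h2 : β ((0 : ℝ) ^ 2) (σ x₀) = x₀ := by simpa using hR0.section_right x₀
    simp only [h2] at h1
    have h3 := ((continuous_fst.tendsto _).comp hΛ.tendsto).comp
      (continuous_snd.tendsto ((0 : ℝ), σ x₀))
    exact ((continuous_fst.tendsto ((0 : ℝ), σ x₀)).prodMk_nhds h3).prodMk_nhds h1
  have hcoord2 : Tendsto (fun q : ℝ × S => (((q.1, co (Ψ.symm q.2)) : P), (Ψ.symm q.2).proj))
      (𝓝 ((0 : ℝ), σ x₀)) (𝓝 ((0 : P), x₀)) := by
    have h3 := hΛ.tendsto.comp (continuous_snd.tendsto ((0 : ℝ), σ x₀))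
    exact ((continuous_fst.tendsto ((0 : ℝ), σ x₀)).prodMk_nhds
      ((continuous_fst.tendsto _).comp h3)).prodMk_nhds ((continuous_snd.tendsto _).comp h3)
  have hJβ := hJc.comp hcoord
  have hzeroJ : Tendsto (fun q : ℝ × S => J (q.1, (0 : E →L[ℝ] ℝ)) (β (q.1 ^ 2) q.2))
      (𝓝 ((0 : ℝ), σ x₀)) (𝓝 x₀) := by
    have h1 : Tendsto (fun q : ℝ × S => (((q.1, (0 : E →L[ℝ] ℝ)) : P), β (q.1 ^ 2) q.2))
        (𝓝 ((0 : ℝ), σ x₀)) (𝓝 ((0 : P), x₀)) :=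
      ((continuous_fst.tendsto ((0 : ℝ), σ x₀)).prodMk_nhds tendsto_const_nhds).prodMk_nhds
        ((continuous_snd.tendsto _).comp hcoord)
    exact (continuous_snd.tendsto _).comp (hJc.comp h1)
  filter_upwards [hcoord.eventually hrad, hcoord2.eventually hJl,
    (continuous_snd.tendsto ((0 : ℝ), σ x₀)).eventually hΛ.eq_self,
    (continuous_fst.tendsto ((0 : ℝ), σ x₀)).eventually hε,
    hzeroJ.eventually hΛ.zero] with q hq hql hqs hqε hq0 c hc
  obtain ⟨t, s⟩ := q
  simp only at hq hql hqs hqε hq0 hc ⊢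
  have R := hR (t ^ 2) ⟨sq_nonneg t, hqε⟩
  set ξ := co (Ψ.symm s)
  set x := β (t ^ 2) s with hx
  -- A path inside the fiber of `β` through `s`, from the section to `s`; `c ∘ α` is constant along
  -- it by `casimir_mfderiv`.
  let γ : ℝ → S := fun r => W ((t, r • ξ), x)
  have hβγ : ∀ r ∈ Icc (-1 : ℝ) 2, β (t ^ 2) (γ r) = x := fun r hr => (hq r hr).2
  have hγd : ∀ r ∈ Icc (-1 : ℝ) 2, MDifferentiableAt 𝓘(ℝ, ℝ) 𝓘(ℝ, F) γ r := by
    intro r hr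
    refine MDifferentiableAt.comp r (g := W) (f := fun r : ℝ => (((t, r • ξ) : P), x))
      (hq r hr).1 ?_
    refine MDifferentiableAt.prodMk ?_ mdifferentiableAt_const
    rw [mdifferentiableAt_iff_differentiableAt]
    fun_prop
  have hγ1 : γ 1 = s := by
    have h1 : J (t, ξ) x = (Ψ.symm s).proj := by
      have : G (t, ξ) (Ψ.symm s).proj = x := by
        simp only [G, hqs, ξ, hx]
      rw [← this]
      exact hql
    simp only [γ, W, one_smul, h1]
    exact hqs
  -- At `r = 0` the path is on the section, and applying `β` identifies the point as `σ x`.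
  have hγ0 : γ 0 = σ x := by
    have h1 : γ 0 = σ (J (t, 0) x) := by
      simp only [γ, W, zero_smul]
      exact hq0
    have h2 := hβγ 0 (by norm_num)
    rw [h1, R.section_right] at h2
    rw [h1, h2]
  have hder : ∀ r ∈ Ioo (-1 : ℝ) 2, HasDerivAt (fun r => c (α (t ^ 2) (γ r))) 0 r := by
    intro r hr
    have hr' : r ∈ Icc (-1 : ℝ) 2 := Ioo_subset_Icc_self hr
    have hcα : MDifferentiableAt 𝓘(ℝ, F) 𝓘(ℝ, ℝ) (fun s => c (α (t ^ 2) s)) (γ r) :=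
      ((hc.1 _).mdifferentiableAt (by simp)).comp (γ r) (R.poisson.mdifferentiableAt _)
    have h1 : DifferentiableAt ℝ (fun r => c (α (t ^ 2) (γ r))) r := by
      rw [← mdifferentiableAt_iff_differentiableAt]
      exact hcα.comp r (hγd r hr')
    have h2 : deriv (fun r => c (α (t ^ 2) (γ r))) r = 0 := by
      have e1 := mvfderiv_comp_mfderiv hcα (hγd r hr') (1 : ℝ)
      rw [mvfderiv_eq_fderiv, fderiv_apply_one_eq_deriv] at e1
      rw [e1]
      have e2 := mvfderiv_comp_mfderiv (g := c) (f := α (t ^ 2)) (s := γ r)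
        ((hc.1 _).mdifferentiableAt (by simp)) (R.poisson.mdifferentiableAt _)
        (mfderiv 𝓘(ℝ, ℝ) 𝓘(ℝ, F) γ r (1 : ℝ))
      rw [e2]
      refine R.casimir_mfderiv hc ?_
      have e3 := mfderiv_comp_apply r (R.antiPoisson.mdifferentiableAt (γ r)) (hγd r hr') (1 : ℝ)
      rw [← e3]
      have e4 : (β (t ^ 2) ∘ γ) =ᶠ[𝓝 r] fun _ => x := by
        filter_upwards [Icc_mem_nhds hr.1 hr.2] with r' hr'
        exact hβγ r' hr'
      have e5 := e4.mfderiv_eq (I := 𝓘(ℝ, ℝ)) (I' := 𝓘(ℝ, E))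
      rw [mfderiv_const] at e5
      exact DFunLike.congr_fun e5 1
    rw [← h2]
    exact h1.hasDerivAt
  have hconst := constant_of_has_deriv_right_zero (f := fun r => c (α (t ^ 2) (γ r))) (a := 0)
    (b := 1) (fun r hr =>
      (hder r ⟨by linarith [hr.1], by linarith [hr.2]⟩).continuousAt.continuousWithinAt)
    (fun r hr => (hder r ⟨by linarith [hr.1], by linarith [hr.2]⟩).hasDerivWithinAt) 1 (by norm_num)
  simp only [hγ1, hγ0, R.section_left] at hconst
  exact hconst

end Casimir

/-! ### Global extension of coordinate vector fields -/

section Frame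

variable {E : Type*} [NormedAddCommGroup E] [NormedSpace ℝ E] [FiniteDimensional ℝ E]
  {M : Type*} [TopologicalSpace M] [ChartedSpace E M] [IsManifold 𝓘(ℝ, E) ∞ M] [T2Space M]
  {x₀ : M} {χ : M → E} {κ : E → M}

/-- The coordinate vector fields extend to smooth vector fields. -/
theorem LocalCoord.exists_frame (h : LocalCoord x₀ χ κ) :
    ∃ X : E → ∀ x : M, TangentSpace 𝓘(ℝ, E) x, (∀ w, IsSmoothVF (X w)) ∧
      ∀ᶠ v in 𝓝 (χ x₀), ∀ w : E, X w (κ v) = mfderiv 𝓘(ℝ, E) 𝓘(ℝ, E) κ v w := by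
  obtain ⟨O, hO, hOo, hxO⟩ := eventually_nhds_iff.1 h.smooth_symm
  have hκO : ContMDiffOn 𝓘(ℝ, E) 𝓘(ℝ, E) ∞ κ O := fun v hv => (hO v hv).contMDiffWithinAt
  have hT := hκO.contMDiffOn_tangentMapWithin (m := ∞) (by simp) hOo.uniqueMDiffOn
  have hmem : ∀ᶠ x in 𝓝 x₀, χ x ∈ O ∧ κ (χ x) = x :=
    (h.tendsto.eventually (hOo.mem_nhds hxO)).and h.left_inv
  obtain ⟨f, -, hf⟩ := (SmoothBumpFunction.nhds_basis_tsupport (I := 𝓘(ℝ, E)) x₀).mem_iff.1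
    hmem.eventually_nhds
  -- The vector is naturally based at `κ (χ x)` and is read in the model space as one at `x`. This
  -- is legitimate only where `κ (χ x) = x`, which holds around the support of the cutoff `f`.
  let Y : E → ∀ x : M, TangentSpace 𝓘(ℝ, E) x := fun w x =>
    (mfderiv 𝓘(ℝ, E) 𝓘(ℝ, E) κ (χ x) w : E)
  refine ⟨fun w x => f x • Y w x, fun w x => ?_, ?_⟩
  · by_cases hx : x ∈ tsupport f
    · have hx' : ∀ᶠ x in 𝓝 x, χ x ∈ O ∧ κ (χ x) = x := hf hx
      have h1 : ContMDiffAt 𝓘(ℝ, E) 𝓘(ℝ, E).tangent ∞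
          (fun y => (⟨y, Y w y⟩ : TangentBundle 𝓘(ℝ, E) M)) x := by
        have hc : ContMDiff 𝓘(ℝ, E) 𝓘(ℝ, E).tangent ∞
            (fun v : E => (⟨v, w⟩ : TangentBundle 𝓘(ℝ, E) E)) :=
          contMDiff_vectorSpace_iff_contDiff.2 contDiff_const
        have h2 : ContMDiffAt 𝓘(ℝ, E).tangent 𝓘(ℝ, E).tangent ∞
            (tangentMapWithin 𝓘(ℝ, E) 𝓘(ℝ, E) κ O) (⟨χ x, w⟩ : TangentBundle 𝓘(ℝ, E) E) := by
          refine (hT ⟨χ x, w⟩ hx'.self_of_nhds.1).contMDiffAt ?_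
          exact (hOo.preimage (FiberBundle.continuous_proj E (TangentSpace 𝓘(ℝ, E)))).mem_nhds
            hx'.self_of_nhds.1
        refine (ContMDiffAt.comp x h2 ((hc _).comp x (h.smooth x))).congr_of_eventuallyEq ?_
        filter_upwards [hx'] with y hy
        have h3 : ∀ (z : M) (v : E), z = y → (⟨y, v⟩ : TangentBundle 𝓘(ℝ, E) M) = ⟨z, v⟩ := by
          rintro z v rfl
          rfl
        refine (h3 (κ (χ y)) _ hy.2).trans ?_
        simp only [Function.comp, tangentMapWithin]
        rw [mfderivWithin_of_isOpen hOo hy.1]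
      exact ContMDiffAt.smul_section f.contMDiffAt h1
    · refine ContMDiffAt.congr_of_eventuallyEq (f := Bundle.zeroSection E (TangentSpace 𝓘(ℝ, E)))
        (Bundle.contMDiff_zeroSection ℝ _ _) ?_
      filter_upwards [(isClosed_tsupport f).isOpen_compl.mem_nhds hx] with y hy
      have : f y = 0 := image_eq_zero_of_notMem_tsupport hy
      simp [this, Bundle.zeroSection]
  · filter_upwards [h.right_inv, h.tendsto_symm.eventually f.eventuallyEq_one] with v hv hv1 w
    have h2 : f (κ v) = 1 := hv1
    have h3 : Y w (κ v) = mfderiv 𝓘(ℝ, E) 𝓘(ℝ, E) κ v w := by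
      simp only [Y]
      rw [hv]
    rw [h2, one_smul, h3]

end Frame

/-! ### The symplectic form and Hamiltonian vector fields in coordinates -/

section SymplecticCoordinates

variable {F : Type*} [NormedAddCommGroup F] [NormedSpace ℝ F] [FiniteDimensional ℝ F]
  {S : Type*} [TopologicalSpace S] [ChartedSpace F S] [IsManifold 𝓘(ℝ, F) ∞ S] [T2Space S]
  {s₀ : S} {χ : S → F} {κ : F → S}

/-- The expression of a symplectic form in coordinates. -/
def SymplecticForm.coordForm (Ω : SymplecticForm F S) (κ : F → S) (u : F) : F →L[ℝ] F →L[ℝ] ℝ :=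
  LinearMap.toContinuousBilinearMap
    (LinearMap.compl₁₂ (Qₗ := F) (Qₗ' := F) (Ω.form (κ u))
      ((mfderiv 𝓘(ℝ, F) 𝓘(ℝ, F) κ u).toLinearMap : F →ₗ[ℝ] TangentSpace 𝓘(ℝ, F) (κ u))
      ((mfderiv 𝓘(ℝ, F) 𝓘(ℝ, F) κ u).toLinearMap : F →ₗ[ℝ] TangentSpace 𝓘(ℝ, F) (κ u)))

theorem SymplecticForm.coordForm_apply (Ω : SymplecticForm F S) (κ : F → S) (u v w : F) :
    Ω.coordForm κ u v w =
      Ω.form (κ u) (mfderiv 𝓘(ℝ, F) 𝓘(ℝ, F) κ u v) (mfderiv 𝓘(ℝ, F) 𝓘(ℝ, F) κ u w) := rfl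

theorem contDiffAt_clm_of_apply {D V W : Type*} [NormedAddCommGroup D] [NormedSpace ℝ D]
    [NormedAddCommGroup V] [NormedSpace ℝ V] [FiniteDimensional ℝ V]
    [NormedAddCommGroup W] [NormedSpace ℝ W] {f : D → V →L[ℝ] W} {x : D} {n : WithTop ℕ∞}
    (h : ∀ v, ContDiffAt ℝ n (fun y => f y v) x) : ContDiffAt ℝ n f x := by
  let d := Module.finrank ℝ V
  have hd : d = Module.finrank ℝ (Fin d → ℝ) := (Module.finrank_fin_fun ℝ).symm
  let e₁ := ContinuousLinearEquiv.ofFinrankEq hd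
  let e₂ := (e₁.arrowCongr (1 : W ≃L[ℝ] W)).trans (ContinuousLinearEquiv.piRing (Fin d))
  rw [← Function.id_comp f, ← e₂.symm_comp_self]
  exact e₂.symm.contDiff.contDiffAt.comp x (contDiffAt_pi.2 fun i => h _)

/-- Smoothness of `Ω` is known only on global smooth vector fields, so the matrix entries are
evaluated on the extended coordinate fields. -/
theorem SymplecticForm.contDiffAt_coordForm (Ω : SymplecticForm F S) (h : LocalCoord s₀ χ κ) :
    ContDiffAt ℝ ∞ (Ω.coordForm κ) (χ s₀) := by
  obtain ⟨X, hX, hXκ⟩ := h.exists_frame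
  refine contDiffAt_clm_of_apply fun v => contDiffAt_clm_of_apply fun w => ?_
  have h1 := (Ω.smooth (X v) (X w) (hX v) (hX w)) (κ (χ s₀))
  have h2 := h1.comp (χ s₀) h.smooth_symm.self_of_nhds
  refine (contMDiffAt_iff_contDiffAt.1 h2).congr_of_eventuallyEq ?_
  filter_upwards [hXκ] with u hu
  simp only [Function.comp, hu]
  rfl

theorem LocalCoord.injective_mfderiv_symm (h : LocalCoord s₀ χ κ) :
    Function.Injective (mfderiv 𝓘(ℝ, F) 𝓘(ℝ, F) κ (χ s₀)) :=
  Function.LeftInverse.injective h.mfderiv_right.self_of_nhds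

theorem LocalCoord.surjective_mfderiv_symm (h : LocalCoord s₀ χ κ)
    (w : TangentSpace 𝓘(ℝ, F) (κ (χ s₀))) :
    ∃ w' : F, mfderiv 𝓘(ℝ, F) 𝓘(ℝ, F) κ (χ s₀) w' = w := by
  let D : F →L[ℝ] F := mfderiv 𝓘(ℝ, F) 𝓘(ℝ, F) κ (χ s₀)
  have hD : Function.Surjective (D : F →ₗ[ℝ] F) :=
    LinearMap.injective_iff_surjective.1 h.injective_mfderiv_symm
  exact hD w

theorem SymplecticForm.isInvertible_coordForm (Ω : SymplecticForm F S) (h : LocalCoord s₀ χ κ) :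
    (Ω.coordForm κ (χ s₀)).IsInvertible := by
  have hinj : Function.Injective (Ω.coordForm κ (χ s₀)) := by
    refine (injective_iff_map_eq_zero _).2 fun v hv => ?_
    have h1 : (mfderiv 𝓘(ℝ, F) 𝓘(ℝ, F) κ (χ s₀) v : TangentSpace 𝓘(ℝ, F) (κ (χ s₀))) = 0 := by
      refine Ω.nondegenerate _ _ fun w => ?_
      obtain ⟨w', rfl⟩ := h.surjective_mfderiv_symm w
      exact DFunLike.congr_fun hv w'
    refine h.injective_mfderiv_symm (h1.trans ?_)
    exact (map_zero (mfderiv 𝓘(ℝ, F) 𝓘(ℝ, F) κ (χ s₀))).symm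
  have hd : Module.finrank ℝ F = Module.finrank ℝ (F →L[ℝ] ℝ) := by
    rw [← (LinearMap.toContinuousLinearMap (𝕜 := ℝ) (E := F) (F' := ℝ)).finrank_eq]
    exact (Subspace.dual_finrank_eq (K := ℝ) (V := F)).symm
  let e := LinearEquiv.ofInjectiveOfFinrankEq (Ω.coordForm κ (χ s₀) : F →ₗ[ℝ] F →L[ℝ] ℝ) hinj hd
  exact ⟨e.toContinuousLinearEquiv, by ext; rfl⟩

/-- The expression in coordinates of the Hamiltonian vector fields of a family of functions. -/
def SymplecticForm.coordHamVF (Ω : SymplecticForm F S) (κ : F → S) (G : ℝ → S → ℝ)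
    (q : ℝ × F) : F :=
  (Ω.coordForm κ q.2).inverse
    ((fderiv ℝ (fun q : ℝ × F => G q.1 (κ q.2)) q).comp (ContinuousLinearMap.inr ℝ ℝ F))

/-- In coordinates the field is the inverse of the form applied to `dG`, and inversion of operators
is smooth. Class `C^1` jointly with the parameter is what the Picard–Lindelöf theorem needs. -/
theorem SymplecticForm.contDiffAt_coordHamVF (Ω : SymplecticForm F S) (h : LocalCoord s₀ χ κ)
    {G : ℝ → S → ℝ} {a : ℝ} (hG : ContMDiffAt (𝓘(ℝ, ℝ).prod 𝓘(ℝ, F)) 𝓘(ℝ, ℝ) ∞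
      (fun q : ℝ × S => G q.1 q.2) (a, s₀)) :
    ContDiffAt ℝ 1 (Ω.coordHamVF κ G) (a, χ s₀) := by
  have h1 : ContDiffAt ℝ ∞ (fun q : ℝ × F => G q.1 (κ q.2)) (a, χ s₀) := by
    refine contDiffAt_coord (G := fun q : ℝ × S => G q.1 q.2) (κ := κ) ?_
      h.smooth_symm.self_of_nhds
    rwa [h.left_inv_self]
  have h2 : ContDiffAt ℝ 1 (fderiv ℝ (fun q : ℝ × F => G q.1 (κ q.2))) (a, χ s₀) :=
    h1.fderiv_right (m := 1) (by norm_cast)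
  have h3 : ContDiffAt ℝ 1 (fun q : ℝ × F => (Ω.coordForm κ q.2).inverse) (a, χ s₀) := by
    have e1 : ContDiffAt ℝ 1 (fun q : ℝ × F => Ω.coordForm κ q.2) (a, χ s₀) :=
      ContDiffAt.comp (g := Ω.coordForm κ) (f := fun q : ℝ × F => q.2) (a, χ s₀)
        ((Ω.contDiffAt_coordForm h).of_le (by simp)) contDiffAt_snd
    exact ((Ω.isInvertible_coordForm h).contDiffAt_map_inverse).comp (a, χ s₀) e1
  exact h3.clm_apply (h2.clm_comp contDiffAt_const)

theorem SymplecticForm.mvfderiv_hamVF (Ω : SymplecticForm F S) (h : LocalCoord s₀ χ κ)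
    {G : ℝ → S → ℝ} {a : ℝ} (hG : ContMDiffAt (𝓘(ℝ, ℝ).prod 𝓘(ℝ, F)) 𝓘(ℝ, ℝ) ∞
      (fun q : ℝ × S => G q.1 q.2) (a, s₀)) :
    mfderiv 𝓘(ℝ, F) 𝓘(ℝ, F) κ (χ s₀) (Ω.coordHamVF κ G (a, χ s₀)) = Ω.hamVF (G a) (κ (χ s₀)) := by
  have h1 : ContDiffAt ℝ ∞ (fun q : ℝ × F => G q.1 (κ q.2)) (a, χ s₀) := by
    refine contDiffAt_coord (G := fun q : ℝ × S => G q.1 q.2) (κ := κ) ?_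
      h.smooth_symm.self_of_nhds
    rwa [h.left_inv_self]
  refine Ω.ext_of_form fun w => ?_
  obtain ⟨w, rfl⟩ := h.surjective_mfderiv_symm w
  rw [Ω.form_hamVF, ← Ω.coordForm_apply]
  have h2 : Ω.coordForm κ (χ s₀) (Ω.coordHamVF κ G (a, χ s₀)) =
      (fderiv ℝ (fun q : ℝ × F => G q.1 (κ q.2)) (a, χ s₀)).comp
        (ContinuousLinearMap.inr ℝ ℝ F) := by
    obtain ⟨e, he⟩ := Ω.isInvertible_coordForm h
    simp only [SymplecticForm.coordHamVF]
    rw [← he, ContinuousLinearMap.inverse_equiv]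
    exact e.apply_symm_apply _
  rw [h2]
  have hGa : MDifferentiableAt 𝓘(ℝ, F) 𝓘(ℝ, ℝ) (G a) (κ (χ s₀)) := by
    rw [h.left_inv_self]
    exact (contMDiffAt_slice hG).mdifferentiableAt (by simp)
  refine Eq.trans ?_ (mvfderiv_comp_mfderiv (g := G a) (f := κ) hGa
    h.mdifferentiableAt_symm.self_of_nhds w)
  rw [mvfderiv_eq_fderiv]
  have h3 : HasFDerivAt (fun u : F => ((a, u) : ℝ × F)) (ContinuousLinearMap.inr ℝ ℝ F) (χ s₀) :=
    hasFDerivAt_prodMk_right a (χ s₀)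
  have h4 := (h1.differentiableAt (by simp)).hasFDerivAt.comp (χ s₀) h3
  exact (DFunLike.congr_fun h4.fderiv w).symm

end SymplecticCoordinates

/-! ### Integral curves: conservation, uniqueness, projection -/

section Flow

variable {E : Type*} [NormedAddCommGroup E] [NormedSpace ℝ E]
  {M : Type*} [TopologicalSpace M] [ChartedSpace E M]

theorem hasDerivWithinAt_comp_integralCurve {V : Type*} [NormedAddCommGroup V] [NormedSpace ℝ V]
    {γ : ℝ → M} {X : ∀ x : M, TangentSpace 𝓘(ℝ, E) x} {s : Set ℝ} (hγ : IsMIntegralCurveOn γ X s)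
    {t : ℝ} (ht : t ∈ s) {k : M → V} (hk : MDifferentiableAt 𝓘(ℝ, E) 𝓘(ℝ, V) k (γ t)) :
    HasDerivWithinAt (fun t => k (γ t)) (mvfderiv 𝓘(ℝ, E) k (γ t) (X (γ t))) s t := by
  have h1 := HasMFDerivWithinAt.comp t hk.hasMFDerivAt.hasMFDerivWithinAt (hγ t ht)
    (subset_preimage_image γ s)
  have h2 : HasFDerivWithinAt (fun t => k (γ t))
      (ContinuousLinearMap.comp (M₂ := TangentSpace 𝓘(ℝ, E) (γ t)) (mvfderiv 𝓘(ℝ, E) k (γ t))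
        ((1 : ℝ →L[ℝ] ℝ).smulRight (X (γ t)))) s t :=
    hasMFDerivWithinAt_iff_hasFDerivWithinAt.1 h1
  have h3 := h2.hasDerivWithinAt
  simpa using h3

/-- At time zero the interval is a single point, where the condition on the derivative is void. -/
theorem FlowsTo.refl (X : ∀ x : M, TangentSpace 𝓘(ℝ, E) x) (x : M) : FlowsTo X 0 x x := by
  refine ⟨fun _ => x, fun t ht => ?_, rfl, rfl⟩
  have hs : Icc (0 : ℝ) 0 = {0} := Icc_self 0
  rw [hs] at ht ⊢
  obtain rfl : t = 0 := ht
  refine ⟨continuousWithinAt_const, ?_⟩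
  simp only [mfld_simps]
  change HasFDerivWithinAt (𝕜 := ℝ) (E := ℝ) (F := E) _ _ ({0} : Set ℝ) 0
  exact HasFDerivWithinAt.of_subsingleton (E := ℝ) subsingleton_singleton

theorem apply_eq_of_integralCurve {γ : ℝ → M} {X : ∀ x : M, TangentSpace 𝓘(ℝ, E) x} {T : ℝ}
    (hT : 0 ≤ T) (hγ : IsMIntegralCurveOn γ X (Icc 0 T)) {k : M → ℝ} (hk : IsSmoothFun E k)
    (h0 : ∀ t ∈ Icc 0 T, mvfderiv 𝓘(ℝ, E) k (γ t) (X (γ t)) = 0) : k (γ T) = k (γ 0) := by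
  have h1 : ∀ t ∈ Icc 0 T, HasDerivWithinAt (fun t => k (γ t)) 0 (Icc 0 T) t := fun t ht => by
    have := hasDerivWithinAt_comp_integralCurve hγ ht ((hk _).mdifferentiableAt (by simp))
    rwa [h0 t ht] at this
  refine constant_of_has_deriv_right_zero (f := fun t => k (γ t))
    (fun t ht => (h1 t ht).continuousWithinAt) (fun t ht => ?_) T ⟨hT, le_rfl⟩
  exact (h1 t ⟨ht.1, ht.2.le⟩).mono_of_mem_nhdsWithin (Icc_mem_nhdsGE_of_mem ⟨ht.1, ht.2⟩)

variable [FiniteDimensional ℝ E] [IsManifold 𝓘(ℝ, E) ∞ M] [T2Space M]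

theorem contDiffAt_of_dual {D V : Type*} [NormedAddCommGroup D] [NormedSpace ℝ D]
    [NormedAddCommGroup V] [NormedSpace ℝ V] [FiniteDimensional ℝ V] {f : D → V} {x : D}
    {n : WithTop ℕ∞} (h : ∀ ξ : V →L[ℝ] ℝ, ContDiffAt ℝ n (fun y => ξ (f y)) x) :
    ContDiffAt ℝ n f x := by
  let e : V ≃L[ℝ] (Fin (Module.finrank ℝ V) → ℝ) :=
    ContinuousLinearEquiv.ofFinrankEq (Module.finrank_fin_fun ℝ).symm
  rw [← Function.id_comp f, ← e.symm_comp_self]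
  exact e.symm.contDiff.contDiffAt.comp x (contDiffAt_pi.2 fun i =>
    h ((ContinuousLinearMap.proj (R := ℝ) (φ := fun _ => ℝ) i).comp
      (e : V →L[ℝ] (Fin (Module.finrank ℝ V) → ℝ))))

/-- Continuous induction on `[0, T]`: the set where the two curves agree is closed, and it extends
to the right of each of its points by uniqueness for a Lipschitz equation in coordinates. It
identifies the endpoint of any integral curve with the one obtained from the realization. -/
theorem PoissonTensor.flowsTo_unique (π : PoissonTensor E M) {H : M → ℝ} (hH : IsSmoothFun E H)
    {T : ℝ} (hT : 0 ≤ T) {x y y' : M} (h : FlowsTo (π.hamVF H) T x y)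
    (h' : FlowsTo (π.hamVF H) T x y') : y = y' := by
  obtain ⟨γ, hγ, h0, rfl⟩ := h
  obtain ⟨γ', hγ', h0', rfl⟩ := h'
  have hc := hγ.continuousOn
  have hc' := hγ'.continuousOn
  suffices Icc 0 T ⊆ {t | γ t = γ' t} from this ⟨hT, le_rfl⟩
  refine IsClosed.Icc_subset_of_forall_mem_nhdsWithin ?_ (h0.trans h0'.symm) ?_
  · rw [inter_comm]
    exact (hc.prodMk hc').preimage_isClosed_of_isClosed isClosed_Icc isClosed_diagonal
  rintro t ⟨ht, ht0, htT⟩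
  have ht : γ t = γ' t := ht
  obtain ⟨χ, κ, hχ⟩ := exists_localCoord (E := E) (γ t)
  -- The coordinate expression of `X_H`. Its components are the brackets `{H, ξ ∘ χ}`, hence smooth.
  let Y : E → E := fun u => mvfderiv 𝓘(ℝ, E) χ (κ u) (π.hamVF H (κ u))
  have hY : ContDiffAt ℝ 1 Y (χ (γ t)) := by
    refine contDiffAt_of_dual fun ξ => ?_
    have e1 := π.smooth H (fun x => ξ (χ x)) hH (hχ.smooth.isSmoothFun_clm_comp ξ)
    have e2 := (e1 (κ (χ (γ t)))).comp (χ (γ t)) hχ.smooth_symm.self_of_nhds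
    refine ((contMDiffAt_iff_contDiffAt.1 e2).of_le (by simp)).congr_of_eventuallyEq ?_
    refine Eventually.of_forall fun u => ?_
    exact (mvfderiv_clm_comp ξ (hχ.mdifferentiableAt (κ u)) _).symm
  obtain ⟨K, s, hs, hlip⟩ := hY.exists_lipschitzOnWith
  have hgood : ∀ {δ : ℝ → M}, IsMIntegralCurveOn δ (π.hamVF H) (Icc 0 T) → δ t = γ t →
      ∀ᶠ τ in 𝓝[≥] t, (κ (χ (δ τ)) = δ τ ∧ χ (δ τ) ∈ s) := by
    intro δ hδ hδt
    have e1 : Tendsto δ (𝓝[≥] t) (𝓝 (γ t)) := by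
      rw [← hδt]
      exact (hδ.continuousOn t ⟨ht0, htT.le⟩).mono_of_mem_nhdsWithin
        (Icc_mem_nhdsGE_of_mem ⟨ht0, htT⟩)
    exact e1.eventually (hχ.left_inv.and (hχ.tendsto.eventually hs))
  obtain ⟨b, htb, hb⟩ := (mem_nhdsGE_iff_exists_Icc_subset).1
    (((hgood hγ rfl).and (hgood hγ' ht.symm)).and (Icc_mem_nhdsGE_of_mem ⟨ht0, htT⟩))
  have hder : ∀ {δ : ℝ → M}, IsMIntegralCurveOn δ (π.hamVF H) (Icc 0 T) →
      (∀ τ ∈ Icc t b, κ (χ (δ τ)) = δ τ) → ∀ τ ∈ Ico t b,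
      HasDerivWithinAt (fun τ => χ (δ τ)) (Y (χ (δ τ))) (Ici τ) τ := by
    intro δ hδ hκ τ hτ
    have hτ' : τ ∈ Icc t b := Ico_subset_Icc_self hτ
    have e1 := hasDerivWithinAt_comp_integralCurve hδ (hb hτ').2 (hχ.mdifferentiableAt (δ τ))
    have e2 : Y (χ (δ τ)) = mvfderiv 𝓘(ℝ, E) χ (δ τ) (π.hamVF H (δ τ)) := by
      simp only [Y]
      rw [hκ τ hτ']
    rw [e2]
    refine e1.mono_of_mem_nhdsWithin (Icc_mem_nhdsGE_of_mem ⟨ht0.trans hτ.1, ?_⟩)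
    exact hτ.2.trans_le (hb ⟨htb.le, le_rfl⟩).2.2
  have hcont : ∀ {δ : ℝ → M}, IsMIntegralCurveOn δ (π.hamVF H) (Icc 0 T) →
      ContinuousOn (fun τ => χ (δ τ)) (Icc t b) := fun hδ =>
    hχ.smooth.continuous.comp_continuousOn (hδ.continuousOn.mono fun τ hτ => (hb hτ).2)
  have heq := ODE_solution_unique_of_mem_Icc_right (v := fun _ => Y) (s := fun _ => s) (K := K)
    (fun _ _ => hlip)
    (hcont hγ) (hder hγ fun τ hτ => (hb hτ).1.1.1)
    (fun τ hτ => (hb (Ico_subset_Icc_self hτ)).1.1.2)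
    (hcont hγ') (hder hγ' fun τ hτ => (hb hτ).1.2.1)
    (fun τ hτ => (hb (Ico_subset_Icc_self hτ)).1.2.2) (by simp only [ht])
  filter_upwards [Ioc_mem_nhdsGT htb] with τ hτ
  have hτ' : τ ∈ Icc t b := Ioc_subset_Icc_self hτ
  have e1 : χ (γ τ) = χ (γ' τ) := heq hτ'
  change γ τ = γ' τ
  rw [← (hb hτ').1.1.1, ← (hb hτ').1.2.1, e1]

/-- Reparametrize time by `ε⁻¹`. For `ε = 0` this is impossible, but then the field vanishes and
every integral curve is constant. -/
theorem PoissonTensor.flowsTo_of_scale (π : PoissonTensor E M) {H : M → ℝ} {ε h : ℝ} (hε : 0 ≤ ε)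
    (hh : 0 ≤ h) {x y : M} (hxy : FlowsTo ((π.scale ε).hamVF H) h x y) :
    FlowsTo (π.hamVF H) (ε * h) x y := by
  obtain ⟨γ, hγ, rfl, rfl⟩ := hxy
  rcases hε.eq_or_lt with rfl | hε
  · have h1 : γ h = γ 0 := by
      refine eq_of_forall_smoothFun_eq (E := E) fun k hk => ?_
      refine apply_eq_of_integralCurve hh hγ hk fun t _ => ?_
      rw [PoissonTensor.hamVF, PoissonTensor.scale_sharp, zero_smul, map_zero]
    rw [h1, zero_mul]
    exact FlowsTo.refl _ _
  · refine ⟨fun t => γ (t * ε⁻¹), ?_, by simp, congrArg γ (by field_simp)⟩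
    have h1 := hγ.comp_mul ε⁻¹
    have h2 : (ε⁻¹ • (π.scale ε).hamVF H : ∀ x : M, TangentSpace 𝓘(ℝ, E) x) = π.hamVF H := by
      funext x
      rw [Pi.smul_apply, PoissonTensor.hamVF, PoissonTensor.scale_sharp, smul_smul,
        inv_mul_cancel₀ hε.ne', one_smul]
      rfl
    rw [h2] at h1
    refine h1.mono fun t ht => ?_
    refine ⟨mul_nonneg ht.1 (inv_nonneg.2 hε.le), ?_⟩
    rw [mul_inv_le_iff₀ hε, mul_comm]
    exact ht.2

variable {F : Type*} [NormedAddCommGroup F] [NormedSpace ℝ F] [FiniteDimensional ℝ F]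
  {S : Type*} [TopologicalSpace S] [ChartedSpace F S] [IsManifold 𝓘(ℝ, F) ∞ S]

/-- The field `X_{H ∘ α}` is tangent to the fibers of `β`, so every function of `β` is conserved. -/
theorem IsRealizationData.right_eq_of_flowsTo {Ω : SymplecticForm F S} {π : PoissonTensor E M}
    {α β : S → M} {σ : M → S} (R : IsRealizationData Ω π α β σ) {H : M → ℝ}
    (hH : IsSmoothFun E H) {h : ℝ} (hh : 0 ≤ h) {s z : S}
    (hz : FlowsTo (Ω.hamVF (H ∘ α)) h s z) : β z = β s := by
  obtain ⟨γ, hγ, rfl, rfl⟩ := hz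
  refine eq_of_forall_smoothFun_eq (E := E) fun k hk => ?_
  refine apply_eq_of_integralCurve (k := fun s => k (β s)) hh hγ
    (ContMDiff.comp hk R.antiPoisson.1) fun t _ => ?_
  rw [mvfderiv_comp_mfderiv (g := k) (f := β) ((hk _).mdifferentiableAt (by simp))
    (R.antiPoisson.mdifferentiableAt _), R.mfderiv_right_hamVF hH, map_zero]

theorem IsRealizationData.flowsTo_left {Ω : SymplecticForm F S} {π : PoissonTensor E M}
    {α β : S → M} {σ : M → S} (R : IsRealizationData Ω π α β σ) {H : M → ℝ}
    (hH : IsSmoothFun E H) {h : ℝ} {s z : S}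
    (hz : FlowsTo (Ω.hamVF (H ∘ α)) h s z) : FlowsTo (π.hamVF H) h (α s) (α z) := by
  obtain ⟨γ, hγ, rfl, rfl⟩ := hz
  refine ⟨fun t => α (γ t), fun t ht => ?_, rfl, rfl⟩
  have h1 := HasMFDerivWithinAt.comp t
    (R.poisson.mdifferentiableAt (γ t)).hasMFDerivAt.hasMFDerivWithinAt (hγ t ht)
    (subset_preimage_image γ _)
  refine h1.congr_mfderiv ?_
  ext
  change mfderiv 𝓘(ℝ, F) 𝓘(ℝ, E) α (γ t)
    ((1 : ℝ →L[ℝ] ℝ).smulRight (Ω.hamVF (H ∘ α) (γ t)) (1 : ℝ)) =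
    (1 : ℝ →L[ℝ] ℝ).smulRight (π.hamVF H (α (γ t))) (1 : ℝ)
  simp [R.mfderiv_left_hamVF hH]

end Flow

/-! ### Local existence of Hamiltonian flows with parameters -/

section LocalFlow

variable {F : Type*} [NormedAddCommGroup F] [NormedSpace ℝ F] [FiniteDimensional ℝ F]
  {S : Type*} [TopologicalSpace S] [ChartedSpace F S] [IsManifold 𝓘(ℝ, F) ∞ S] [T2Space S]

/-- Existence, for small times, of the Hamiltonian flows of a smooth family of functions, uniformly
in the parameter and the initial point. -/
theorem SymplecticForm.exists_local_flow (Ω : SymplecticForm F S) {G : ℝ → S → ℝ} {s₀ : S}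
    (hG : ∀ᶠ q in 𝓝 ((0 : ℝ), s₀), ContMDiffAt (𝓘(ℝ, ℝ).prod 𝓘(ℝ, F)) 𝓘(ℝ, ℝ) ∞
      (fun q : ℝ × S => G q.1 q.2) q) :
    ∃ Z : (ℝ × ℝ) × S → S, Tendsto Z (𝓝 ((0 : ℝ × ℝ), s₀)) (𝓝 s₀) ∧
      ∀ᶠ q in 𝓝 ((0 : ℝ × ℝ), s₀), 0 ≤ q.1.2 →
        FlowsTo (Ω.hamVF (G q.1.1)) q.1.2 q.2 (Z q) := by
  obtain ⟨χ, κ, h⟩ := exists_localCoord (E := F) s₀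
  -- The parameter becomes a coordinate of zero velocity, so that one autonomous equation provides
  -- the flows for all nearby parameters and initial points, continuously.
  let f : ℝ × F → ℝ × F := fun q => (0, Ω.coordHamVF κ G q)
  have hf : ContDiffAt ℝ 1 f (0, χ s₀) :=
    contDiffAt_const.prodMk (Ω.contDiffAt_coordHamVF h hG.self_of_nhds)
  have hκ : Tendsto (fun q : ℝ × F => (q.1, κ q.2)) (𝓝 (0, χ s₀)) (𝓝 (0, s₀)) :=
    (continuous_fst.tendsto ((0 : ℝ), χ s₀)).prodMk_nhds
      (h.tendsto_symm.comp (continuous_snd.tendsto ((0 : ℝ), χ s₀)))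
  have hsnd := continuous_snd.tendsto ((0 : ℝ), χ s₀)
  have hgood : ∀ᶠ q in 𝓝 ((0 : ℝ), χ s₀), MDifferentiableAt 𝓘(ℝ, F) 𝓘(ℝ, F) κ q.2 ∧
      mfderiv 𝓘(ℝ, F) 𝓘(ℝ, F) κ q.2 (Ω.coordHamVF κ G q) = Ω.hamVF (G q.1) (κ q.2) := by
    filter_upwards [hκ.eventually hG, hsnd.eventually h.mdifferentiableAt_symm,
      hsnd.eventually h.right_inv,
      hsnd.eventually (h.tendsto_symm.eventually h.eventually)] with q h1 h3 h4 h5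
    refine ⟨h3, ?_⟩
    have := Ω.mvfderiv_hamVF h5 h1
    rwa [h4] at this
  obtain ⟨τ, hτ, a, r, L, K, hr, hpl⟩ := IsPicardLindelof.of_contDiffAt_one hf
  obtain ⟨A, hA, hAc⟩ :=
    (hpl 0).exists_forall_mem_closedBall_eq_hasDerivWithinAt_continuousOn
  have hr' : (0 : ℝ) < r := hr
  have hAc0 : ContinuousAt A (((0 : ℝ), χ s₀), 0) := by
    refine hAc.continuousAt (prod_mem_nhds (Metric.closedBall_mem_nhds _ hr') ?_)
    exact Icc_mem_nhds (by linarith) (by linarith)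
  have hA0 : A (((0 : ℝ), χ s₀), 0) = (0, χ s₀) := (hA _ (Metric.mem_closedBall_self hr'.le)).1
  -- Continuity of the local flow keeps short trajectories in the region where `κ` carries the
  -- coordinate field to the Hamiltonian field.
  have hev : ∀ᶠ w in 𝓝 (((0 : ℝ), χ s₀), (0 : ℝ)),
      MDifferentiableAt 𝓘(ℝ, F) 𝓘(ℝ, F) κ (A w).2 ∧
      mfderiv 𝓘(ℝ, F) 𝓘(ℝ, F) κ (A w).2 (Ω.coordHamVF κ G (A w)) =
        Ω.hamVF (G (A w).1) (κ (A w).2) := by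
    have := hAc0.tendsto
    rw [hA0] at this
    exact this.eventually hgood
  obtain ⟨δ, hδ, hball⟩ := Metric.eventually_nhds_iff.1 hev
  have hq : Tendsto (fun q : (ℝ × ℝ) × S => ((q.1.1, χ q.2), q.1.2)) (𝓝 ((0 : ℝ × ℝ), s₀))
      (𝓝 (((0 : ℝ), χ s₀), (0 : ℝ))) := by
    have hχ := h.smooth.continuous
    have : Continuous fun q : (ℝ × ℝ) × S => ((q.1.1, χ q.2), q.1.2) := by fun_prop
    exact this.tendsto ((0 : ℝ × ℝ), s₀)
  have hZ : Tendsto (fun q : (ℝ × ℝ) × S => κ (A ((q.1.1, χ q.2), q.1.2)).2)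
      (𝓝 ((0 : ℝ × ℝ), s₀)) (𝓝 s₀) := by
    have e1 := hAc0.tendsto
    rw [hA0] at e1
    exact h.tendsto_symm.comp (hsnd.comp (e1.comp hq))
  refine ⟨_, hZ, ?_⟩
  filter_upwards [hq.eventually (Metric.ball_mem_nhds _ hδ),
    hq.eventually (Metric.ball_mem_nhds _ hτ), hq.eventually (Metric.ball_mem_nhds _ hr'),
    (continuous_snd.tendsto ((0 : ℝ × ℝ), s₀)).eventually h.left_inv] with q h1 h2 h3 h4 hq0
  obtain ⟨⟨c, T⟩, s⟩ := q
  simp only [Prod.dist_eq, max_lt_iff] at h1 h2 h3 h4 hq0 ⊢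
  obtain ⟨hAs, hAd⟩ := hA (c, χ s) (by
    rw [Metric.mem_closedBall, Prod.dist_eq]
    exact max_le h3.1.1.le h3.1.2.le)
  have hTτ : T < τ := by
    have := h2.2
    rw [Real.dist_eq, sub_zero, abs_of_nonneg hq0] at this
    exact this
  have hTδ : T < δ := by
    have := h1.2
    rw [Real.dist_eq, sub_zero, abs_of_nonneg hq0] at this
    exact this
  have hder : ∀ t ∈ Icc 0 T, HasDerivAt (fun t => A ((c, χ s), t)) (f (A ((c, χ s), t))) t := by
    intro t ht
    refine (hAd t ⟨by linarith [ht.1], by linarith [ht.2]⟩).hasDerivAt (Icc_mem_nhds ?_ ?_)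
    · linarith [ht.1]
    · linarith [ht.2]
  have hfst : ∀ t ∈ Icc 0 T, (A ((c, χ s), t)).1 = c := by
    intro t ht
    have e1 : ∀ t ∈ Icc 0 T, HasDerivAt (fun t => (A ((c, χ s), t)).1) 0 t := fun t ht =>
      (hder t ht).fst
    have e2 := constant_of_has_deriv_right_zero (f := fun t => (A ((c, χ s), t)).1) (a := 0)
      (b := T) (fun t ht => (e1 t ht).continuousAt.continuousWithinAt)
      (fun t ht => (e1 t (Ico_subset_Icc_self ht)).hasDerivWithinAt) t ht
    rw [e2, hAs]
  have hg : ∀ t ∈ Icc 0 T,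
      MDifferentiableAt 𝓘(ℝ, F) 𝓘(ℝ, F) κ (A ((c, χ s), t)).2 ∧
      mfderiv 𝓘(ℝ, F) 𝓘(ℝ, F) κ (A ((c, χ s), t)).2 (Ω.coordHamVF κ G (A ((c, χ s), t))) =
        Ω.hamVF (G c) (κ (A ((c, χ s), t)).2) := by
    intro t ht
    have e1 := hball (y := ((c, χ s), t)) (by
      rw [Prod.dist_eq, Prod.dist_eq, Real.dist_eq t, sub_zero, abs_of_nonneg ht.1]
      exact max_lt (max_lt h1.1.1 h1.1.2) (ht.2.trans_lt hTδ))
    rw [hfst t ht] at e1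
    exact e1
  refine ⟨fun t => κ (A ((c, χ s), t)).2, fun t ht => ?_, ?_, rfl⟩
  · have e1 : HasDerivAt (fun t => (A ((c, χ s), t)).2) (Ω.coordHamVF κ G (A ((c, χ s), t))) t :=
      (hder t ht).snd
    have e2 := HasMFDerivAt.comp t (hg t ht).1.hasMFDerivAt e1.hasFDerivAt.hasMFDerivAt
    refine (e2.hasMFDerivWithinAt).congr_mfderiv ?_
    ext
    change mfderiv 𝓘(ℝ, F) 𝓘(ℝ, F) κ (A ((c, χ s), t)).2 (ContinuousLinearMap.toSpanSingleton ℝ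
      (Ω.coordHamVF κ G (A ((c, χ s), t))) (1 : ℝ)) =
      (1 : ℝ →L[ℝ] ℝ).smulRight (Ω.hamVF (G c) (κ (A ((c, χ s), t)).2)) (1 : ℝ)
    rw [← (hg t ht).2]
    simp
  · change κ (A ((c, χ s), 0)).2 = s
    rw [hAs]
    exact h4

end LocalFlow

/-! ### The transported Poisson tensor as a function of first jets -/

section Transport

variable {E : Type*} [NormedAddCommGroup E] [NormedSpace ℝ E]
  {M : Type*} [TopologicalSpace M] [ChartedSpace E M]

/-- The value of the Poisson tensor at `A y` on the covectors that correspond, by `D_y A`, to the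
differentials of `f ∘ B` and `g ∘ B` at `y`. -/
def PoissonTensor.transportEval (π : PoissonTensor E M) (A B : M → M) (f g : M → ℝ) (y : M) : ℝ :=
  π.eval (A y)
    (mvfderiv 𝓘(ℝ, E) (fun y => f (B y)) y ∘L (mfderiv 𝓘(ℝ, E) 𝓘(ℝ, E) A y).inverse)
    (mvfderiv 𝓘(ℝ, E) (fun y => g (B y)) y ∘L (mfderiv 𝓘(ℝ, E) 𝓘(ℝ, E) A y).inverse)

/-- The contraction of a Poisson tensor in coordinates. -/
def PoissonTensor.coordSharp [FiniteDimensional ℝ E] (π : PoissonTensor E M) (χ : M → E)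
    (κ : E → M) (u : E) : (E →L[ℝ] ℝ) →L[ℝ] E :=
  LinearMap.toContinuousLinearMap
    { toFun := fun ξ => mvfderiv 𝓘(ℝ, E) χ (κ u) (π.sharp (κ u) (ξ ∘L mvfderiv 𝓘(ℝ, E) χ (κ u)))
      map_add' := fun ξ η => by rw [ContinuousLinearMap.add_comp, map_add, map_add]
      map_smul' := fun c ξ => by
        rw [ContinuousLinearMap.smul_comp, map_smul, map_smul, RingHom.id_apply] }

theorem PoissonTensor.coordSharp_apply [FiniteDimensional ℝ E] (π : PoissonTensor E M) (χ : M → E)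
    (κ : E → M) (u : E) (ξ : E →L[ℝ] ℝ) : π.coordSharp χ κ u ξ =
      mvfderiv 𝓘(ℝ, E) χ (κ u) (π.sharp (κ u) (ξ ∘L mvfderiv 𝓘(ℝ, E) χ (κ u))) := rfl

/-- The expression of `PoissonTensor.transportEval` in terms of first jets. -/
def PoissonTensor.jetEval [FiniteDimensional ℝ E] (π : PoissonTensor E M) (χ : M → E)
    (κ : E → M) (z : (E →L[ℝ] E) × (E →L[ℝ] ℝ) × (E →L[ℝ] ℝ) × E) : ℝ :=
  (z.2.2.1 ∘L z.1.inverse) (π.coordSharp χ κ z.2.2.2 (z.2.1 ∘L z.1.inverse))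

/-- The first jets of `A` and of `f ∘ B`, `g ∘ B` in coordinates. -/
def jetOf {P : Type*} [NormedAddCommGroup P] [NormedSpace ℝ P] (χ : M → E) (κ₁ : E → M)
    (A B : P → M → M) (f g : M → ℝ) (q : P × E) :
    (E →L[ℝ] E) × (E →L[ℝ] ℝ) × (E →L[ℝ] ℝ) × E :=
  (fderiv ℝ (fun q : P × E => χ (A q.1 (κ₁ q.2))) q ∘L ContinuousLinearMap.inr ℝ P E,
    fderiv ℝ (fun q : P × E => f (B q.1 (κ₁ q.2))) q ∘L ContinuousLinearMap.inr ℝ P E,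
    fderiv ℝ (fun q : P × E => g (B q.1 (κ₁ q.2))) q ∘L ContinuousLinearMap.inr ℝ P E,
    χ (A q.1 (κ₁ q.2)))

theorem mvfderiv_congr_point {V : Type*} [NormedAddCommGroup V] [NormedSpace ℝ V] {y y' : M}
    (h : y = y') (k : M → V) (v : E) :
    mvfderiv 𝓘(ℝ, E) k y v = mvfderiv 𝓘(ℝ, E) k y' v := by
  rw [h]

variable [FiniteDimensional ℝ E] [IsManifold 𝓘(ℝ, E) ∞ M] [T2Space M]

theorem comp_inverse_apply {A : M → M} {y : M}
    (hA : Function.Injective (mfderiv 𝓘(ℝ, E) 𝓘(ℝ, E) A y))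
    (ξ : TangentSpace 𝓘(ℝ, E) y →L[ℝ] ℝ) (w : TangentSpace 𝓘(ℝ, E) y) :
    (ξ ∘L (mfderiv 𝓘(ℝ, E) 𝓘(ℝ, E) A y).inverse) (mfderiv 𝓘(ℝ, E) 𝓘(ℝ, E) A y w) = ξ w := by
  obtain ⟨e, he⟩ := exists_tangentEquiv_of_injective hA
  rw [← he, ContinuousLinearMap.inverse_equiv]
  exact congrArg ξ (e.symm_apply_apply w)

/-- The matrix entries are brackets of coordinate functions, smooth by the definition of a Poisson
tensor. -/
theorem PoissonTensor.contDiffAt_coordSharp (π : PoissonTensor E M) {x₀ : M} {χ : M → E}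
    {κ : E → M} (h : LocalCoord x₀ χ κ) : ContDiffAt ℝ ∞ (π.coordSharp χ κ) (χ x₀) := by
  refine contDiffAt_clm_of_apply fun ξ => contDiffAt_of_dual fun η => ?_
  have e1 := π.smooth _ _ (h.smooth.isSmoothFun_clm_comp ξ) (h.smooth.isSmoothFun_clm_comp η)
  have e2 := (e1 (κ (χ x₀))).comp (χ x₀) h.smooth_symm.self_of_nhds
  refine (contMDiffAt_iff_contDiffAt.1 e2).congr_of_eventuallyEq (Eventually.of_forall fun u => ?_)
  have e3 : mvfderiv 𝓘(ℝ, E) (fun x => ξ (χ x)) (κ u) = ξ ∘L mvfderiv 𝓘(ℝ, E) χ (κ u) := by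
    ext w
    exact mvfderiv_clm_comp ξ (h.mdifferentiableAt (κ u)) w
  simp only [Function.comp, bracketOf, e3]
  exact (mvfderiv_clm_comp η (h.mdifferentiableAt (κ u)) _).symm

/-- Class `C^1` makes this function locally Lipschitz, which turns closeness of jets into closeness
of transported tensors. -/
theorem PoissonTensor.contDiffAt_jetEval (π : PoissonTensor E M) {x₀ : M} {χ : M → E}
    {κ : E → M} (h : LocalCoord x₀ χ κ) {z : (E →L[ℝ] E) × (E →L[ℝ] ℝ) × (E →L[ℝ] ℝ) × E}
    (hz : z.1.IsInvertible) (hz' : z.2.2.2 = χ x₀) : ContDiffAt ℝ 1 (π.jetEval χ κ) z := by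
  have h1 : ContDiffAt ℝ 1
      (fun z : (E →L[ℝ] E) × (E →L[ℝ] ℝ) × (E →L[ℝ] ℝ) × E => z.1.inverse) z :=
    (hz.contDiffAt_map_inverse).comp z contDiffAt_fst
  have h2 : ContDiffAt ℝ 1
      (fun z : (E →L[ℝ] E) × (E →L[ℝ] ℝ) × (E →L[ℝ] ℝ) × E => π.coordSharp χ κ z.2.2.2) z := by
    refine ContDiffAt.comp z (g := π.coordSharp χ κ) (f := fun
      z : (E →L[ℝ] E) × (E →L[ℝ] ℝ) × (E →L[ℝ] ℝ) × E => z.2.2.2) ?_ (by fun_prop)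
    rw [hz']
    exact (π.contDiffAt_coordSharp h).of_le (by simp)
  have h3 : ContDiffAt ℝ 1
      (fun z : (E →L[ℝ] E) × (E →L[ℝ] ℝ) × (E →L[ℝ] ℝ) × E => z.2.1) z := by fun_prop
  have h4 : ContDiffAt ℝ 1
      (fun z : (E →L[ℝ] E) × (E →L[ℝ] ℝ) × (E →L[ℝ] ℝ) × E => z.2.2.1) z := by fun_prop
  exact (h4.clm_comp h1).clm_apply (h2.clm_apply (h3.clm_comp h1))

section Family

variable {P : Type*} [NormedAddCommGroup P] [NormedSpace ℝ P] [CompleteSpace P]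

theorem fderiv_coord_comp_inr {V : Type*} [NormedAddCommGroup V] [NormedSpace ℝ V] {k : M → V}
    (hk : ContMDiff 𝓘(ℝ, E) 𝓘(ℝ, V) ∞ k) {A : P → M → M} {κ₁ : E → M} {q : P × E}
    (hA : ContMDiffAt (𝓘(ℝ, P).prod 𝓘(ℝ, E)) 𝓘(ℝ, E) ∞ (fun q : P × M => A q.1 q.2) (q.1, κ₁ q.2))
    (hκ₁ : ContMDiffAt 𝓘(ℝ, E) 𝓘(ℝ, E) ∞ κ₁ q.2) (v : E) :
    (fderiv ℝ (fun q : P × E => k (A q.1 (κ₁ q.2))) q ∘L ContinuousLinearMap.inr ℝ P E) v =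
      mvfderiv 𝓘(ℝ, E) (fun y => k (A q.1 y)) (κ₁ q.2) (mfderiv 𝓘(ℝ, E) 𝓘(ℝ, E) κ₁ q.2 v) := by
  have hkA := (hk (A q.1 (κ₁ q.2))).comp (q.1, κ₁ q.2) hA
  have h1 : ContDiffAt ℝ ∞ (fun q : P × E => k (A q.1 (κ₁ q.2))) q :=
    contDiffAt_coord (G := fun q : P × M => k (A q.1 q.2)) hkA hκ₁
  have h2 : HasFDerivAt (fun u : E => ((q.1, u) : P × E)) (ContinuousLinearMap.inr ℝ P E) q.2 :=
    hasFDerivAt_prodMk_right q.1 q.2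
  have h3 := (h1.differentiableAt (by simp)).hasFDerivAt.comp q.2 h2
  have h4 : MDifferentiableAt 𝓘(ℝ, E) 𝓘(ℝ, V) (fun y => k (A q.1 y)) (κ₁ q.2) :=
    (contMDiffAt_slice (G := fun p y => k (A p y)) hkA).mdifferentiableAt (by simp)
  refine Eq.trans ?_ (mvfderiv_comp_mfderiv (g := fun y => k (A q.1 y)) (f := κ₁) h4
    (hκ₁.mdifferentiableAt (by simp)) v)
  rw [mvfderiv_eq_fderiv]
  exact (DFunLike.congr_fun h3.fderiv v).symm

theorem contDiffAt_fderiv_coord {V : Type*} [NormedAddCommGroup V] [NormedSpace ℝ V] {k : M → V}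
    (hk : ContMDiff 𝓘(ℝ, E) 𝓘(ℝ, V) ∞ k) {A : P → M → M} {κ₁ : E → M} {q : P × E}
    (hA : ContMDiffAt (𝓘(ℝ, P).prod 𝓘(ℝ, E)) 𝓘(ℝ, E) ∞ (fun q : P × M => A q.1 q.2) (q.1, κ₁ q.2))
    (hκ₁ : ContMDiffAt 𝓘(ℝ, E) 𝓘(ℝ, E) ∞ κ₁ q.2) :
    ContinuousAt (fun q => fderiv ℝ (fun q : P × E => k (A q.1 (κ₁ q.2))) q ∘L
      ContinuousLinearMap.inr ℝ P E) q := by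
  have h1 : ContDiffAt ℝ ∞ (fun q : P × E => k (A q.1 (κ₁ q.2))) q :=
    contDiffAt_coord (G := fun q : P × M => k (A q.1 q.2))
      ((hk (A q.1 (κ₁ q.2))).comp (q.1, κ₁ q.2) hA) hκ₁
  have h2 : ContDiffAt ℝ 1 (fderiv ℝ (fun q : P × E => k (A q.1 (κ₁ q.2)))) q :=
    h1.fderiv_right (m := 1) (by norm_cast)
  exact (h2.clm_comp contDiffAt_const).continuousAt

variable {A B : P → M → M} {f g : M → ℝ} {χ₁ χ : M → E} {κ₁ κ : E → M} {p₀ : P} {y₀ : M}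

theorem continuousAt_jetOf (h₁ : LocalCoord y₀ χ₁ κ₁)
    (hχ : ContMDiff 𝓘(ℝ, E) 𝓘(ℝ, E) ∞ χ)
    (hA : ContMDiffAt (𝓘(ℝ, P).prod 𝓘(ℝ, E)) 𝓘(ℝ, E) ∞ (fun q : P × M => A q.1 q.2) (p₀, y₀))
    (hB : ContMDiffAt (𝓘(ℝ, P).prod 𝓘(ℝ, E)) 𝓘(ℝ, E) ∞ (fun q : P × M => B q.1 q.2) (p₀, y₀))
    (hf : IsSmoothFun E f) (hg : IsSmoothFun E g) :
    ContinuousAt (jetOf χ κ₁ A B f g) (p₀, χ₁ y₀) := by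
  rw [← h₁.left_inv_self] at hA hB
  have hκ₁ := h₁.smooth_symm.self_of_nhds
  have h4 : ContDiffAt ℝ ∞ (fun q : P × E => χ (A q.1 (κ₁ q.2))) (p₀, χ₁ y₀) :=
    contDiffAt_coord (G := fun q : P × M => χ (A q.1 q.2))
      ((hχ (A p₀ (κ₁ (χ₁ y₀)))).comp (p₀, κ₁ (χ₁ y₀)) hA) hκ₁
  exact (contDiffAt_fderiv_coord hχ hA hκ₁).prodMk ((contDiffAt_fderiv_coord hf hB hκ₁).prodMk
    ((contDiffAt_fderiv_coord hg hB hκ₁).prodMk h4.continuousAt))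

theorem isInvertible_jetOf (h₁ : LocalCoord y₀ χ₁ κ₁) (h : LocalCoord (A p₀ y₀) χ κ)
    (hA : ContMDiffAt (𝓘(ℝ, P).prod 𝓘(ℝ, E)) 𝓘(ℝ, E) ∞ (fun q : P × M => A q.1 q.2) (p₀, y₀))
    (hinj : Function.Injective (mfderiv 𝓘(ℝ, E) 𝓘(ℝ, E) (A p₀) y₀)) :
    (jetOf χ κ₁ A B f g (p₀, χ₁ y₀)).1.IsInvertible := by
  have e0 := h₁.left_inv_self
  rw [← e0] at hA hinj h
  have hinj' : Function.Injective (jetOf χ κ₁ A B f g (p₀, χ₁ y₀)).1 := by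
    refine (injective_iff_map_eq_zero _).2 fun v hv => ?_
    have e1 := fderiv_coord_comp_inr (q := (p₀, χ₁ y₀)) h.smooth hA h₁.smooth_symm.self_of_nhds v
    have e2 := mvfderiv_comp_mfderiv (g := χ) (f := A p₀) (s := κ₁ (χ₁ y₀))
      (h.mdifferentiableAt _) ((contMDiffAt_slice hA).mdifferentiableAt (by simp))
      (mfderiv 𝓘(ℝ, E) 𝓘(ℝ, E) κ₁ (χ₁ y₀) v)
    have e3 := (e1.trans e2).symm.trans hv
    have e4 := (injective_iff_map_eq_zero _).1 h.injective_mvfderiv _ e3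
    have e5 := (injective_iff_map_eq_zero _).1 hinj _ e4
    exact (injective_iff_map_eq_zero (mfderiv 𝓘(ℝ, E) 𝓘(ℝ, E) κ₁ (χ₁ y₀))).1
      h₁.injective_mfderiv_symm _ e5
  let L := (jetOf χ κ₁ A B f g (p₀, χ₁ y₀)).1
  exact ⟨(LinearEquiv.ofInjectiveOfFinrankEq L.toLinearMap hinj' rfl).toContinuousLinearEquiv, by
    ext; rfl⟩

/-- The intrinsic value rewritten in two independent charts, one at `y₀` and one at its image; the
identity to check is that of the covectors at the image. -/
theorem PoissonTensor.transportEval_eq_jetEval (π : PoissonTensor E M) (h₁ : LocalCoord y₀ χ₁ κ₁)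
    (h : LocalCoord (A p₀ y₀) χ κ)
    (hA : ContMDiffAt (𝓘(ℝ, P).prod 𝓘(ℝ, E)) 𝓘(ℝ, E) ∞ (fun q : P × M => A q.1 q.2) (p₀, y₀))
    (hB : ContMDiffAt (𝓘(ℝ, P).prod 𝓘(ℝ, E)) 𝓘(ℝ, E) ∞ (fun q : P × M => B q.1 q.2) (p₀, y₀))
    (hinj : Function.Injective (mfderiv 𝓘(ℝ, E) 𝓘(ℝ, E) (A p₀) y₀))
    (hf : IsSmoothFun E f) (hg : IsSmoothFun E g) :
    π.transportEval (A p₀) (B p₀) f g y₀ = π.jetEval χ κ (jetOf χ κ₁ A B f g (p₀, χ₁ y₀)) := by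
  have hJ := isInvertible_jetOf (B := B) (f := f) (g := g) h₁ h hA hinj
  have e0 : κ₁ (χ₁ y₀) = y₀ := h₁.left_inv_self
  have hcov : ∀ (k : M → ℝ) (d : E →L[ℝ] ℝ), IsSmoothFun E k →
      d = fderiv ℝ (fun q : P × E => k (B q.1 (κ₁ q.2))) (p₀, χ₁ y₀) ∘L
        ContinuousLinearMap.inr ℝ P E →
      mvfderiv 𝓘(ℝ, E) (fun y => k (B p₀ y)) y₀ ∘L (mfderiv 𝓘(ℝ, E) 𝓘(ℝ, E) (A p₀) y₀).inverse =
        (d ∘L (jetOf χ κ₁ A B f g (p₀, χ₁ y₀)).1.inverse) ∘L mvfderiv 𝓘(ℝ, E) χ (A p₀ y₀) := by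
    intro k d hk hd
    obtain ⟨e, he⟩ := exists_tangentEquiv_of_injective hinj
    obtain ⟨j, hj⟩ := hJ
    ext w
    -- The vectors `DA (Dκ₁ v)` exhaust the tangent space at the image, and on them both inverses
    -- cancel.
    obtain ⟨w, rfl⟩ : ∃ w', mfderiv 𝓘(ℝ, E) 𝓘(ℝ, E) (A p₀) y₀ w' = w :=
      ⟨e.symm w, by rw [← he]; exact e.apply_symm_apply w⟩
    refine (comp_inverse_apply hinj _ w).trans ?_
    obtain ⟨v, rfl⟩ : ∃ v : E, (mfderiv 𝓘(ℝ, E) 𝓘(ℝ, E) κ₁ (χ₁ y₀) v : E) = w :=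
      h₁.surjective_mfderiv_symm w
    have e1 : mvfderiv 𝓘(ℝ, E) χ (A p₀ y₀) (mfderiv 𝓘(ℝ, E) 𝓘(ℝ, E) (A p₀) y₀
        (mfderiv 𝓘(ℝ, E) 𝓘(ℝ, E) κ₁ (χ₁ y₀) v : E)) = (jetOf χ κ₁ A B f g (p₀, χ₁ y₀)).1 v := by
      have a1 := fderiv_coord_comp_inr (A := A) (q := (p₀, χ₁ y₀)) (κ₁ := κ₁) h.smooth
        (by rwa [e0]) h₁.smooth_symm.self_of_nhds v
      refine Eq.trans ?_ (a1.trans (mvfderiv_congr_point e0 (fun y => χ (A p₀ y)) _)).symm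
      exact (mvfderiv_comp_mfderiv (g := χ) (f := A p₀) (h.mdifferentiableAt _)
        ((contMDiffAt_slice hA).mdifferentiableAt (by simp)) _).symm
    have e2 : d v = mvfderiv 𝓘(ℝ, E) (fun y => k (B p₀ y)) y₀
        (mfderiv 𝓘(ℝ, E) 𝓘(ℝ, E) κ₁ (χ₁ y₀) v : E) := by
      have a1 := fderiv_coord_comp_inr (A := B) (q := (p₀, χ₁ y₀)) (κ₁ := κ₁) hk (by rwa [e0])
        h₁.smooth_symm.self_of_nhds v
      rw [hd]
      exact a1.trans (mvfderiv_congr_point e0 (fun y => k (B p₀ y)) _)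
    refine Eq.trans e2.symm ?_
    change _ = d ((jetOf χ κ₁ A B f g (p₀, χ₁ y₀)).1.inverse (mvfderiv 𝓘(ℝ, E) χ (A p₀ y₀) _))
    rw [e1, ← hj, ContinuousLinearMap.inverse_equiv]
    exact (congrArg d (j.symm_apply_apply v)).symm
  have h3 : (jetOf χ κ₁ A B f g (p₀, χ₁ y₀)).2.2.2 = χ (A p₀ y₀) := by
    simp only [jetOf, e0]
  rw [PoissonTensor.transportEval, hcov f _ hf rfl, hcov g _ hg rfl, PoissonTensor.jetEval, h3,
    PoissonTensor.coordSharp_apply, h.left_inv_self]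
  rfl

theorem PoissonTensor.eventually_transportEval_eq (π : PoissonTensor E M)
    (h₁ : LocalCoord y₀ χ₁ κ₁) (h : LocalCoord (A p₀ y₀) χ κ)
    (hA : ∀ᶠ q in 𝓝 (p₀, y₀),
      ContMDiffAt (𝓘(ℝ, P).prod 𝓘(ℝ, E)) 𝓘(ℝ, E) ∞ (fun q : P × M => A q.1 q.2) q)
    (hB : ∀ᶠ q in 𝓝 (p₀, y₀),
      ContMDiffAt (𝓘(ℝ, P).prod 𝓘(ℝ, E)) 𝓘(ℝ, E) ∞ (fun q : P × M => B q.1 q.2) q)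
    (hinj : Function.Injective (mfderiv 𝓘(ℝ, E) 𝓘(ℝ, E) (A p₀) y₀))
    (hf : IsSmoothFun E f) (hg : IsSmoothFun E g) :
    ∀ᶠ q in 𝓝 (p₀, y₀), π.transportEval (A q.1) (B q.1) f g q.2 =
      π.jetEval χ κ (jetOf χ κ₁ A B f g (q.1, χ₁ q.2)) := by
  filter_upwards [hA, hB, eventually_injective_mfderiv hA.self_of_nhds hinj,
    (continuous_snd.tendsto (p₀, y₀)).eventually h₁.eventually,
    hA.self_of_nhds.continuousAt.tendsto.eventually h.eventually] with q q1 q2 q3 q4 q5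
  exact π.transportEval_eq_jetEval q4 q5 q1 q2 q3 hf hg

/-- Needed away from `ε = 0`, where the estimates only ask for local boundedness. -/
theorem PoissonTensor.continuousAt_transportEval (π : PoissonTensor E M)
    (hA : ∀ᶠ q in 𝓝 (p₀, y₀),
      ContMDiffAt (𝓘(ℝ, P).prod 𝓘(ℝ, E)) 𝓘(ℝ, E) ∞ (fun q : P × M => A q.1 q.2) q)
    (hB : ∀ᶠ q in 𝓝 (p₀, y₀),
      ContMDiffAt (𝓘(ℝ, P).prod 𝓘(ℝ, E)) 𝓘(ℝ, E) ∞ (fun q : P × M => B q.1 q.2) q)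
    (hinj : Function.Injective (mfderiv 𝓘(ℝ, E) 𝓘(ℝ, E) (A p₀) y₀))
    (hf : IsSmoothFun E f) (hg : IsSmoothFun E g) :
    ContinuousAt (fun q : P × M => π.transportEval (A q.1) (B q.1) f g q.2) (p₀, y₀) := by
  obtain ⟨χ₁, κ₁, h₁⟩ := exists_localCoord (E := E) y₀
  obtain ⟨χ, κ, h⟩ := exists_localCoord (E := E) (A p₀ y₀)
  have e1 := π.contDiffAt_jetEval h (isInvertible_jetOf (B := B) (f := f) (g := g) h₁ h
    hA.self_of_nhds hinj) (by simp only [jetOf, h₁.left_inv_self])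
  have e2 := continuousAt_jetOf h₁ h.smooth hA.self_of_nhds hB.self_of_nhds hf hg
  have e3 : ContinuousAt (fun q : P × M => (q.1, χ₁ q.2)) (p₀, y₀) :=
    (continuous_fst.prodMk (h₁.smooth.continuous.comp continuous_snd)).continuousAt
  have e4 := ContinuousAt.comp (f := fun q : P × M => (q.1, χ₁ q.2)) (x := (p₀, y₀))
    (ContinuousAt.comp (f := jetOf χ κ₁ A B f g) (x := (p₀, χ₁ y₀)) e1.continuousAt e2) e3
  exact e4.congr (EventuallyEq.symm
    (π.eventually_transportEval_eq h₁ h hA hB hinj hf hg))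

end Family

end Transport

/-! ### Families agreeing to some order in the parameter -/

section Agreement

variable {E : Type*} [NormedAddCommGroup E] [NormedSpace ℝ E]
  {M : Type*} [TopologicalSpace M] [ChartedSpace E M]

/-- The families `A` and `A'`, parametrized by `(a, b)`, agree to order `k` in `a` near the point
`q₀`. -/
def AgreeToOrder (E : Type*) [NormedAddCommGroup E] [NormedSpace ℝ E]
    {M : Type*} [TopologicalSpace M] [ChartedSpace E M] (k : ℕ) (A A' : ℝ × ℝ → M → M)
    (q₀ : (ℝ × ℝ) × M) : Prop :=
  ∀ g : M → ℝ, IsSmoothFun E g →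
    (fun q : (ℝ × ℝ) × M => g (A q.1 q.2) - g (A' q.1 q.2)) =O[𝓝 q₀] fun q => q.1.1 ^ k

theorem AgreeToOrder.isBigO {k : ℕ} {A A' : ℝ × ℝ → M → M} {q₀ : (ℝ × ℝ) × M}
    (h : AgreeToOrder E k A A' q₀) {V : Type*} [NormedAddCommGroup V] [NormedSpace ℝ V]
    [FiniteDimensional ℝ V] {g : M → V} (hg : ContMDiff 𝓘(ℝ, E) 𝓘(ℝ, V) ∞ g) :
    (fun q : (ℝ × ℝ) × M => g (A q.1 q.2) - g (A' q.1 q.2)) =O[𝓝 q₀] fun q => q.1.1 ^ k :=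
  isBigO_of_dual fun ξ => by
    simpa only [map_sub] using h _ (hg.isSmoothFun_clm_comp ξ)

variable [FiniteDimensional ℝ E] [IsManifold 𝓘(ℝ, E) ∞ M] [T2Space M]

theorem AgreeToOrder.eq {k : ℕ} (hk : k ≠ 0) {A A' : ℝ × ℝ → M → M} {q₀ : (ℝ × ℝ) × M}
    (h : AgreeToOrder E k A A' q₀) (hq₀ : q₀.1.1 = 0) : A q₀.1 q₀.2 = A' q₀.1 q₀.2 := by
  refine eq_of_forall_smoothFun_eq (E := E) fun g hg => ?_
  exact sub_eq_zero.1 ((h g hg).eq_zero_imp.self_of_nhds (by rw [hq₀, zero_pow hk]))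

variable {A A' B B' : ℝ × ℝ → M → M} {f g : M → ℝ} {χ₁ χ : M → E} {κ₁ κ : E → M}
  {p₀ : ℝ × ℝ} {y₀ : M} {k : ℕ}

/-- Families that agree to order `k` have derivatives that agree to order `k`. -/
theorem isBigO_fderiv_coord_sub (h₁ : LocalCoord y₀ χ₁ κ₁) (hp₀ : p₀.1 = 0)
    (hA : ∀ᶠ q in 𝓝 (p₀, y₀),
      ContMDiffAt (𝓘(ℝ, ℝ × ℝ).prod 𝓘(ℝ, E)) 𝓘(ℝ, E) ∞ (fun q : (ℝ × ℝ) × M => A q.1 q.2) q)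
    (hA' : ∀ᶠ q in 𝓝 (p₀, y₀),
      ContMDiffAt (𝓘(ℝ, ℝ × ℝ).prod 𝓘(ℝ, E)) 𝓘(ℝ, E) ∞ (fun q : (ℝ × ℝ) × M => A' q.1 q.2) q)
    (hAA' : ∀ᶠ q in 𝓝 (p₀, y₀), q.1.1 = 0 → AgreeToOrder E k A A' q)
    {V : Type*} [NormedAddCommGroup V] [NormedSpace ℝ V] [FiniteDimensional ℝ V] {g : M → V}
    (hg : ContMDiff 𝓘(ℝ, E) 𝓘(ℝ, V) ∞ g) :
    (fun q : (ℝ × ℝ) × E =>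
      fderiv ℝ (fun q : (ℝ × ℝ) × E => g (A q.1 (κ₁ q.2))) q ∘L
        ContinuousLinearMap.inr ℝ (ℝ × ℝ) E -
      fderiv ℝ (fun q : (ℝ × ℝ) × E => g (A' q.1 (κ₁ q.2))) q ∘L
        ContinuousLinearMap.inr ℝ (ℝ × ℝ) E) =O[𝓝 (p₀, χ₁ y₀)] fun q => q.1.1 ^ k := by
  have hκ : Tendsto (fun q : (ℝ × ℝ) × E => (q.1, κ₁ q.2)) (𝓝 (p₀, χ₁ y₀)) (𝓝 (p₀, y₀)) :=
    (continuous_fst.tendsto (p₀, χ₁ y₀)).prodMk_nhds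
      (h₁.tendsto_symm.comp (continuous_snd.tendsto (p₀, χ₁ y₀)))
  have hsm : ∀ {A : ℝ × ℝ → M → M}, (∀ᶠ q in 𝓝 (p₀, y₀),
      ContMDiffAt (𝓘(ℝ, ℝ × ℝ).prod 𝓘(ℝ, E)) 𝓘(ℝ, E) ∞ (fun q : (ℝ × ℝ) × M => A q.1 q.2) q) →
      ∀ᶠ q in 𝓝 (p₀, χ₁ y₀), ContDiffAt ℝ ∞ (fun q : (ℝ × ℝ) × E => g (A q.1 (κ₁ q.2))) q := by
    intro A hA
    filter_upwards [hκ.eventually hA,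
      (continuous_snd.tendsto (p₀, χ₁ y₀)).eventually h₁.smooth_symm] with q q1 q2
    exact contDiffAt_coord (G := fun q : (ℝ × ℝ) × M => g (A q.1 q.2))
      ((hg (A q.1 (κ₁ q.2))).comp (q.1, κ₁ q.2) q1) q2
  refine isBigO_clm_of_apply fun v => ?_
  -- The hyperplane is `a = 0`, with transversal direction `∂/∂a`; the directions `(0, v)` of `M`
  -- are tangent to it, so the order `k` is kept.
  let ℓ : (ℝ × ℝ) × E →L[ℝ] ℝ :=
    (ContinuousLinearMap.fst ℝ ℝ ℝ).comp (ContinuousLinearMap.fst ℝ (ℝ × ℝ) E)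
  have key := fderiv_tangent_isBigO ℓ (((1 : ℝ), (0 : ℝ)), (0 : E)) rfl k
    (fun q : (ℝ × ℝ) × E => g (A q.1 (κ₁ q.2)) - g (A' q.1 (κ₁ q.2))) (p₀, χ₁ y₀) hp₀
    (by filter_upwards [hsm hA, hsm hA'] with q q1 q2 using q1.sub q2)
    (by
      filter_upwards [hκ.eventually hAA'] with z hz hz0
      have e1 := (hz hz0).isBigO hg
      have e2 : Tendsto (fun t : ℝ => (z.1 + t • ((1 : ℝ), (0 : ℝ)), κ₁ z.2)) (𝓝 0)
          (𝓝 (z.1, κ₁ z.2)) := by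
        have : Continuous fun t : ℝ => (z.1 + t • ((1 : ℝ), (0 : ℝ)), κ₁ z.2) := by fun_prop
        simpa using this.tendsto 0
      have e3 := e1.comp_tendsto e2
      have hz0' : z.1.1 = 0 := hz0
      refine (e3.congr_right fun t => ?_).congr_left fun t => ?_
      · simp [hz0']
      · simp)
    (0, v) rfl
  refine (key.congr' ?_ EventuallyEq.rfl)
  filter_upwards [hsm hA, hsm hA'] with q q1 q2
  have e1 := fderiv_fun_sub (q1.differentiableAt (by simp)) (q2.differentiableAt (by simp))
  rw [e1]
  rfl

/-- The first jets of the two families differ by `O(a ^ k)`, and the transported tensor is a locally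
Lipschitz function of them. -/
theorem PoissonTensor.isBigO_transportEval_sub (π : PoissonTensor E M) (hk : k ≠ 0)
    (hp₀ : p₀.1 = 0)
    (hA : ∀ᶠ q in 𝓝 (p₀, y₀),
      ContMDiffAt (𝓘(ℝ, ℝ × ℝ).prod 𝓘(ℝ, E)) 𝓘(ℝ, E) ∞ (fun q : (ℝ × ℝ) × M => A q.1 q.2) q)
    (hA' : ∀ᶠ q in 𝓝 (p₀, y₀),
      ContMDiffAt (𝓘(ℝ, ℝ × ℝ).prod 𝓘(ℝ, E)) 𝓘(ℝ, E) ∞ (fun q : (ℝ × ℝ) × M => A' q.1 q.2) q)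
    (hB : ∀ᶠ q in 𝓝 (p₀, y₀),
      ContMDiffAt (𝓘(ℝ, ℝ × ℝ).prod 𝓘(ℝ, E)) 𝓘(ℝ, E) ∞ (fun q : (ℝ × ℝ) × M => B q.1 q.2) q)
    (hB' : ∀ᶠ q in 𝓝 (p₀, y₀),
      ContMDiffAt (𝓘(ℝ, ℝ × ℝ).prod 𝓘(ℝ, E)) 𝓘(ℝ, E) ∞ (fun q : (ℝ × ℝ) × M => B' q.1 q.2) q)
    (hAA' : ∀ᶠ q in 𝓝 (p₀, y₀), q.1.1 = 0 → AgreeToOrder E k A A' q)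
    (hBB' : ∀ᶠ q in 𝓝 (p₀, y₀), q.1.1 = 0 → AgreeToOrder E k B B' q)
    (hinj : Function.Injective (mfderiv 𝓘(ℝ, E) 𝓘(ℝ, E) (A p₀) y₀))
    (hinj' : Function.Injective (mfderiv 𝓘(ℝ, E) 𝓘(ℝ, E) (A' p₀) y₀))
    (hf : IsSmoothFun E f) (hg : IsSmoothFun E g) :
    (fun q : (ℝ × ℝ) × M => π.transportEval (A q.1) (B q.1) f g q.2 -
      π.transportEval (A' q.1) (B' q.1) f g q.2) =O[𝓝 (p₀, y₀)] fun q => q.1.1 ^ k := by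
  obtain ⟨χ₁, κ₁, h₁⟩ := exists_localCoord (E := E) y₀
  obtain ⟨χ, κ, h⟩ := exists_localCoord (E := E) (A p₀ y₀)
  -- At `a = 0` the families coincide, as `k ≠ 0`; hence one chart at the image serves both, and
  -- their jets tend to the same limit.
  have hAeq : A p₀ y₀ = A' p₀ y₀ := (hAA'.self_of_nhds hp₀).eq hk hp₀
  have h' : LocalCoord (A' p₀ y₀) χ κ := hAeq ▸ h
  have hc := continuousAt_jetOf h₁ h.smooth hA.self_of_nhds hB.self_of_nhds hf hg
  have hc' := continuousAt_jetOf h₁ h.smooth hA'.self_of_nhds hB'.self_of_nhds hf hg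
  have hχ : Tendsto (fun q : (ℝ × ℝ) × M => (q.1, χ₁ q.2)) (𝓝 (p₀, y₀)) (𝓝 (p₀, χ₁ y₀)) :=
    (continuous_fst.prodMk (h₁.smooth.continuous.comp continuous_snd)).tendsto (p₀, y₀)
  have hκ : Tendsto (fun q : (ℝ × ℝ) × E => (q.1, κ₁ q.2)) (𝓝 (p₀, χ₁ y₀)) (𝓝 (p₀, y₀)) :=
    (continuous_fst.tendsto (p₀, χ₁ y₀)).prodMk_nhds
      (h₁.tendsto_symm.comp (continuous_snd.tendsto (p₀, χ₁ y₀)))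
  have hjet : (fun q : (ℝ × ℝ) × E => jetOf χ κ₁ A B f g q - jetOf χ κ₁ A' B' f g q)
      =O[𝓝 (p₀, χ₁ y₀)] fun q => q.1.1 ^ k := by
    refine (isBigO_fderiv_coord_sub h₁ hp₀ hA hA' hAA' h.smooth).prod_left
      ((isBigO_fderiv_coord_sub h₁ hp₀ hB hB' hBB' hf).prod_left
      ((isBigO_fderiv_coord_sub h₁ hp₀ hB hB' hBB' hg).prod_left ?_))
    exact ((hAA'.self_of_nhds hp₀).isBigO h.smooth).comp_tendsto hκ
  have hjet0 : jetOf χ κ₁ A' B' f g (p₀, χ₁ y₀) = jetOf χ κ₁ A B f g (p₀, χ₁ y₀) :=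
    (sub_eq_zero.1 (hjet.eq_zero_imp.self_of_nhds (by simp only [hp₀, zero_pow hk]))).symm
  have hstrict := (π.contDiffAt_jetEval h (isInvertible_jetOf (B := B) (f := f) (g := g) h₁ h
    hA.self_of_nhds hinj) (by simp only [jetOf, h₁.left_inv_self])).hasStrictFDerivAt (by simp)
  have hpair : Tendsto (fun q => (jetOf χ κ₁ A B f g q, jetOf χ κ₁ A' B' f g q)) (𝓝 (p₀, χ₁ y₀))
      (𝓝 (jetOf χ κ₁ A B f g (p₀, χ₁ y₀), jetOf χ κ₁ A B f g (p₀, χ₁ y₀))) := by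
    have := hc'.tendsto
    rw [hjet0] at this
    exact hc.tendsto.prodMk_nhds this
  have hfin := ((hstrict.isBigO_sub.comp_tendsto hpair).trans hjet).comp_tendsto hχ
  refine hfin.congr' ?_ EventuallyEq.rfl
  filter_upwards [π.eventually_transportEval_eq h₁ h hA hB hinj hf hg,
    π.eventually_transportEval_eq h₁ h' hA' hB' hinj' hf hg] with q q1 q2
  rw [q1, q2]
  rfl

end Agreement

/-! ### The bisection maps in the parameters `a = √ε`, `b = √h` -/

section BisectionMaps

variable {E : Type*} [NormedAddCommGroup E] [NormedSpace ℝ E]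
  {M : Type*} [TopologicalSpace M] [ChartedSpace E M] [IsManifold 𝓘(ℝ, E) ∞ M]
  {F : Type*} [NormedAddCommGroup F] [NormedSpace ℝ F]
  {S : Type*} [TopologicalSpace S] [ChartedSpace F S]
  {Ψ : OpenPartialHomeomorph (CotangentBundle E M) S}
  {θ : ℝ → ℝ → ∀ x : M, TangentSpace 𝓘(ℝ, E) x →L[ℝ] ℝ} {ε₀ h₀ : ℝ}

/-- The composition of a map `S → M` with the parametrization of the Lagrangian, with the
parameters `ε = a ^ 2` and `h = b ^ 2`. -/
def bisectionMap (a : ℝ → S → M) (Ψ : OpenPartialHomeomorph (CotangentBundle E M) S)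
    (θ : ℝ → ℝ → ∀ x : M, TangentSpace 𝓘(ℝ, E) x →L[ℝ] ℝ) (p : ℝ × ℝ) (y : M) : M :=
  a (p.1 ^ 2) (graphMap Ψ (θ (p.1 ^ 2) (p.2 ^ 2)) y)

/-- The parameters `(a, b)` with `a ^ 2 < ε₀` and `b ^ 2 < h₀`. -/
def sqDomain (ε₀ h₀ : ℝ) : Set (ℝ × ℝ) := {p | p.1 ^ 2 < ε₀ ∧ p.2 ^ 2 < h₀}

theorem isOpen_sqDomain : IsOpen (sqDomain ε₀ h₀) := by
  have h1 : Continuous fun p : ℝ × ℝ => p.1 ^ 2 := by fun_prop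
  have h2 : Continuous fun p : ℝ × ℝ => p.2 ^ 2 := by fun_prop
  exact (isOpen_lt h1 continuous_const).inter (isOpen_lt h2 continuous_const)

theorem zero_mem_sqDomain (hε₀ : 0 < ε₀) (hh₀ : 0 < h₀) : (0 : ℝ × ℝ) ∈ sqDomain ε₀ h₀ := by
  simpa [sqDomain] using And.intro hε₀ hh₀

theorem eventually_fst_mem {p₀ : ℝ × ℝ} {y₀ : M} (h : p₀ ∈ sqDomain ε₀ h₀) :
    ∀ᶠ q in 𝓝 (p₀, y₀), q.1 ∈ sqDomain ε₀ h₀ :=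
  (continuous_fst.tendsto (p₀, y₀)).eventually (isOpen_sqDomain.mem_nhds h)

/-- Squares are nonnegative, so smoothness on the half-open parameter intervals gives smoothness on
a full neighbourhood in `(a, b)`. -/
theorem IsLagrangianFamily.contMDiffAt_graph [IsManifold 𝓘(ℝ, F) ∞ S] {Ω : SymplecticForm F S}
    [FiniteDimensional ℝ F]
    {σ : M → S} (hΨ : IsTubularNeighbourhood (F := F) Ψ σ)
    (hθ : IsLagrangianFamily Ω Ψ ε₀ h₀ θ) {p : ℝ × ℝ} (hp : p ∈ sqDomain ε₀ h₀) (y : M) :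
    ContMDiffAt (𝓘(ℝ, ℝ × ℝ).prod 𝓘(ℝ, E)) 𝓘(ℝ, F) ∞
      (fun q : (ℝ × ℝ) × M => graphMap Ψ (θ (q.1.1 ^ 2) (q.1.2 ^ 2)) q.2) (p, y) := by
  have h1 : ContMDiffAt (𝓘(ℝ, ℝ × ℝ).prod 𝓘(ℝ, E)) (𝓘(ℝ, ℝ × ℝ).prod 𝓘(ℝ, E)) ∞
      (fun q : (ℝ × ℝ) × M => ((q.1.1 ^ 2, q.1.2 ^ 2), q.2)) (p, y) := by
    refine ContMDiffAt.prodMk ?_ contMDiffAt_snd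
    refine ContMDiffAt.comp (p, y) (g := fun p : ℝ × ℝ => (p.1 ^ 2, p.2 ^ 2))
      (f := fun q : (ℝ × ℝ) × M => q.1) (contMDiffAt_iff_contDiffAt.2 ?_) contMDiffAt_fst
    fun_prop
  have hmem : ((p.1 ^ 2, p.2 ^ 2), y) ∈ (Ico 0 ε₀ ×ˢ Ico 0 h₀) ×ˢ (univ : Set M) :=
    ⟨⟨⟨sq_nonneg _, hp.1⟩, ⟨sq_nonneg _, hp.2⟩⟩, mem_univ y⟩
  have h2 := ContMDiffWithinAt.comp (p, y) (hθ.smooth _ hmem) (h1.contMDiffWithinAt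
    (s := (fun q : (ℝ × ℝ) × M => ((q.1.1 ^ 2, q.1.2 ^ 2), q.2)) ⁻¹'
      ((Ico 0 ε₀ ×ˢ Ico 0 h₀) ×ˢ univ))) (fun q hq => hq)
  have h3 := h2.contMDiffAt (by
    filter_upwards [eventually_fst_mem hp] with q hq
    exact ⟨⟨⟨sq_nonneg _, hq.1⟩, ⟨sq_nonneg _, hq.2⟩⟩, mem_univ _⟩)
  have hsrc := hθ.mem_source (p.1 ^ 2) ⟨sq_nonneg _, hp.1⟩ (p.2 ^ 2) ⟨sq_nonneg _, hp.2⟩ y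
  exact ContMDiffAt.comp (p, y) (g := Ψ)
    ((hΨ.smooth _ hsrc).contMDiffAt (Ψ.open_source.mem_nhds hsrc)) h3

theorem contMDiffAt_bisectionMap [IsManifold 𝓘(ℝ, F) ∞ S] [FiniteDimensional ℝ E] [T2Space M]
    [FiniteDimensional ℝ F] {Ω : SymplecticForm F S}
    {σ : M → S} (hΨ : IsTubularNeighbourhood (F := F) Ψ σ)
    (hθ : IsLagrangianFamily Ω Ψ ε₀ h₀ θ) {a : ℝ → S → M} (ha : IsSmoothFamily E F ε₀ a)
    {p : ℝ × ℝ} (hp : p ∈ sqDomain ε₀ h₀) (y : M) :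
    ContMDiffAt (𝓘(ℝ, ℝ × ℝ).prod 𝓘(ℝ, E)) 𝓘(ℝ, E) ∞
      (fun q : (ℝ × ℝ) × M => bisectionMap a Ψ θ q.1 q.2) (p, y) :=
  contMDiffAt_comp_family (b := fun t s => a (t ^ 2) s) (τ := fun p : ℝ × ℝ => p.1)
    (ha.contMDiffAt_sq hp.1 _) contDiffAt_fst (hθ.contMDiffAt_graph hΨ hp y)

theorem one_isBigO_of_tendsto {ι : Type*} {l : Filter ι} {δ : ι → ℝ} {c : ℝ}
    (h : Tendsto δ l (𝓝 c)) (hc : c ≠ 0) : (fun _ => (1 : ℝ)) =O[l] δ := by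
  have h1 := ((h.inv₀ hc).isBigO_one ℝ).mul (isBigO_refl δ l)
  refine h1.congr' ?_ (Eventually.of_forall fun i => one_mul _)
  filter_upwards [h.eventually_ne hc] with i hi
  exact inv_mul_cancel₀ hi

/-- Away from `a = 0` the right-hand side is bounded below, and boundedness is enough. -/
theorem isBigO_pow_of_continuousAt {h : (ℝ × ℝ) × M → ℝ} {q₀ : (ℝ × ℝ) × M}
    (hc : ContinuousAt h q₀) (hq₀ : q₀.1.1 ≠ 0) (k : ℕ) :
    h =O[𝓝 q₀] fun q => q.1.1 ^ k := by
  have h1 : h =O[𝓝 q₀] fun _ => (1 : ℝ) := hc.tendsto.isBigO_one ℝ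
  refine h1.trans ?_
  have h2 : Continuous fun q : (ℝ × ℝ) × M => q.1.1 ^ k := by fun_prop
  exact one_isBigO_of_tendsto (h2.tendsto q₀) (pow_ne_zero k hq₀)

/-- A compact neighbourhood in `S` turns an estimate on compact sets into a local one. The exponent
doubles since `ε = a ^ 2`, and being even it makes the sign of `a` irrelevant. -/
theorem ApproxToOrder.agreeToOrder [LocallyCompactSpace S] {n : ℕ} {a a' : ℝ → S → M}
    (h : ApproxToOrder E n a a') {q₀ : (ℝ × ℝ) × M} (hq₀ : q₀.1.1 = 0)
    (hΓ : ContinuousAt (fun q : (ℝ × ℝ) × M => graphMap Ψ (θ (q.1.1 ^ 2) (q.1.2 ^ 2)) q.2) q₀) :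
    AgreeToOrder E (2 * (n + 1)) (bisectionMap a Ψ θ) (bisectionMap a' Ψ θ) q₀ := by
  intro g hg
  obtain ⟨Q, hQ, hQn⟩ := exists_compact_mem_nhds
    (graphMap Ψ (θ (q₀.1.1 ^ 2) (q₀.1.2 ^ 2)) q₀.2)
  obtain ⟨C, ε₁, hε₁, hC⟩ := h g hg Q hQ
  refine IsBigO.of_bound C ?_
  have h1 : ∀ᶠ q : (ℝ × ℝ) × M in 𝓝 q₀, q.1.1 ^ 2 < ε₁ := by
    have hc : Continuous fun q : (ℝ × ℝ) × M => q.1.1 ^ 2 := by fun_prop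
    refine hc.continuousAt.eventually (isOpen_Iio.mem_nhds ?_)
    simpa [hq₀] using hε₁
  filter_upwards [h1, hΓ.eventually hQn] with q q1 q2
  have := hC (q.1.1 ^ 2) ⟨sq_nonneg _, q1.le⟩ _ q2
  rw [← pow_mul] at this
  rw [Real.norm_eq_abs, Real.norm_eq_abs, abs_of_nonneg ((even_two_mul (n + 1)).pow_nonneg q.1.1)]
  exact this

theorem ApproxToOrder.eq_zero [FiniteDimensional ℝ E] [T2Space M] {n : ℕ} {a a' : ℝ → S → M}
    (h : ApproxToOrder E n a a') (s : S) : a 0 s = a' 0 s := by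
  refine eq_of_forall_smoothFun_eq (E := E) fun g hg => ?_
  obtain ⟨C, ε₁, hε₁, hC⟩ := h g hg {s} isCompact_singleton
  have := hC 0 ⟨le_rfl, hε₁.le⟩ s rfl
  rw [zero_pow (Nat.succ_ne_zero n), mul_zero] at this
  exact sub_eq_zero.1 (abs_eq_zero.1 (le_antisymm this (abs_nonneg _)))

end BisectionMaps

/-! ### Defects of the Poisson tensor and of the Casimirs -/

section PoissonEstimate

variable {E : Type*} [NormedAddCommGroup E] [NormedSpace ℝ E] [FiniteDimensional ℝ E]
  {M : Type*} [TopologicalSpace M] [ChartedSpace E M] [IsManifold 𝓘(ℝ, E) ∞ M] [T2Space M]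
  {F : Type*} [NormedAddCommGroup F] [NormedSpace ℝ F] [FiniteDimensional ℝ F]
  {S : Type*} [TopologicalSpace S] [ChartedSpace F S] [IsManifold 𝓘(ℝ, F) ∞ S]

/-- The case where the induced map is the identity, met at `ε = 0`. -/
theorem PoissonTensor.transportEval_self (π : PoissonTensor E M) {A B : M → M} {f g : M → ℝ}
    {y : M} (hA : MDifferentiableAt 𝓘(ℝ, E) 𝓘(ℝ, E) A y) (hAB : A =ᶠ[𝓝 y] B)
    (hinj : Function.Injective (mfderiv 𝓘(ℝ, E) 𝓘(ℝ, E) A y))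
    (hf : IsSmoothFun E f) (hg : IsSmoothFun E g) :
    π.transportEval A B f g y = π.bracket f g (B y) := by
  have hcov : ∀ k : M → ℝ, IsSmoothFun E k →
      mvfderiv 𝓘(ℝ, E) (fun y => k (B y)) y ∘L (mfderiv 𝓘(ℝ, E) 𝓘(ℝ, E) A y).inverse =
        mvfderiv 𝓘(ℝ, E) k (A y) := by
    intro k hk
    obtain ⟨e, he⟩ := exists_tangentEquiv_of_injective hinj
    have h1 : (fun y => k (B y)) =ᶠ[𝓝 y] fun y => k (A y) := by
      filter_upwards [hAB] with z hz
      rw [hz]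
    ext w
    obtain ⟨w, rfl⟩ : ∃ w', mfderiv 𝓘(ℝ, E) 𝓘(ℝ, E) A y w' = w :=
      ⟨e.symm w, by rw [← he]; exact e.apply_symm_apply w⟩
    refine (comp_inverse_apply hinj _ w).trans ?_
    have h2 : mvfderiv 𝓘(ℝ, E) (fun y => k (B y)) y w = mvfderiv 𝓘(ℝ, E) (fun y => k (A y)) y w :=
      DFunLike.congr_fun (h1.mfderiv_eq (I := 𝓘(ℝ, E)) (I' := 𝓘(ℝ, ℝ))) w
    rw [h2]
    exact mvfderiv_comp_mfderiv (g := k) (f := A) ((hk _).mdifferentiableAt (by simp)) hA w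
  rw [PoissonTensor.transportEval, hcov f hf, hcov g hg, ← hAB.self_of_nhds]
  rfl

variable {Ω : SymplecticForm F S} {π : PoissonTensor E M} {σ : M → S} {ε₀ h₀ : ℝ}
  {α β α' β' : ℝ → S → M} {Ψ : OpenPartialHomeomorph (CotangentBundle E M) S}
  {θ : ℝ → ℝ → ∀ x : M, TangentSpace 𝓘(ℝ, E) x →L[ℝ] ℝ} {n : ℕ} {f g : M → ℝ} {p₀ : ℝ × ℝ} {y₀ : M}

/-- The Casimirs of the exact Poisson structures have the same pullbacks by `α` and `β` at the
points of the Lagrangians near `q₀`. -/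
def CasimirsAgree (π : PoissonTensor E M) (α β : ℝ → S → M)
    (Ψ : OpenPartialHomeomorph (CotangentBundle E M) S)
    (θ : ℝ → ℝ → ∀ x : M, TangentSpace 𝓘(ℝ, E) x →L[ℝ] ℝ) (q₀ : (ℝ × ℝ) × M) : Prop :=
  ∀ᶠ q in 𝓝 q₀, ∀ c, (π.scale (q.1.1 ^ 2)).IsCasimir c →
    c (bisectionMap α Ψ θ q.1 q.2) = c (bisectionMap β Ψ θ q.1 q.2)

theorem PoissonTensor.isCasimir_scale {c : M → ℝ} (hc : π.IsCasimir c) (t : ℝ) :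
    (π.scale t).IsCasimir c := by
  refine ⟨hc.1, fun f hf x => ?_⟩
  have h1 : (π.scale t).bracket c f x = t * π.bracket c f x :=
    congrFun (PoissonTensor.bracketOf_smul t π.sharp c f) x
  rw [h1, hc.2 f hf x, mul_zero]

/-- For the zero structure the Casimirs separate points, so their agreement at `ε = 0` forces `α_0 =
β_0` on the bisection. -/
theorem PoissonTensor.isCasimir_scale_zero {c : M → ℝ} (hc : IsSmoothFun E c) :
    (π.scale 0).IsCasimir c := by
  refine ⟨hc, fun f _ x => ?_⟩
  have h1 : (π.scale 0).bracket c f x = 0 * π.bracket c f x :=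
    congrFun (PoissonTensor.bracketOf_smul 0 π.sharp c f) x
  rw [h1, zero_mul]

/-- The maps induced by the exact Lagrangian bisections are Poisson. -/
theorem eventually_transportEval_eq_bracket
    (hR : ∀ ε ∈ Ico 0 ε₀, IsRealizationData Ω (π.scale ε) (α ε) (β ε) σ)
    (hα : IsSmoothFamily E F ε₀ α)
    (hΨ : IsTubularNeighbourhood (F := F) Ψ σ) (hθ : IsLagrangianFamily Ω Ψ ε₀ h₀ θ)
    (hp₀ : p₀ ∈ sqDomain ε₀ h₀) (hcas : CasimirsAgree π α β Ψ θ (p₀, y₀))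
    (hinj : Function.Injective (mfderiv 𝓘(ℝ, E) 𝓘(ℝ, E) (bisectionMap α Ψ θ p₀) y₀))
    (hf : IsSmoothFun E f) (hg : IsSmoothFun E g) :
    ∀ᶠ q in 𝓝 (p₀, y₀), π.transportEval (bisectionMap α Ψ θ q.1) (bisectionMap β Ψ θ q.1) f g q.2 =
      π.bracket f g (bisectionMap β Ψ θ q.1 q.2) := by
  filter_upwards [eventually_fst_mem hp₀, hcas.eventually_nhds,
    eventually_injective_mfderiv (contMDiffAt_bisectionMap hΨ hθ hα hp₀ y₀) hinj] with q q1 q2 q3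
  obtain ⟨p, y⟩ := q
  simp only at q1 q2 q3 ⊢
  have hA := (contMDiffAt_slice (contMDiffAt_bisectionMap hΨ hθ hα q1 y)).mdifferentiableAt
    (by simp)
  -- At `ε = 0` the realization carries no information about `π`; the agreement of Casimirs shows
  -- that the two bisection maps coincide.
  by_cases hp : p.1 = 0
  · refine π.transportEval_self hA ?_ q3 hf hg
    have e1 : Tendsto (fun y : M => (p, y)) (𝓝 y) (𝓝 (p, y)) :=
      (Continuous.prodMk_right p).tendsto y
    filter_upwards [e1.eventually q2] with z hz
    refine eq_of_forall_smoothFun_eq (E := E) fun c hc => hz c ?_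
    simp only [hp, ne_eq, OfNat.ofNat_ne_zero, not_false_eq_true, zero_pow]
    exact π.isCasimir_scale_zero hc
  -- For `ε ≠ 0` the induced map is Poisson for `επ`, and the factor `ε` cancels.
  · have hpos : p.1 ^ 2 ≠ 0 := pow_ne_zero 2 hp
    have e1 := (hR (p.1 ^ 2) ⟨sq_nonneg _, q1.1⟩).eval_eq_bracket
      (hθ.lagrangian (p.1 ^ 2) ⟨sq_nonneg _, q1.1⟩ (p.2 ^ 2) ⟨sq_nonneg _, q1.2⟩)
      ((contMDiffAt_slice (G := fun p : ℝ × ℝ => graphMap Ψ (θ (p.1 ^ 2) (p.2 ^ 2)))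
        (hθ.contMDiffAt_graph hΨ q1 y)).mdifferentiableAt (by simp)) q3 hf hg
      (fun w => comp_inverse_apply q3 (mvfderiv 𝓘(ℝ, E) (fun y => f (bisectionMap β Ψ θ p y)) y) w)
      (fun w => comp_inverse_apply q3 (mvfderiv 𝓘(ℝ, E) (fun y => g (bisectionMap β Ψ θ p y)) y) w)
    have e2 : ∀ z, (π.scale (p.1 ^ 2)).bracket f g z = p.1 ^ 2 * π.bracket f g z := fun z =>
      congrFun (PoissonTensor.bracketOf_smul (p.1 ^ 2) π.sharp f g) z
    have e3 : ∀ (z : M) (ξ η : TangentSpace 𝓘(ℝ, E) z →L[ℝ] ℝ),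
        (π.scale (p.1 ^ 2)).eval z ξ η = p.1 ^ 2 * π.eval z ξ η := fun z ξ η => by
      rw [PoissonTensor.eval, PoissonTensor.scale_sharp, map_smul, smul_eq_mul]
      rfl
    exact mul_left_cancel₀ hpos ((e3 _ _ _).symm.trans (e1.trans (e2 _)))

variable [LocallyCompactSpace S]

/-- The exact transported tensor equals the bracket at the `β`-end. Two errors remain: the change of
jets from `α, β` to `α', β'`, and the change of `{f, g}` between `β` and `β'`, which is an instance
of the approximation hypothesis with test function `{f, g}`. -/
theorem isBigO_transportEval_sub_bracket
    (hR : ∀ ε ∈ Ico 0 ε₀, IsRealizationData Ω (π.scale ε) (α ε) (β ε) σ)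
    (hα : IsSmoothFamily E F ε₀ α) (hβ : IsSmoothFamily E F ε₀ β)
    (hα' : IsSmoothFamily E F ε₀ α') (hβ' : IsSmoothFamily E F ε₀ β')
    (hαα' : ApproxToOrder E n α α') (hββ' : ApproxToOrder E n β β')
    (hΨ : IsTubularNeighbourhood (F := F) Ψ σ) (hθ : IsLagrangianFamily Ω Ψ ε₀ h₀ θ)
    (hp₀ : p₀ ∈ sqDomain ε₀ h₀) (hcas : CasimirsAgree π α β Ψ θ (p₀, y₀))
    (hinj : Function.Injective (mfderiv 𝓘(ℝ, E) 𝓘(ℝ, E) (bisectionMap α Ψ θ p₀) y₀))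
    (hinj' : Function.Injective (mfderiv 𝓘(ℝ, E) 𝓘(ℝ, E) (bisectionMap α' Ψ θ p₀) y₀))
    (hf : IsSmoothFun E f) (hg : IsSmoothFun E g) :
    (fun q : (ℝ × ℝ) × M =>
      π.transportEval (bisectionMap α' Ψ θ q.1) (bisectionMap β' Ψ θ q.1) f g q.2 -
        π.bracket f g (bisectionMap β' Ψ θ q.1 q.2)) =O[𝓝 (p₀, y₀)]
      fun q => q.1.1 ^ (2 * (n + 1)) := by
  have hsm : ∀ {a : ℝ → S → M}, IsSmoothFamily E F ε₀ a → ∀ᶠ q in 𝓝 (p₀, y₀),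
      ContMDiffAt (𝓘(ℝ, ℝ × ℝ).prod 𝓘(ℝ, E)) 𝓘(ℝ, E) ∞
        (fun q : (ℝ × ℝ) × M => bisectionMap a Ψ θ q.1 q.2) q := fun ha => by
    filter_upwards [eventually_fst_mem hp₀] with q hq
    exact contMDiffAt_bisectionMap hΨ hθ ha hq q.2
  have hbr : IsSmoothFun E (π.bracket f g) := π.smooth f g hf hg
  by_cases hp : p₀.1 = 0
  · have hag : ∀ {a a' : ℝ → S → M}, ApproxToOrder E n a a' → ∀ᶠ q in 𝓝 (p₀, y₀), q.1.1 = 0 →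
        AgreeToOrder E (2 * (n + 1)) (bisectionMap a Ψ θ) (bisectionMap a' Ψ θ) q := fun haa' => by
      filter_upwards [eventually_fst_mem hp₀] with q hq hq0
      exact haa'.agreeToOrder hq0 (hθ.contMDiffAt_graph hΨ hq q.2).continuousAt
    have h1 := π.isBigO_transportEval_sub (by omega) hp (hsm hα) (hsm hα') (hsm hβ) (hsm hβ')
      (hag hαα') (hag hββ') hinj hinj' hf hg
    have h2 := (hag hββ').self_of_nhds hp _ hbr
    refine (h2.sub h1).congr' ?_ EventuallyEq.rfl
    filter_upwards [eventually_transportEval_eq_bracket hR hα hΨ hθ hp₀ hcas hinj hf hg] with q hq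
    rw [hq]
    ring
  · refine isBigO_pow_of_continuousAt (ContinuousAt.sub ?_ ?_) hp _
    · exact π.continuousAt_transportEval (hsm hα') (hsm hβ') hinj' hf hg
    · exact (hbr.continuous.continuousAt).comp (hsm hβ').self_of_nhds.continuousAt

/-- As `c ∘ α = c ∘ β` on the bisection, the difference is that of the two approximation errors. -/
theorem isBigO_casimir_sub
    (hα' : IsSmoothFamily E F ε₀ α') (hβ' : IsSmoothFamily E F ε₀ β')
    (hαα' : ApproxToOrder E n α α') (hββ' : ApproxToOrder E n β β')
    (hΨ : IsTubularNeighbourhood (F := F) Ψ σ) (hθ : IsLagrangianFamily Ω Ψ ε₀ h₀ θ)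
    (hp₀ : p₀ ∈ sqDomain ε₀ h₀) (hcas : CasimirsAgree π α β Ψ θ (p₀, y₀))
    {c : M → ℝ} (hc : π.IsCasimir c) :
    (fun q : (ℝ × ℝ) × M => c (bisectionMap α' Ψ θ q.1 q.2) - c (bisectionMap β' Ψ θ q.1 q.2))
      =O[𝓝 (p₀, y₀)] fun q => q.1.1 ^ (2 * (n + 1)) := by
  by_cases hp : p₀.1 = 0
  · have hΓ := (hθ.contMDiffAt_graph hΨ hp₀ y₀).continuousAt
    have h1 := hαα'.agreeToOrder hp hΓ c hc.1
    have h2 := hββ'.agreeToOrder hp hΓ c hc.1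
    refine (h2.sub h1).congr' ?_ EventuallyEq.rfl
    filter_upwards [hcas] with q hq
    rw [hq c (π.isCasimir_scale hc _)]
    ring
  · refine isBigO_pow_of_continuousAt (ContinuousAt.sub ?_ ?_) hp _
    · exact hc.1.continuous.continuousAt.comp
        (contMDiffAt_bisectionMap hΨ hθ hα' hp₀ y₀).continuousAt
    · exact hc.1.continuous.continuousAt.comp
        (contMDiffAt_bisectionMap hΨ hθ hβ' hp₀ y₀).continuousAt

end PoissonEstimate

/-! ### Comparison of the induced map with the Hamiltonian flow -/

section FlowEstimate

variable {E : Type*} [NormedAddCommGroup E] [NormedSpace ℝ E] [FiniteDimensional ℝ E]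
  {M : Type*} [TopologicalSpace M] [ChartedSpace E M] [IsManifold 𝓘(ℝ, E) ∞ M] [T2Space M]

/-- Smooth families of maps are locally Lipschitz. -/
theorem isBigO_sub_of_contMDiffAt {P V : Type*} [NormedAddCommGroup P] [NormedSpace ℝ P]
    [NormedAddCommGroup V] [NormedSpace ℝ V] {G : P × M → V} {p₀ : P} {y₀ : M} {χ : M → E}
    {κ : E → M} (hG : ContMDiffAt (𝓘(ℝ, P).prod 𝓘(ℝ, E)) 𝓘(ℝ, V) ∞ G (p₀, y₀))
    (h : LocalCoord y₀ χ κ) {ι : Type*} {l : Filter ι} {p₁ p₂ : ι → P} {y₁ y₂ : ι → M}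
    (hp₁ : Tendsto p₁ l (𝓝 p₀)) (hp₂ : Tendsto p₂ l (𝓝 p₀))
    (hy₁ : Tendsto y₁ l (𝓝 y₀)) (hy₂ : Tendsto y₂ l (𝓝 y₀)) :
    (fun i => G (p₁ i, y₁ i) - G (p₂ i, y₂ i)) =O[l]
      fun i => (p₁ i - p₂ i, χ (y₁ i) - χ (y₂ i)) := by
  have h1 : ContDiffAt ℝ ∞ (fun q : P × E => G (q.1, κ q.2)) (p₀, χ y₀) :=
    contDiffAt_coord (by rwa [h.left_inv_self]) h.smooth_symm.self_of_nhds
  have h2 := (h1.hasStrictFDerivAt (by simp)).isBigO_sub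
  have h3 : Tendsto (fun i => ((p₁ i, χ (y₁ i)), (p₂ i, χ (y₂ i)))) l
      (𝓝 ((p₀, χ y₀), (p₀, χ y₀))) :=
    (hp₁.prodMk_nhds (h.tendsto.comp hy₁)).prodMk_nhds (hp₂.prodMk_nhds (h.tendsto.comp hy₂))
  refine (h2.comp_tendsto h3).congr' ?_ EventuallyEq.rfl
  filter_upwards [hy₁.eventually h.left_inv, hy₂.eventually h.left_inv] with i i1 i2
  simp only [Function.comp, i1, i2]

variable {F : Type*} [NormedAddCommGroup F] [NormedSpace ℝ F] [FiniteDimensional ℝ F]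
  {S : Type*} [TopologicalSpace S] [ChartedSpace F S] [IsManifold 𝓘(ℝ, F) ∞ S]
  {Ω : SymplecticForm F S} {π : PoissonTensor E M} {σ : M → S} {ε₀ h₀ : ℝ}
  {α β α' β' : ℝ → S → M} {Ψ : OpenPartialHomeomorph (CotangentBundle E M) S}
  {θ : ℝ → ℝ → ∀ x : M, TangentSpace 𝓘(ℝ, E) x →L[ℝ] ℝ} {n m : ℕ}

theorem TubularCoord.contMDiffAt_comp {Λ : (E →L[ℝ] ℝ) → M → S}
    {co : CotangentBundle E M → (E →L[ℝ] ℝ)} {X : E → ∀ x : M, TangentSpace 𝓘(ℝ, E) x} {x₀ : M}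
    (hΛ : TubularCoord (F := F) Ψ σ x₀ Λ co X) {a : ℝ → S → M} (ha : IsSmoothFamily E F ε₀ a)
    (hε₀ : 0 < ε₀) :
    ContMDiffAt (𝓘(ℝ, ℝ × (E →L[ℝ] ℝ)).prod 𝓘(ℝ, E)) 𝓘(ℝ, E) ∞
      (fun q : (ℝ × (E →L[ℝ] ℝ)) × M => a (q.1.1 ^ 2) (Λ q.1.2 q.2)) (0, x₀) := by
  have h1 : ContMDiffAt (𝓘(ℝ, ℝ × (E →L[ℝ] ℝ)).prod 𝓘(ℝ, E)) 𝓘(ℝ, F) ∞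
      (fun q : (ℝ × (E →L[ℝ] ℝ)) × M => Λ q.1.2 q.2) (0, x₀) := by
    refine ContMDiffAt.comp (0, x₀) (g := fun q : (E →L[ℝ] ℝ) × M => Λ q.1 q.2)
      (f := fun q : (ℝ × (E →L[ℝ] ℝ)) × M => (q.1.2, q.2)) hΛ.smooth.self_of_nhds ?_
    exact (ContMDiffAt.comp (0, x₀) (g := fun p : ℝ × (E →L[ℝ] ℝ) => p.2)
      (f := fun q : (ℝ × (E →L[ℝ] ℝ)) × M => q.1)
      (contMDiffAt_iff_contDiffAt.2 contDiffAt_snd) contMDiffAt_fst).prodMk contMDiffAt_snd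
  exact contMDiffAt_comp_family (b := fun t s => a (t ^ 2) s)
    (τ := fun p : ℝ × (E →L[ℝ] ℝ) => p.1)
    (ha.contMDiffAt_sq (by simpa using hε₀) _) contDiffAt_fst h1

theorem graphMap_zero (hΨ : IsTubularNeighbourhood (F := F) Ψ σ)
    (hθ : IsLagrangianFamily Ω Ψ ε₀ h₀ θ) (hε₀ : 0 < ε₀) (y : M) :
    graphMap Ψ (θ ((0 : ℝ × ℝ).1 ^ 2) ((0 : ℝ × ℝ).2 ^ 2)) y = σ y := by
  simp only [graphMap, Prod.fst_zero, Prod.snd_zero, ne_eq, OfNat.ofNat_ne_zero, not_false_eq_true,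
    zero_pow, hθ.at_zero 0 ⟨le_rfl, hε₀⟩, hΨ.zero_eq]

theorem bisectionMap_zero (hΨ : IsTubularNeighbourhood (F := F) Ψ σ)
    (hθ : IsLagrangianFamily Ω Ψ ε₀ h₀ θ) (hε₀ : 0 < ε₀) {a : ℝ → S → M}
    (ha : ∀ x, a 0 (σ x) = x) (y : M) : bisectionMap a Ψ θ 0 y = y := by
  rw [bisectionMap, graphMap_zero hΨ hθ hε₀]
  simpa using ha y

variable [LocallyCompactSpace S]

/-- The map induced by the approximate Lagrangians approximates the Hamiltonian flow. -/
theorem isBigO_flow_sub {H : M → ℝ} (hH : IsSmoothFun E H) (hε₀ : 0 < ε₀) (hh₀ : 0 < h₀)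
    (hR : ∀ ε ∈ Ico 0 ε₀, IsRealizationData Ω (π.scale ε) (α ε) (β ε) σ)
    (hα : IsSmoothFamily E F ε₀ α) (hβ : IsSmoothFamily E F ε₀ β)
    (hα' : IsSmoothFamily E F ε₀ α') (hβ' : IsSmoothFamily E F ε₀ β')
    (hαα' : ApproxToOrder E n α α') (hββ' : ApproxToOrder E n β β')
    (hΨ : IsTubularNeighbourhood (F := F) Ψ σ) (hθ : IsLagrangianFamily Ω Ψ ε₀ h₀ θ)
    (hθL : ApproxLagrangian Ω Ψ σ α H m θ) {K : Set M} (hK : IsCompact K) {g : M → ℝ}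
    (hg : IsSmoothFun E g) {x₀ : M} {ι : Type*} {l : Filter ι} {p : ι → ℝ × ℝ} {x Y : ι → M}
    {Z : ι → S} (hp : Tendsto p l (𝓝 0)) (hx : Tendsto x l (𝓝 x₀)) (hxK : ∀ᶠ i in l, x i ∈ K)
    (hY : Tendsto Y l (𝓝 x₀)) (hYx : ∀ᶠ i in l, bisectionMap β' Ψ θ (p i) (Y i) = x i)
    (hZ : Tendsto Z l (𝓝 (σ x₀)))
    (hflow : ∀ᶠ i in l,
      FlowsTo (Ω.hamVF (H ∘ α ((p i).1 ^ 2))) ((p i).2 ^ 2) (σ (x i)) (Z i)) :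
    (fun i => g (bisectionMap α' Ψ θ (p i) (Y i)) - g (α ((p i).1 ^ 2) (Z i))) =O[l]
      fun i => (p i).1 ^ (2 * (n + 1)) + (p i).2 ^ (2 * (m + 1)) := by
  obtain ⟨Λ, co, X, hΛ⟩ := hΨ.exists_coord x₀
  obtain ⟨χ, κ, hχ⟩ := exists_localCoord (E := E) x₀
  have hdom : (0 : ℝ × ℝ) ∈ sqDomain ε₀ h₀ := zero_mem_sqDomain hε₀ hh₀
  have hp1 : Tendsto (fun i => (p i).1) l (𝓝 0) := (continuous_fst.tendsto (0 : ℝ × ℝ)).comp hp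
  have hp2 : Tendsto (fun i => (p i).2) l (𝓝 0) := (continuous_snd.tendsto (0 : ℝ × ℝ)).comp hp
  have hsq : ∀ {t : ι → ℝ}, Tendsto t l (𝓝 0) → ∀ r > 0, ∀ᶠ i in l, t i ^ 2 ∈ Icc 0 r := by
    intro t ht r hr
    have e1 : Tendsto (fun i => t i ^ 2) l (𝓝 0) := by simpa using ht.pow 2
    filter_upwards [e1.eventually (Iio_mem_nhds hr)] with i hi using ⟨sq_nonneg _, le_of_lt hi⟩
  have hδ₁ : (fun i => (p i).1 ^ (2 * (n + 1))) =O[l]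
      fun i => (p i).1 ^ (2 * (n + 1)) + (p i).2 ^ (2 * (m + 1)) := by
    refine IsBigO.of_bound 1 (Eventually.of_forall fun i => ?_)
    have e1 := (even_two_mul (n + 1)).pow_nonneg (p i).1
    have e2 := (even_two_mul (m + 1)).pow_nonneg (p i).2
    rw [Real.norm_of_nonneg e1, Real.norm_of_nonneg (add_nonneg e1 e2)]
    linarith
  have hδ₂ : (fun i => (p i).2 ^ (2 * (m + 1))) =O[l]
      fun i => (p i).1 ^ (2 * (n + 1)) + (p i).2 ^ (2 * (m + 1)) := by
    refine IsBigO.of_bound 1 (Eventually.of_forall fun i => ?_)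
    have e1 := (even_two_mul (n + 1)).pow_nonneg (p i).1
    have e2 := (even_two_mul (m + 1)).pow_nonneg (p i).2
    rw [Real.norm_of_nonneg e2, Real.norm_of_nonneg (add_nonneg e1 e2)]
    linarith
  -- the cotangent coordinates of the exact and of the approximate Lagrangian
  let ξ : ι → (E →L[ℝ] ℝ) := fun i => co (Ψ.symm (Z i))
  let x' : ι → M := fun i => (Ψ.symm (Z i)).proj
  let ξ' : ι → (E →L[ℝ] ℝ) := fun i =>
    co ⟨x' i, θ ((p i).1 ^ 2) ((p i).2 ^ 2) (x' i)⟩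
  have hξx : Tendsto (fun i => (ξ i, x' i)) l (𝓝 (0, x₀)) := hΛ.tendsto.comp hZ
  have hξ : Tendsto ξ l (𝓝 0) := (continuous_fst.tendsto _).comp hξx
  have hx' : Tendsto x' l (𝓝 x₀) := (continuous_snd.tendsto _).comp hξx
  have hξξ' : (fun i => ξ' i - ξ i) =O[l] fun i => (p i).2 ^ (2 * (m + 1)) := by
    refine isBigO_clm_of_apply fun w => ?_
    obtain ⟨C, ε₁, hε₁, h₁, hh₁, hC⟩ := hθL (X w) (hΛ.smoothVF w) K hK
    refine IsBigO.of_bound C ?_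
    filter_upwards [hsq hp1 ε₁ hε₁, hsq hp2 h₁ hh₁, hx'.eventually hΛ.frame,
      hZ.eventually hΛ.mem_target, hflow, hxK] with i i1 i2 i3 i4 i5 i6
    have e1 := hC _ i1 _ i2 (x' i) (Ψ.symm (Z i)).2 (Ψ.map_target i4) (by
      refine ⟨σ (x i), mem_image_of_mem σ i6, ?_⟩
      have e2 : Ψ ⟨x' i, (Ψ.symm (Z i)).2⟩ = Z i := Ψ.right_inv i4
      rw [e2]
      exact i5)
    have e3 := i3 (θ ((p i).1 ^ 2) ((p i).2 ^ 2) (x' i)) w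
    have e4 : ξ i w = (Ψ.symm (Z i)).2 (X w (x' i)) := i3 (Ψ.symm (Z i)).2 w
    rw [← pow_mul] at e1
    rw [sub_apply, e3, e4,
      Real.norm_of_nonneg ((even_two_mul (m + 1)).pow_nonneg (p i).2)]
    exact e1
  have hξ' : Tendsto ξ' l (𝓝 0) := by
    have e1 : Tendsto (fun i => (p i).2 ^ (2 * (m + 1))) l (𝓝 0) := by
      simpa using hp2.pow (2 * (m + 1))
    simpa using (hξξ'.trans_tendsto e1).add hξ
  -- comparison of the exact and of the approximate Lagrangian
  have hcomp : ∀ {a : ℝ → S → M}, IsSmoothFamily E F ε₀ a →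
      ∀ {k : M → ℝ}, IsSmoothFun E k →
      (fun i => k (bisectionMap a Ψ θ (p i) (x' i)) - k (a ((p i).1 ^ 2) (Z i))) =O[l]
        fun i => (p i).2 ^ (2 * (m + 1)) := by
    intro a ha k hk
    have e1 := isBigO_sub_of_contMDiffAt
      (G := fun q : (ℝ × (E →L[ℝ] ℝ)) × M => k (a (q.1.1 ^ 2) (Λ q.1.2 q.2)))
      ((hk _).comp (0, x₀) (hΛ.contMDiffAt_comp ha hε₀)) hχ
      (p₁ := fun i => ((p i).1, ξ' i)) (p₂ := fun i => ((p i).1, ξ i)) (y₁ := x') (y₂ := x')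
      (hp1.prodMk_nhds hξ') (hp1.prodMk_nhds hξ) hx' hx'
    have e2 : (fun i => ((((p i).1, ξ' i) - ((p i).1, ξ i) : ℝ × (E →L[ℝ] ℝ)),
        χ (x' i) - χ (x' i))) =O[l] fun i => (p i).2 ^ (2 * (m + 1)) := by
      simp only [Prod.mk_sub_mk, sub_self]
      exact ((isBigO_zero _ _).prod_left hξξ').prod_left (isBigO_zero _ _)
    refine (e1.trans e2).congr' ?_ EventuallyEq.rfl
    filter_upwards [hx'.eventually hΛ.eq_graph, hZ.eventually hΛ.eq_self] with i i1 i2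
    have e3 : Λ (ξ' i) (x' i) = graphMap Ψ (θ ((p i).1 ^ 2) ((p i).2 ^ 2)) (x' i) := i1 _
    have e4 : Λ (ξ i) (x' i) = Z i := i2
    simp only [e3, e4, bisectionMap]
  have hpx' : Tendsto (fun i => (p i, x' i)) l (𝓝 (0, x₀)) := hp.prodMk_nhds hx'
  have hΓ := (hθ.contMDiffAt_graph hΨ hdom x₀).continuousAt
  -- The exact point `Z` lies in the fiber of `β` over `x`. Passing to the approximate Lagrangian
  -- over the same base point `x'`, and then from `β` to `β'`, moves the value away from `x` by the
  -- sum of the two errors.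
  have hβx : (fun i => χ (bisectionMap β' Ψ θ (p i) (x' i)) - χ (x i)) =O[l]
      fun i => (p i).1 ^ (2 * (n + 1)) + (p i).2 ^ (2 * (m + 1)) := by
    have e1 : (fun i => χ (bisectionMap β Ψ θ (p i) (x' i)) - χ (β ((p i).1 ^ 2) (Z i))) =O[l]
        fun i => (p i).1 ^ (2 * (n + 1)) + (p i).2 ^ (2 * (m + 1)) := by
      refine isBigO_of_dual fun η => ?_
      simpa only [map_sub] using (hcomp hβ (hχ.smooth.isSmoothFun_clm_comp η)).trans hδ₂
    have e2 := (((hββ'.agreeToOrder (q₀ := ((0 : ℝ × ℝ), x₀)) rfl hΓ).isBigO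
      hχ.smooth).comp_tendsto hpx').trans hδ₁
    refine (e1.sub e2).congr' ?_ EventuallyEq.rfl
    filter_upwards [hflow, hsq hp1 (ε₀ / 2) (half_pos hε₀)] with i i1 i2
    have R := hR ((p i).1 ^ 2) ⟨i2.1, by linarith [i2.2]⟩
    have e3 := R.right_eq_of_flowsTo hH (sq_nonneg _) i1
    rw [R.section_right] at e3
    rw [e3]
    simp only [Function.comp]
    abel
  have hR0 := hR 0 ⟨le_rfl, hε₀⟩
  have hβ0 : ∀ y, bisectionMap β' Ψ θ 0 y = y :=
    bisectionMap_zero hΨ hθ hε₀ fun y => by rw [← hββ'.eq_zero, hR0.section_right]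
  have hBsm := contMDiffAt_bisectionMap hΨ hθ hβ' hdom x₀
  obtain ⟨J, hJ, hJl, -⟩ := exists_local_inverse rfl hBsm
    (injective_mfderiv_of_eq_id (E := E) hβ0 x₀)
  have hJ0 : J 0 (bisectionMap β' Ψ θ 0 x₀) = x₀ := hJl.self_of_nhds
  rw [hβ0] at hJ hJ0
  -- `x'` and `Y` are preimages, under the bisection map of `β'`, of a point close to `x` and of `x`
  -- itself. The local inverse `J` is Lipschitz, so replacing `x'` by `Y` costs an error of the same
  -- order.
  have hJlip : (fun i => g (bisectionMap α' Ψ θ (p i) (x' i)) -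
      g (bisectionMap α' Ψ θ (p i) (Y i))) =O[l]
      fun i => (p i).1 ^ (2 * (n + 1)) + (p i).2 ^ (2 * (m + 1)) := by
    have e0 : ContMDiffAt (𝓘(ℝ, ℝ × ℝ).prod 𝓘(ℝ, E)) 𝓘(ℝ, ℝ) ∞
        (fun q : (ℝ × ℝ) × M => g (bisectionMap α' Ψ θ q.1 (J q.1 q.2))) (0, x₀) := by
      refine (hg _).comp (0, x₀) ?_
      refine ContMDiffAt.comp (0, x₀) (g := fun q : (ℝ × ℝ) × M => bisectionMap α' Ψ θ q.1 q.2)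
        (f := fun q : (ℝ × ℝ) × M => (q.1, J q.1 q.2)) ?_ (contMDiffAt_fst.prodMk hJ)
      exact contMDiffAt_bisectionMap hΨ hθ hα' hdom _
    have hBx' : Tendsto (fun i => bisectionMap β' Ψ θ (p i) (x' i)) l (𝓝 x₀) := by
      have := hBsm.continuousAt.tendsto.comp hpx'
      rwa [hβ0] at this
    have e1 := isBigO_sub_of_contMDiffAt e0 hχ (p₁ := p) (p₂ := p)
      (y₁ := fun i => bisectionMap β' Ψ θ (p i) (x' i)) (y₂ := x) hp hp hBx' hx
    have e2 : (fun i => (p i - p i, χ (bisectionMap β' Ψ θ (p i) (x' i)) - χ (x i))) =O[l]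
        fun i => (p i).1 ^ (2 * (n + 1)) + (p i).2 ^ (2 * (m + 1)) := by
      simp only [sub_self]
      exact (isBigO_zero _ _).prod_left hβx
    refine (e1.trans e2).congr' ?_ EventuallyEq.rfl
    filter_upwards [hpx'.eventually hJl, (hp.prodMk_nhds hY).eventually hJl, hYx] with i i1 i2 i3
    rw [i3] at i2
    simp only [i1, i2]
  have e1 := (hcomp hα hg).trans hδ₂
  have e2 := ((hαα'.agreeToOrder (q₀ := ((0 : ℝ × ℝ), x₀)) rfl hΓ g hg).comp_tendsto hpx').trans hδ₁
  refine ((e1.sub e2).sub hJlip).congr_left fun i => ?_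
  simp only [Function.comp]
  ring

end FlowEstimate

/-! ### Uniform constants on compact sets -/

section UniformBounds

variable {E : Type*} [NormedAddCommGroup E] [NormedSpace ℝ E] [FiniteDimensional ℝ E]
  {M : Type*} [TopologicalSpace M] [ChartedSpace E M] [IsManifold 𝓘(ℝ, E) ∞ M] [T2Space M]
  {F : Type*} [NormedAddCommGroup F] [NormedSpace ℝ F] [FiniteDimensional ℝ F]
  {S : Type*} [TopologicalSpace S] [ChartedSpace F S] [IsManifold 𝓘(ℝ, F) ∞ S]
  {Ω : SymplecticForm F S} {π : PoissonTensor E M} {σ : M → S} {ε₀ h₀ : ℝ}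
  {α β α' β' : ℝ → S → M} {Ψ : OpenPartialHomeomorph (CotangentBundle E M) S}
  {θ : ℝ → ℝ → ∀ x : M, TangentSpace 𝓘(ℝ, E) x →L[ℝ] ℝ} {n m : ℕ}

theorem eventually_casimirsAgree (hε₀ : 0 < ε₀) (hh₀ : 0 < h₀)
    (hR : ∀ ε ∈ Ico 0 ε₀, IsRealizationData Ω (π.scale ε) (α ε) (β ε) σ)
    (hβ : IsSmoothFamily E F ε₀ β) (hΨ : IsTubularNeighbourhood (F := F) Ψ σ)
    (hθ : IsLagrangianFamily Ω Ψ ε₀ h₀ θ) (y₀ : M) :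
    ∀ᶠ q in 𝓝 ((0 : ℝ × ℝ), y₀), CasimirsAgree π α β Ψ θ q := by
  have h1 := (hθ.contMDiffAt_graph hΨ (zero_mem_sqDomain hε₀ hh₀) y₀).continuousAt.tendsto
  simp only [graphMap_zero hΨ hθ hε₀] at h1
  have h2 : Tendsto (fun q : (ℝ × ℝ) × M => q.1.1) (𝓝 ((0 : ℝ × ℝ), y₀)) (𝓝 0) :=
    (continuous_fst.comp continuous_fst).tendsto ((0 : ℝ × ℝ), y₀)
  exact ((h2.prodMk_nhds h1).eventually (eventually_casimir_eq hε₀ hβ hR hΨ y₀)).eventually_nhds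

theorem exists_local_flow_section [T2Space S] {H : M → ℝ} (hH : IsSmoothFun E H) (hε₀ : 0 < ε₀)
    (hR : ∀ ε ∈ Ico 0 ε₀, IsRealizationData Ω (π.scale ε) (α ε) (β ε) σ)
    (hα : IsSmoothFamily E F ε₀ α) (x₀ : M) :
    ∃ Z : (ℝ × ℝ) × M → S, Tendsto Z (𝓝 (0, x₀)) (𝓝 (σ x₀)) ∧
      ∀ᶠ q in 𝓝 ((0 : ℝ × ℝ), x₀),
        FlowsTo (Ω.hamVF (H ∘ α (q.1.1 ^ 2))) (q.1.2 ^ 2) (σ q.2) (Z q) := by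
  have hG : ∀ᶠ q in 𝓝 ((0 : ℝ), σ x₀), ContMDiffAt (𝓘(ℝ, ℝ).prod 𝓘(ℝ, F)) 𝓘(ℝ, ℝ) ∞
      (fun q : ℝ × S => (H ∘ α (q.1 ^ 2)) q.2) q := by
    have hc : Continuous fun q : ℝ × S => q.1 ^ 2 := by fun_prop
    filter_upwards [hc.continuousAt.eventually
      (isOpen_Iio.mem_nhds (show ((0 : ℝ), σ x₀).1 ^ 2 ∈ Iio ε₀ by simpa using hε₀))] with q hq
    exact (hH _).comp q (hα.contMDiffAt_sq hq q.2)
  obtain ⟨Z, hZ, hZf⟩ := Ω.exists_local_flow (G := fun a => H ∘ α (a ^ 2)) hG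
  have hσ := (hR 0 ⟨le_rfl, hε₀⟩).smooth_section.continuous
  have hq : Tendsto (fun q : (ℝ × ℝ) × M => (((q.1.1, q.1.2 ^ 2) : ℝ × ℝ), σ q.2))
      (𝓝 ((0 : ℝ × ℝ), x₀)) (𝓝 ((0 : ℝ × ℝ), σ x₀)) := by
    have : Continuous fun q : (ℝ × ℝ) × M => (((q.1.1, q.1.2 ^ 2) : ℝ × ℝ), σ q.2) := by fun_prop
    have h1 := this.tendsto ((0 : ℝ × ℝ), x₀)
    simpa [Prod.mk_zero_zero] using h1
  refine ⟨_, hZ.comp hq, ?_⟩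
  filter_upwards [hq.eventually hZf] with q hq
  exact hq (sq_nonneg _)

/-- The exact bisections induce the Hamiltonian flow. -/
theorem flowsTo_of_flowsTo_section {H : M → ℝ} (hH : IsSmoothFun E H)
    (hR : ∀ ε ∈ Ico 0 ε₀, IsRealizationData Ω (π.scale ε) (α ε) (β ε) σ) {ε h : ℝ}
    (hε : ε ∈ Ico 0 ε₀) (hh : 0 ≤ h) {x : M} {z : S}
    (hz : FlowsTo (Ω.hamVF (H ∘ α ε)) h (σ x) z) : FlowsTo (π.hamVF H) (ε * h) x (α ε z) := by
  have h1 := (hR ε hε).flowsTo_left hH hz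
  rw [(hR ε hε).section_left] at h1
  exact π.flowsTo_of_scale hε.1 hh h1

/-- The flow of `X_H` is obtained as the `α`-image of the flow in `S` started on the section. The
endpoint is kept in `U` to have a bound on functions there. -/
theorem eventually_exists_flowsTo [T2Space S] {H : M → ℝ} (hH : IsSmoothFun E H) (hε₀ : 0 < ε₀)
    (hR : ∀ ε ∈ Ico 0 ε₀, IsRealizationData Ω (π.scale ε) (α ε) (β ε) σ)
    (hα : IsSmoothFamily E F ε₀ α) {K U : Set M} (hK : IsCompact K) (hKU : K ⊆ interior U) :
    ∀ᶠ p in 𝓝 (0 : ℝ × ℝ), ∀ x ∈ K, ∃ y ∈ U, FlowsTo (π.hamVF H) (p.1 ^ 2 * p.2 ^ 2) x y := by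
  refine hK.eventually_forall_of_forall_eventually fun x₀ hx₀ => ?_
  obtain ⟨Z, hZ, hZf⟩ := exists_local_flow_section hH hε₀ hR hα x₀
  have h1 : Tendsto (fun q : (ℝ × ℝ) × M => q.1.1) (𝓝 ((0 : ℝ × ℝ), x₀)) (𝓝 0) :=
    (continuous_fst.comp continuous_fst).tendsto ((0 : ℝ × ℝ), x₀)
  have h2 := (hα.contMDiffAt_sq (t := 0) (by simpa using hε₀) (σ x₀)).continuousAt.tendsto.comp
    (h1.prodMk_nhds hZ)
  have h3 : α ((0 : ℝ) ^ 2) (σ x₀) = x₀ := by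
    simpa using (hR 0 ⟨le_rfl, hε₀⟩).section_left x₀
  simp only [h3] at h2
  have h4 : ∀ᶠ q : (ℝ × ℝ) × M in 𝓝 ((0 : ℝ × ℝ), x₀), q.1.1 ^ 2 < ε₀ :=
    (h1.pow 2).eventually (Iio_mem_nhds (by simpa using hε₀))
  filter_upwards [h2.eventually (mem_interior_iff_mem_nhds.1 (hKU hx₀)), hZf, h4] with q q1 q2 q3
  exact ⟨_, q1, flowsTo_of_flowsTo_section hH hR ⟨sq_nonneg _, q3⟩ (sq_nonneg _) q2⟩

variable [LocallyCompactSpace S]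

theorem exists_transportEval_bound
    (hR : ∀ ε ∈ Ico 0 ε₀, IsRealizationData Ω (π.scale ε) (α ε) (β ε) σ)
    (hα : IsSmoothFamily E F ε₀ α) (hβ : IsSmoothFamily E F ε₀ β)
    (hα' : IsSmoothFamily E F ε₀ α') (hβ' : IsSmoothFamily E F ε₀ β')
    (hαα' : ApproxToOrder E n α α') (hββ' : ApproxToOrder E n β β')
    (hΨ : IsTubularNeighbourhood (F := F) Ψ σ) (hθ : IsLagrangianFamily Ω Ψ ε₀ h₀ θ)
    {Q : Set (ℝ × ℝ)} (hQ : IsCompact Q) (hQd : Q ⊆ sqDomain ε₀ h₀) {W : Set M} (hW : IsCompact W)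
    (hcas : ∀ p ∈ Q, ∀ y ∈ W, CasimirsAgree π α β Ψ θ (p, y))
    (hinj : ∀ p ∈ Q, ∀ y ∈ W,
      Function.Injective (mfderiv 𝓘(ℝ, E) 𝓘(ℝ, E) (bisectionMap α Ψ θ p) y))
    (hinj' : ∀ p ∈ Q, ∀ y ∈ W,
      Function.Injective (mfderiv 𝓘(ℝ, E) 𝓘(ℝ, E) (bisectionMap α' Ψ θ p) y))
    {f g : M → ℝ} (hf : IsSmoothFun E f) (hg : IsSmoothFun E g) :
    ∃ C : ℝ, ∀ p ∈ Q, ∀ y ∈ W,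
      |π.transportEval (bisectionMap α' Ψ θ p) (bisectionMap β' Ψ θ p) f g y -
        π.bracket f g (bisectionMap β' Ψ θ p y)| ≤ C * p.1 ^ (2 * (n + 1)) := by
  obtain ⟨C, -, hC⟩ := exists_bound_of_isBigO (hQ.prod hW)
    (δ := fun q : (ℝ × ℝ) × M => q.1.1 ^ (2 * (n + 1)))
    (fun q _ => (even_two_mul (n + 1)).pow_nonneg q.1.1)
    (fun q hq => (isBigO_transportEval_sub_bracket hR hα hβ hα' hβ' hαα' hββ' hΨ hθ (hQd hq.1)
      (hcas q.1 hq.1 q.2 hq.2) (hinj q.1 hq.1 q.2 hq.2) (hinj' q.1 hq.1 q.2 hq.2)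
      hf hg).mono nhdsWithin_le_nhds)
  exact ⟨C, fun p hp y hy => hC (p, y) ⟨hp, hy⟩⟩

theorem exists_casimir_bound
    (hα' : IsSmoothFamily E F ε₀ α') (hβ' : IsSmoothFamily E F ε₀ β')
    (hαα' : ApproxToOrder E n α α') (hββ' : ApproxToOrder E n β β')
    (hΨ : IsTubularNeighbourhood (F := F) Ψ σ) (hθ : IsLagrangianFamily Ω Ψ ε₀ h₀ θ)
    {Q : Set (ℝ × ℝ)} (hQ : IsCompact Q) (hQd : Q ⊆ sqDomain ε₀ h₀) {W : Set M} (hW : IsCompact W)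
    (hcas : ∀ p ∈ Q, ∀ y ∈ W, CasimirsAgree π α β Ψ θ (p, y))
    {c : M → ℝ} (hc : π.IsCasimir c) :
    ∃ C : ℝ, ∀ p ∈ Q, ∀ y ∈ W,
      |c (bisectionMap α' Ψ θ p y) - c (bisectionMap β' Ψ θ p y)| ≤ C * p.1 ^ (2 * (n + 1)) := by
  obtain ⟨C, -, hC⟩ := exists_bound_of_isBigO (hQ.prod hW)
    (δ := fun q : (ℝ × ℝ) × M => q.1.1 ^ (2 * (n + 1)))
    (fun q _ => (even_two_mul (n + 1)).pow_nonneg q.1.1)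
    (fun q hq => (isBigO_casimir_sub hα' hβ' hαα' hββ' hΨ hθ (hQd hq.1)
      (hcas q.1 hq.1 q.2 hq.2) hc).mono nhdsWithin_le_nhds)
  exact ⟨C, fun p hp y hy => hC (p, y) ⟨hp, hy⟩⟩

/-- `Y` and `T` are choices without any continuity assumed. Near `p = 0` the estimate of
`isBigO_flow_sub` applies; elsewhere the right-hand side is bounded below and both terms on the left
take values in bounded sets. -/
theorem exists_flow_bound [T2Space S] {H : M → ℝ} (hH : IsSmoothFun E H) (hε₀ : 0 < ε₀)
    (hh₀ : 0 < h₀)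
    (hR : ∀ ε ∈ Ico 0 ε₀, IsRealizationData Ω (π.scale ε) (α ε) (β ε) σ)
    (hα : IsSmoothFamily E F ε₀ α) (hβ : IsSmoothFamily E F ε₀ β)
    (hα' : IsSmoothFamily E F ε₀ α') (hβ' : IsSmoothFamily E F ε₀ β')
    (hαα' : ApproxToOrder E n α α') (hββ' : ApproxToOrder E n β β')
    (hΨ : IsTubularNeighbourhood (F := F) Ψ σ) (hθ : IsLagrangianFamily Ω Ψ ε₀ h₀ θ)
    (hθL : ApproxLagrangian Ω Ψ σ α H m θ) {K V U : Set M} (hK : IsCompact K) (hU : IsCompact U)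
    (hV : IsOpen V) (hVc : IsCompact (closure V)) (hKV : K ⊆ V)
    {Q : Set (ℝ × ℝ)} (hQ : IsCompact Q) (hQd : Q ⊆ sqDomain ε₀ h₀)
    (hinj : ∀ p ∈ Q, InjOn (bisectionMap β' Ψ θ p) (closure V))
    {Y T : (ℝ × ℝ) × M → M}
    (hY : ∀ p ∈ Q, ∀ x ∈ K, Y (p, x) ∈ V ∧ bisectionMap β' Ψ θ p (Y (p, x)) = x)
    (hT : ∀ p ∈ Q, ∀ x ∈ K, T (p, x) ∈ U ∧
      FlowsTo (π.hamVF H) (p.1 ^ 2 * p.2 ^ 2) x (T (p, x))) {g : M → ℝ} (hg : IsSmoothFun E g) :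
    ∃ C : ℝ, 0 ≤ C ∧ ∀ p ∈ Q, ∀ x ∈ K,
      |g (bisectionMap α' Ψ θ p (Y (p, x))) - g (T (p, x))| ≤
        C * (p.1 ^ (2 * (n + 1)) + p.2 ^ (2 * (m + 1))) := by
  have hδ0 : ∀ p : ℝ × ℝ, 0 ≤ p.1 ^ (2 * (n + 1)) + p.2 ^ (2 * (m + 1)) := fun p =>
    add_nonneg ((even_two_mul (n + 1)).pow_nonneg p.1) ((even_two_mul (m + 1)).pow_nonneg p.2)
  have hmain : ∀ q ∈ Q ×ˢ K, (fun q : (ℝ × ℝ) × M =>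
      g (bisectionMap α' Ψ θ q.1 (Y q)) - g (T q)) =O[𝓝[Q ×ˢ K] q]
      fun q => q.1.1 ^ (2 * (n + 1)) + q.1.2 ^ (2 * (m + 1)) := by
    rintro ⟨p₀, x₀⟩ ⟨hp₀, hx₀⟩
    have hmem : ∀ᶠ q in 𝓝[Q ×ˢ K] (p₀, x₀), q.1 ∈ Q ∧ q.2 ∈ K := self_mem_nhdsWithin
    by_cases hp : p₀ = 0
    · subst hp
      have hfst : Tendsto (fun q : (ℝ × ℝ) × M => q.1) (𝓝[Q ×ˢ K] (0, x₀)) (𝓝 0) :=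
        (continuous_fst.tendsto ((0 : ℝ × ℝ), x₀)).mono_left nhdsWithin_le_nhds
      have hsnd : Tendsto (fun q : (ℝ × ℝ) × M => q.2) (𝓝[Q ×ˢ K] (0, x₀)) (𝓝 x₀) :=
        (continuous_snd.tendsto ((0 : ℝ × ℝ), x₀)).mono_left nhdsWithin_le_nhds
      have hβ0 : ∀ y, bisectionMap β' Ψ θ 0 y = y :=
        bisectionMap_zero hΨ hθ hε₀ fun y => by
          rw [← hββ'.eq_zero, (hR 0 ⟨le_rfl, hε₀⟩).section_right]
      -- Continuity of `Y` at `p = 0` is automatic: the equation has a solution near `x₀`, and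
      -- injectivity on `closure V` makes it the chosen one.
      have hYt : Tendsto Y (𝓝[Q ×ˢ K] (0, x₀)) (𝓝 x₀) := by
        intro O hO
        change ∀ᶠ q in 𝓝[Q ×ˢ K] ((0 : ℝ × ℝ), x₀), Y q ∈ O
        have e1 := eventually_exists_preimage
          (fun y => contMDiffAt_bisectionMap hΨ hθ hβ' (zero_mem_sqDomain hε₀ hh₀) y) hβ0
          (inter_mem hO (hV.mem_nhds (hKV hx₀)))
        filter_upwards [e1.filter_mono nhdsWithin_le_nhds, hmem] with q q1 q2
        obtain ⟨y, hy, hyq⟩ := q1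
        have e2 := hY q.1 q2.1 q.2 q2.2
        have e3 : Y q = y := hinj q.1 q2.1 (subset_closure e2.1) (subset_closure hy.2)
          (e2.2.trans hyq.symm)
        rw [e3]
        exact hy.1
      obtain ⟨Z, hZ, hZf⟩ := exists_local_flow_section hH hε₀ hR hα x₀
      have e1 := isBigO_flow_sub hH hε₀ hh₀ hR hα hβ hα' hβ' hαα' hββ' hΨ hθ hθL hK hg hfst hsnd
        (hmem.mono fun q hq => hq.2) hYt (hmem.mono fun q hq => (hY q.1 hq.1 q.2 hq.2).2)
        (hZ.mono_left nhdsWithin_le_nhds) (hZf.filter_mono nhdsWithin_le_nhds)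
      refine e1.congr' ?_ EventuallyEq.rfl
      filter_upwards [hmem, hZf.filter_mono nhdsWithin_le_nhds] with q q1 q2
      have e2 := flowsTo_of_flowsTo_section hH hR ⟨sq_nonneg q.1.1, (hQd q1.1).1⟩
        (sq_nonneg q.1.2) q2
      have e3 : T q = α (q.1.1 ^ 2) (Z q) := π.flowsTo_unique hH
        (mul_nonneg (sq_nonneg _) (sq_nonneg _)) (hT q.1 q1.1 q.2 q1.2).2 e2
      rw [e3]
    -- If only one of `a`, `b` vanishes, the sum on the right is still positive; this is why the
    -- full estimate is needed at the origin alone.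
    · have hδ : Tendsto (fun q : (ℝ × ℝ) × M => q.1.1 ^ (2 * (n + 1)) + q.1.2 ^ (2 * (m + 1)))
          (𝓝[Q ×ˢ K] (p₀, x₀)) (𝓝 (p₀.1 ^ (2 * (n + 1)) + p₀.2 ^ (2 * (m + 1)))) := by
        have : Continuous fun q : (ℝ × ℝ) × M =>
          q.1.1 ^ (2 * (n + 1)) + q.1.2 ^ (2 * (m + 1)) := by fun_prop
        exact (this.tendsto (p₀, x₀)).mono_left nhdsWithin_le_nhds
      have hpos : p₀.1 ^ (2 * (n + 1)) + p₀.2 ^ (2 * (m + 1)) ≠ 0 := by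
        intro h0
        have e1 := (even_two_mul (n + 1)).pow_nonneg p₀.1
        have e2 := (even_two_mul (m + 1)).pow_nonneg p₀.2
        have e3 : p₀.1 ^ (2 * (n + 1)) = 0 := by linarith
        have e4 : p₀.2 ^ (2 * (m + 1)) = 0 := by linarith
        exact hp (Prod.ext (eq_zero_of_pow_eq_zero e3) (eq_zero_of_pow_eq_zero e4))
      refine IsBigO.trans ?_ (one_isBigO_of_tendsto hδ hpos)
      obtain ⟨C₁, hC₁⟩ := (hQ.prod hVc).exists_bound_of_continuousOn
        (f := fun q : (ℝ × ℝ) × M => g (bisectionMap α' Ψ θ q.1 q.2)) fun q hq =>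
          (hg.continuous.continuousAt.comp
            (contMDiffAt_bisectionMap hΨ hθ hα' (hQd hq.1) q.2).continuousAt).continuousWithinAt
      obtain ⟨C₂, hC₂⟩ := hU.exists_bound_of_continuousOn hg.continuous.continuousOn
      refine IsBigO.of_bound (C₁ + C₂) ?_
      filter_upwards [hmem] with q hq
      rw [norm_one, mul_one]
      refine (norm_sub_le _ _).trans (add_le_add ?_ (hC₂ _ (hT q.1 hq.1 q.2 hq.2).1))
      exact hC₁ (q.1, Y q) ⟨hq.1, subset_closure (hY q.1 hq.1 q.2 hq.2).1⟩
  obtain ⟨C, hC0, hC⟩ := exists_bound_of_isBigO (hQ.prod hK) (fun q _ => hδ0 q.1) hmain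
  exact ⟨C, hC0, fun p hp x hx => hC (p, x) ⟨hp, hx⟩⟩

end UniformBounds

end PoissonIntegrator

end

/-! ### Assembly of the theorem -/

theorem theorem2
    {E : Type*} [NormedAddCommGroup E] [NormedSpace ℝ E] [FiniteDimensional ℝ E]
    {M : Type*} [TopologicalSpace M] [ChartedSpace E M] [IsManifold 𝓘(ℝ, E) ∞ M]
    [T2Space M] [SecondCountableTopology M]
    {F : Type*} [NormedAddCommGroup F] [NormedSpace ℝ F] [FiniteDimensional ℝ F]
    {S : Type*} [TopologicalSpace S] [ChartedSpace F S] [IsManifold 𝓘(ℝ, F) ∞ S]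
    [T2Space S] [SecondCountableTopology S]
    (π : PoissonTensor E M) (H : M → ℝ) (hH : IsSmoothFun E H)
    -- the exact realization data
    (Ω : SymplecticForm F S) (σ : M → S) (ε₀ h₀ : ℝ) (hε₀ : 0 < ε₀) (hh₀ : 0 < h₀)
    (α β : ℝ → S → M) (hα : IsSmoothFamily E F ε₀ α) (hβ : IsSmoothFamily E F ε₀ β)
    (hR : ∀ ε ∈ Set.Ico 0 ε₀, IsRealizationData Ω (π.scale ε) (α ε) (β ε) σ)
    -- the approximate realization maps
    (n m : ℕ)
    (α' β' : ℝ → S → M) (hα' : IsSmoothFamily E F ε₀ α') (hβ' : IsSmoothFamily E F ε₀ β')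
    (hαα' : ApproxToOrder E n α α') (hββ' : ApproxToOrder E n β β')
    -- the approximate Lagrangians
    (Ψ : OpenPartialHomeomorph (CotangentBundle E M) S) (hΨ : IsTubularNeighbourhood (F := F) Ψ σ)
    (θ : ℝ → ℝ → ∀ x : M, TangentSpace 𝓘(ℝ, E) x →L[ℝ] ℝ)
    (hθ : IsLagrangianFamily Ω Ψ ε₀ h₀ θ)
    (hθL : ApproxLagrangian Ω Ψ σ α H m θ)
    -- the compact set on which the induced map is considered
    (V : Set M) (hV : IsOpen V) (hVc : IsCompact (closure V))
    (K : Set M) (hK : IsCompact K) (hKV : K ⊆ V) :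
    ∃ ε₁ ∈ Set.Ioo 0 ε₀, ∃ h₁ ∈ Set.Ioo 0 h₀,
      let L : ℝ → ℝ → Set S := fun ε h => graphMap Ψ (θ ε h) '' V
      let φ : ℝ → ℝ → M → M := fun ε h => inducedMap (α' ε) (β' ε) (L ε h)
      -- the approximate Lagrangian is a bisection
      (∀ ε ∈ Set.Icc 0 ε₁, ∀ h ∈ Set.Icc 0 h₁,
        (∃ U : Set M, K ⊆ U ∧ RestrictsToDiffeo E F (α' ε) (L ε h) U) ∧
        (∃ U : Set M, K ⊆ U ∧ RestrictsToDiffeo E F (β' ε) (L ε h) U)) ∧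
      -- the induced map preserves the Poisson tensor to order `n` in `ε`
      (∀ f g : M → ℝ, IsSmoothFun E f → IsSmoothFun E g →
        ∃ C : ℝ, ∀ ε ∈ Set.Icc 0 ε₁, ∀ h ∈ Set.Icc 0 h₁, ∀ x ∈ K,
          |π.pullbackEval (φ ε h) x (mvfderiv 𝓘(ℝ, E) f x) (mvfderiv 𝓘(ℝ, E) g x)
            - π.eval x (mvfderiv 𝓘(ℝ, E) f x) (mvfderiv 𝓘(ℝ, E) g x)| ≤ C * ε ^ (n + 1)) ∧
      -- the induced map preserves the Casimirs to order `n` in `ε`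
      (∀ c : M → ℝ, π.IsCasimir c →
        ∃ C : ℝ, ∀ ε ∈ Set.Icc 0 ε₁, ∀ h ∈ Set.Icc 0 h₁, ∀ x ∈ K,
          |c (φ ε h x) - c x| ≤ C * ε ^ (n + 1)) ∧
      -- the Hamiltonian flow is defined up to time `ε h`, and the induced map approximates it
      (∀ ε ∈ Set.Icc 0 ε₁, ∀ h ∈ Set.Icc 0 h₁, ∀ x ∈ K,
        ∃ y, FlowsTo (π.hamVF H) (ε * h) x y) ∧
      (∀ g : M → ℝ, IsSmoothFun E g →
        ∃ C : ℝ, ∀ ε ∈ Set.Icc 0 ε₁, ∀ h ∈ Set.Icc 0 h₁, ∀ x ∈ K, ∀ y,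
          FlowsTo (π.hamVF H) (ε * h) x y →
            |g (φ ε h x) - g y| ≤ C * (ε ^ (n + 1) + h ^ (m + 1))) ∧
      -- the combined order
      (∀ g : M → ℝ, IsSmoothFun E g →
        ∃ C : ℝ, ∀ ε ∈ Set.Icc 0 ε₁, ∀ h ∈ Set.Icc 0 h₁, ∀ x ∈ K, ∀ y,
          FlowsTo (π.hamVF H) (ε * h) x y →
            |g (φ ε h x) - g y| ≤ C * (max ε h) ^ (min n m + 1)) := by
  have : LocallyCompactSpace S := ChartedSpace.locallyCompactSpace F S
  have : LocallyCompactSpace M := ChartedSpace.locallyCompactSpace E M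
  have hdom := zero_mem_sqDomain hε₀ hh₀
  have hR0 := hR 0 ⟨le_rfl, hε₀⟩
  have hsm : ∀ {a : ℝ → S → M}, IsSmoothFamily E F ε₀ a → ∀ y, ContMDiffAt
      (𝓘(ℝ, ℝ × ℝ).prod 𝓘(ℝ, E)) 𝓘(ℝ, E) ∞
      (fun q : (ℝ × ℝ) × M => bisectionMap a Ψ θ q.1 q.2) (0, y) := fun ha y =>
    contMDiffAt_bisectionMap hΨ hθ ha hdom y
  have hA0 : ∀ y, bisectionMap α Ψ θ 0 y = y := bisectionMap_zero hΨ hθ hε₀ hR0.section_left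
  have hA0' : ∀ y, bisectionMap α' Ψ θ 0 y = y :=
    bisectionMap_zero hΨ hθ hε₀ fun y => by rw [← hαα'.eq_zero, hR0.section_left]
  have hB0' : ∀ y, bisectionMap β' Ψ θ 0 y = y :=
    bisectionMap_zero hΨ hθ hε₀ fun y => by rw [← hββ'.eq_zero, hR0.section_right]
  -- A compact neighbourhood of `K` to contain the endpoints of the flow.
  obtain ⟨U, hU, hKU⟩ := exists_compact_superset hK
  have hdomev : ∀ᶠ p in 𝓝 (0 : ℝ × ℝ), p ∈ sqDomain ε₀ h₀ := isOpen_sqDomain.mem_nhds hdom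
  have hcasev : ∀ᶠ p in 𝓝 (0 : ℝ × ℝ), ∀ y ∈ closure V, CasimirsAgree π α β Ψ θ (p, y) :=
    hVc.eventually_forall_of_forall_eventually fun y _ =>
      eventually_casimirsAgree hε₀ hh₀ hR hβ hΨ hθ y
  have hgood := ((((hdomev.and hcasev).and
    (eventually_forall_injective_mfderiv (hsm hα) hA0 hVc)).and
    ((eventually_forall_injective_mfderiv (hsm hα') hA0' hVc).and
      (eventually_forall_injective_mfderiv (hsm hβ') hB0' hVc))).and
    ((eventually_injOn (hsm hα') hA0' hVc).and (eventually_injOn (hsm hβ') hB0' hVc))).and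
    (((eventually_subset_image (hsm hα') hA0' hK hV hKV).and
      (eventually_subset_image (hsm hβ') hB0' hK hV hKV)).and
    (eventually_exists_flowsTo hH hε₀ hR hα hK hKU))
  obtain ⟨r, hr, hball⟩ := Metric.eventually_nhds_iff_ball.1 hgood
  -- Below `r`, so that the compact square `Q` lies in the ball where all conditions hold; at most
  -- `1`, so that powers decrease with the exponent in the combined estimate.
  set ρ := min (r / 2) 1 with hρdef
  have hρ : 0 < ρ := lt_min (half_pos hr) one_pos
  have hρ1 : ρ ≤ 1 := min_le_right _ _
  have hρr : ρ < r := (min_le_left _ _).trans_lt (half_lt_self hr)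
  let Q : Set (ℝ × ℝ) := Set.Icc 0 ρ ×ˢ Set.Icc 0 ρ
  have hQ : IsCompact Q := isCompact_Icc.prod isCompact_Icc
  have hQball : ∀ p ∈ Q, p ∈ Metric.ball (0 : ℝ × ℝ) r := by
    rintro ⟨a, b⟩ ⟨ha, hb⟩
    have ha : a ∈ Set.Icc 0 ρ := ha
    have hb : b ∈ Set.Icc 0 ρ := hb
    rw [mem_ball_zero_iff, Prod.norm_def, max_lt_iff, Real.norm_of_nonneg ha.1,
      Real.norm_of_nonneg hb.1]
    exact ⟨ha.2.trans_lt hρr, hb.2.trans_lt hρr⟩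
  have hQd : Q ⊆ sqDomain ε₀ h₀ := fun p hp => (hball p (hQball p hp)).1.1.1.1.1
  have hcas : ∀ p ∈ Q, ∀ y ∈ closure V, CasimirsAgree π α β Ψ θ (p, y) := fun p hp =>
    (hball p (hQball p hp)).1.1.1.1.2
  have hdA : ∀ p ∈ Q, ∀ y ∈ closure V,
      Function.Injective (mfderiv 𝓘(ℝ, E) 𝓘(ℝ, E) (bisectionMap α Ψ θ p) y) := fun p hp =>
    (hball p (hQball p hp)).1.1.1.2
  have hdA' : ∀ p ∈ Q, ∀ y ∈ closure V,
      Function.Injective (mfderiv 𝓘(ℝ, E) 𝓘(ℝ, E) (bisectionMap α' Ψ θ p) y) := fun p hp =>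
    (hball p (hQball p hp)).1.1.2.1
  have hdB' : ∀ p ∈ Q, ∀ y ∈ closure V,
      Function.Injective (mfderiv 𝓘(ℝ, E) 𝓘(ℝ, E) (bisectionMap β' Ψ θ p) y) := fun p hp =>
    (hball p (hQball p hp)).1.1.2.2
  have hinjA : ∀ p ∈ Q, Set.InjOn (bisectionMap α' Ψ θ p) (closure V) := fun p hp =>
    (hball p (hQball p hp)).1.2.1
  have hinjB : ∀ p ∈ Q, Set.InjOn (bisectionMap β' Ψ θ p) (closure V) := fun p hp =>
    (hball p (hQball p hp)).1.2.2
  have hKA : ∀ p ∈ Q, K ⊆ bisectionMap α' Ψ θ p '' V := fun p hp =>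
    (hball p (hQball p hp)).2.1.1
  have hKB : ∀ p ∈ Q, K ⊆ bisectionMap β' Ψ θ p '' V := fun p hp =>
    (hball p (hQball p hp)).2.1.2
  have hflow : ∀ p ∈ Q, ∀ x ∈ K, ∃ y ∈ U, FlowsTo (π.hamVF H) (p.1 ^ 2 * p.2 ^ 2) x y :=
    fun p hp => (hball p (hQball p hp)).2.2
  have hρQ : (ρ, ρ) ∈ Q := ⟨⟨hρ.le, le_rfl⟩, ⟨hρ.le, le_rfl⟩⟩
  have hρ2 : 0 < ρ ^ 2 := pow_pos hρ 2
  -- the parameters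
  have hsqrt : ∀ ε ∈ Set.Icc 0 (ρ ^ 2), ∀ h ∈ Set.Icc 0 (ρ ^ 2),
      ∃ p ∈ Q, p.1 ^ 2 = ε ∧ p.2 ^ 2 = h := fun ε hε h hh =>
    ⟨(√ε, √h), ⟨⟨Real.sqrt_nonneg _, (Real.sqrt_le_left hρ.le).2 hε.2⟩,
      ⟨Real.sqrt_nonneg _, (Real.sqrt_le_left hρ.le).2 hh.2⟩⟩, Real.sq_sqrt hε.1, Real.sq_sqrt hh.1⟩
  have hind : ∀ p ∈ Q, ∀ y ∈ V, inducedMap (α' (p.1 ^ 2)) (β' (p.1 ^ 2))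
      (graphMap Ψ (θ (p.1 ^ 2) (p.2 ^ 2)) '' V) (bisectionMap β' Ψ θ p y) =
      bisectionMap α' Ψ θ p y := fun p hp y hy =>
    inducedMap_eq (α := α' (p.1 ^ 2)) (β := β' (p.1 ^ 2))
      (Γ := graphMap Ψ (θ (p.1 ^ 2) (p.2 ^ 2))) ((hinjB p hp).mono subset_closure) hy
  have hslice : ∀ {a : ℝ → S → M}, IsSmoothFamily E F ε₀ a → ∀ p ∈ Q, ∀ y,
      ContMDiffAt 𝓘(ℝ, E) 𝓘(ℝ, E) ∞ (bisectionMap a Ψ θ p) y := fun ha p hp y =>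
    contMDiffAt_slice (contMDiffAt_bisectionMap hΨ hθ ha (hQd hp) y)
  have hflowbound : ∀ g : M → ℝ, IsSmoothFun E g →
      ∃ C : ℝ, 0 ≤ C ∧ ∀ ε ∈ Set.Icc 0 (ρ ^ 2), ∀ h ∈ Set.Icc 0 (ρ ^ 2), ∀ x ∈ K, ∀ y,
        FlowsTo (π.hamVF H) (ε * h) x y →
          |g (inducedMap (α' ε) (β' ε) (graphMap Ψ (θ ε h) '' V) x) - g y| ≤
            C * (ε ^ (n + 1) + h ^ (m + 1)) := by
    intro g hg
    -- Outside `Q × K` any value will do; it only makes the choice total.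
    have hYex : ∀ q : (ℝ × ℝ) × M, ∃ y, q.1 ∈ Q → q.2 ∈ K →
        y ∈ V ∧ bisectionMap β' Ψ θ q.1 y = q.2 := fun q => by
      by_cases h1 : q.1 ∈ Q ∧ q.2 ∈ K
      · obtain ⟨y, hy⟩ := hKB q.1 h1.1 h1.2
        exact ⟨y, fun _ _ => hy⟩
      · exact ⟨q.2, fun h2 h3 => (h1 ⟨h2, h3⟩).elim⟩
    have hTex : ∀ q : (ℝ × ℝ) × M, ∃ y, q.1 ∈ Q → q.2 ∈ K →
        y ∈ U ∧ FlowsTo (π.hamVF H) (q.1.1 ^ 2 * q.1.2 ^ 2) q.2 y := fun q => by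
      by_cases h1 : q.1 ∈ Q ∧ q.2 ∈ K
      · obtain ⟨y, hy⟩ := hflow q.1 h1.1 q.2 h1.2
        exact ⟨y, fun _ _ => hy⟩
      · exact ⟨q.2, fun h2 h3 => (h1 ⟨h2, h3⟩).elim⟩
    choose Y hY using hYex
    choose T hT using hTex
    obtain ⟨C, hC0, hC⟩ := exists_flow_bound hH hε₀ hh₀ hR hα hβ hα' hβ' hαα' hββ' hΨ hθ hθL hK hU
      hV hVc hKV hQ hQd hinjB (fun p hp x hx => hY (p, x) hp hx)
      (fun p hp x hx => hT (p, x) hp hx) hg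
    refine ⟨C, hC0, fun ε hε h hh x hx y hy => ?_⟩
    obtain ⟨p, hp, rfl, rfl⟩ := hsqrt ε hε h hh
    have e1 := hC p hp x hx
    have e2 := hY (p, x) hp hx
    have e3 : T (p, x) = y := π.flowsTo_unique hH (mul_nonneg (sq_nonneg _) (sq_nonneg _))
      (hT (p, x) hp hx).2 hy
    have e4 := hind p hp _ e2.1
    simp only at e2
    rw [e2.2] at e4
    rw [e4, ← pow_mul, ← pow_mul, ← e3]
    exact e1
  -- The square `[0, ρ] ^ 2` in `(a, b)` corresponds to `[0, ρ ^ 2] ^ 2` in `(ε, h)`.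
  refine ⟨ρ ^ 2, ⟨hρ2, (hQd hρQ).1⟩, ρ ^ 2, ⟨hρ2, (hQd hρQ).2⟩, ?_⟩
  intro L φ
  refine ⟨?_, ?_, ?_, ?_, ?_, ?_⟩
  · intro ε hε h hh
    obtain ⟨p, hp, rfl, rfl⟩ := hsqrt ε hε h hh
    have hΓ : ∀ y ∈ V, ContMDiffAt 𝓘(ℝ, E) 𝓘(ℝ, F) ∞ (graphMap Ψ (θ (p.1 ^ 2) (p.2 ^ 2))) y :=
      fun y _ => contMDiffAt_slice (G := fun p : ℝ × ℝ => graphMap Ψ (θ (p.1 ^ 2) (p.2 ^ 2)))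
        (hθ.contMDiffAt_graph hΨ (hQd hp) y)
    exact ⟨⟨_, hKA p hp, restrictsToDiffeo_of_injOn hV hΓ (fun y _ => hslice hα' p hp y)
        ((hinjA p hp).mono subset_closure) fun y hy => hdA' p hp y (subset_closure hy)⟩,
      ⟨_, hKB p hp, restrictsToDiffeo_of_injOn hV hΓ (fun y _ => hslice hβ' p hp y)
        ((hinjB p hp).mono subset_closure) fun y hy => hdB' p hp y (subset_closure hy)⟩⟩
  · intro f g hf hg
    obtain ⟨C, hC⟩ := exists_transportEval_bound hR hα hβ hα' hβ' hαα' hββ' hΨ hθ hQ hQd hVc hcas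
      hdA hdA' hf hg
    refine ⟨C, fun ε hε h hh x hx => ?_⟩
    obtain ⟨p, hp, rfl, rfl⟩ := hsqrt ε hε h hh
    obtain ⟨y, hy, rfl⟩ := hKB p hp hx
    have e1 := hC p hp y (subset_closure hy)
    -- The covectors are those of `PoissonTensor.transportEval`, so the pullback is the quantity
    -- already estimated.
    have e2 := pullbackEval_inducedMap π (α := α' (p.1 ^ 2)) (β := β' (p.1 ^ 2))
      (Γ := graphMap Ψ (θ (p.1 ^ 2) (p.2 ^ 2))) hV ((hinjB p hp).mono subset_closure) hy
      (hslice hα' p hp y) (hslice hβ' p hp y) (hdA' p hp y (subset_closure hy))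
      (hdB' p hp y (subset_closure hy)) hf hg _ _
      (fun w => comp_inverse_apply (hdA' p hp y (subset_closure hy))
        (mvfderiv 𝓘(ℝ, E) (fun y => f (bisectionMap β' Ψ θ p y)) y) w)
      (fun w => comp_inverse_apply (hdA' p hp y (subset_closure hy))
        (mvfderiv 𝓘(ℝ, E) (fun y => g (bisectionMap β' Ψ θ p y)) y) w)
    rw [← pow_mul]
    refine le_of_eq_of_le (congrArg abs (congrArg₂ (· - ·) e2 rfl)) e1
  · intro c hc
    obtain ⟨C, hC⟩ := exists_casimir_bound hα' hβ' hαα' hββ' hΨ hθ hQ hQd hVc hcas hc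
    refine ⟨C, fun ε hε h hh x hx => ?_⟩
    obtain ⟨p, hp, rfl, rfl⟩ := hsqrt ε hε h hh
    obtain ⟨y, hy, rfl⟩ := hKB p hp hx
    have e1 := hC p hp y (subset_closure hy)
    rw [← hind p hp y hy] at e1
    rw [← pow_mul]
    exact e1
  · intro ε hε h hh x hx
    obtain ⟨p, hp, rfl, rfl⟩ := hsqrt ε hε h hh
    obtain ⟨y, -, hy⟩ := hflow p hp x hx
    exact ⟨y, hy⟩
  · intro g hg
    obtain ⟨C, -, hC⟩ := hflowbound g hg
    exact ⟨C, hC⟩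
  · intro g hg
    obtain ⟨C, hC0, hC⟩ := hflowbound g hg
    -- Each of the two powers is at most the power of `max ε h`.
    refine ⟨C * 2, fun ε hε h hh x hx y hy => (hC ε hε h hh x hx y hy).trans ?_⟩
    have hm0 : 0 ≤ max ε h := hε.1.trans (le_max_left _ _)
    have hm1 : max ε h ≤ 1 := (max_le hε.2 hh.2).trans (pow_le_one₀ hρ.le hρ1)
    have e1 : ε ^ (n + 1) ≤ max ε h ^ (min n m + 1) :=
      (pow_le_pow_left₀ hε.1 (le_max_left _ _) _).trans
        (pow_le_pow_of_le_one hm0 hm1 (Nat.succ_le_succ (min_le_left _ _)))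
    have e2 : h ^ (m + 1) ≤ max ε h ^ (min n m + 1) :=
      (pow_le_pow_left₀ hh.1 (le_max_right _ _) _).trans
        (pow_le_pow_of_le_one hm0 hm1 (Nat.succ_le_succ (min_le_right _ _)))
    rw [mul_assoc]
    exact mul_le_mul_of_nonneg_left (by linarith) hC0
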